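/- Let $\Gamma$ be the chain graph made of rings $j\in\mathbb Z$ of circumference $2\pi$: ring $j$ consists of an upper and a lower semicircle, each identified with $[0,\pi]$ and joining the vertex $v_j$ (at $0$) to the vertex $v_{j+1}$ (at $\pi$), so neighbouring rings touch at the vertices. For real sequences $\boldsymbol\alpha=(\boldsymbol\alpha_j)_{j\in\mathbb Z}$ (coupling at $v_j$) and $\mathbf A=(\mathbf A_j)_{j\in\mathbb Z}$ (magnetic field on ring $j$), let $-\Delta_{\boldsymbol\alpha,\mathbf A}$ be the operator in $L^2(\Gamma)$ acting as $-\mathscr D^2$ on each edge, with $\mathscr D=\frac{d}{dx}+i\mathbf A_j$ on the upper and $\mathscr D=\frac{d}{dx}-i\mathbf A_j$ on the lower semicircle of ring $j$; its domain consists of all $u\in L^2(\Gamma)$ which are in $H^2$ on each edge, satisfy $\mathscr D^2u\in L^2(\Gamma)$, are continuous at every vertex, and satisfy at every $v_j$ the $\delta$-condition that the sum of the outgoing quasiderivatives equals $\boldsymbol\alpha_j u(v_j)$, i.e. $\mathscr D\psi_j(0)+\mathscr D\varphi_j(0)-\mathscr D\psi_{j-1}(\pi)-\mathscr D\varphi_{j-1}(\pi)=\boldsymbol\alpha_j\psi_j(0)$,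 where $\psi_j,\varphi_j$ are the components of $u$ on the upper and lower semicircle of ring $j$. Let $\alpha,A\in\mathbb R$ with $A\notin\mathbb Z$, and write $-\Delta_{\alpha,A}$ for the operator with the constant sequences $\alpha$, $A$. Let $n\in\mathbb N$, let $\alpha_1,\dots,\alpha_n,A_1,\dots,A_n\in\mathbb R$, and for $\varepsilon>0$ let $-\Delta_\varepsilon$ be the operator with coupling $\alpha+\varepsilon\alpha_j$ at $v_j$ and magnetic field $A+\varepsilon A_j$ on ring $j$ for $j=1,\dots,n$, and with coupling $\alpha$ and field $A$ elsewhere. Suppose that $\sum_{j=1}^n A_j=0$. **Theorem.** 1. For every $\varepsilon\in(0,1)$ one has $\sigma_{\mathrm{ess}}(-\Delta_\varepsilon)=\sigma_{\mathrm{ess}}(-\Delta_{\alpha,A})$. 2. Suppose in addition that $A-\frac12\notin\mathbb Z$, and number the gaps of the essential spectrum (the connected components of $\mathbb R\setminus\sigma_{\mathrm{ess}}(-\Delta_\varepsilon)$) from left to right by $m=1,2,3,\dots$, the first one being the unbounded gap below the essential spectrum. - If $\sum_{j=1}^n\alpha_j<0$, then for every odd $m$ there is $\varepsilon_m>0$ such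 that for all $\varepsilon\in(0,\varepsilon_m)$ the $m$-th gap exists, and $-\Delta_\varepsilon$ has exactly one eigenvalue (impurity state) in it, and this eigenvalue is simple. - If $\sum_{j=1}^n\alpha_j>0$, then the same holds for every even $m\ge 2$. -/

import Mathlib

open MeasureTheory Filter Topology Set

noncomputable section

namespace ChainGraph

/-! ### The Hilbert space of the chain graph -/

/-- `L²` of one semicircle, parametrized from left to right by arc length in `[0, π]`. -/
abbrev EdgeL2 : Type := Lp ℂ 2 (volume.restrict (Ioc (0 : ℝ) Real.pi))

/-- The edges of the chain: `(j, true)` is the upper and `(j, false)` the lower semicircle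
of the `j`-th ring. The ring `j` joins the vertex `j` (its left end) to the vertex `j + 1`. -/
abbrev Edge : Type := ℤ × Bool

/-- `L²(Γ)`, the Hilbert space direct sum of the `L²` spaces of all the edges. -/
abbrev GraphL2 : Type := lp (fun _ : Edge => EdgeL2) 2

/-! ### The Hamiltonian -/

/-- `u` belongs to the Sobolev space `H²(0, π)`: it is represented by `f`, which is `C¹` on
`[0, π]` with derivative `p`, and `p` is absolutely continuous with derivative `q ∈ L²`. -/
structure IsSobolevTwo (u : EdgeL2) (f p : ℝ → ℂ) (q : EdgeL2) : Prop where
  repr : u =ᵐ[volume.restrict (Ioc (0 : ℝ) Real.pi)] f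
  deriv_f : ∀ x ∈ Icc (0 : ℝ) Real.pi, HasDerivWithinAt f (p x) (Icc 0 Real.pi) x
  deriv_p : ∀ x ∈ Icc (0 : ℝ) Real.pi, p x = p 0 + ∫ t in (0 : ℝ)..x, q t

/-- Coefficient of `i` in the quasiderivative `𝒟 = d/dx + i a` on an edge: it is `A j` on the
upper semicircle of the ring `j` (where the vector potential is `- A j`) and `- A j` on the lower
one. -/
def edgeField (A : ℤ → ℝ) (e : Edge) : ℂ := if e.2 then (A e.1 : ℂ) else -(A e.1 : ℂ)

/-- The quasiderivative `𝒟 f = f' + i a f` on the edge `e`, where `p = f'`. -/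
def quasiDeriv (A : ℤ → ℝ) (e : Edge) (f p : ℝ → ℂ) (x : ℝ) : ℂ :=
  p x + Complex.I * edgeField A e * f x

/-- `δ`-coupling with strength `α j` at the vertex `j` for every `j`: continuity, and the sum of
the outgoing quasiderivatives equals `α j` times the value at the vertex. -/
structure DeltaCoupling (α A : ℤ → ℝ) (f p : Edge → ℝ → ℂ) : Prop where
  cont_upper_lower : ∀ j : ℤ, f (j, true) 0 = f (j, false) 0
  cont_left_upper : ∀ j : ℤ, f (j - 1, true) Real.pi = f (j, true) 0
  cont_left_lower : ∀ j : ℤ, f (j - 1, false) Real.pi = f (j, true) 0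
  jump : ∀ j : ℤ,
    quasiDeriv A (j, true) (f (j, true)) (p (j, true)) 0
      + quasiDeriv A (j, false) (f (j, false)) (p (j, false)) 0
      - quasiDeriv A (j - 1, true) (f (j - 1, true)) (p (j - 1, true)) Real.pi
      - quasiDeriv A (j - 1, false) (f (j - 1, false)) (p (j - 1, false)) Real.pi
      = (α j : ℂ) * f (j, true) 0

/-- `(u, v)` is in the graph of the Hamiltonian: `u` is in `H²` on every edge, satisfies the
`δ`-coupling, and `v = - 𝒟² u = - (u'' + 2 i a u' - a² u)` (in particular this is in `L²(Γ)`). -/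
def InGraph (α A : ℤ → ℝ) (u v : GraphL2) : Prop :=
  ∃ (f p : Edge → ℝ → ℂ) (q : Edge → EdgeL2),
    (∀ e, IsSobolevTwo (u e) (f e) (p e) (q e)) ∧
    DeltaCoupling α A f p ∧
    ∀ e, v e =ᵐ[volume.restrict (Ioc (0 : ℝ) Real.pi)] fun x =>
      -(q e x + 2 * Complex.I * edgeField A e * p e x - edgeField A e ^ 2 * f e x)

lemma intervalIntegrable_edge (q : EdgeL2) {x : ℝ} (hx : x ∈ Icc (0 : ℝ) Real.pi) :
    IntervalIntegrable (q : ℝ → ℂ) volume 0 x := by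
  have h : Integrable (q : ℝ → ℂ) (volume.restrict (Ioc (0 : ℝ) Real.pi)) :=
    (Lp.memLp q).integrable (by norm_num)
  rw [intervalIntegrable_iff_integrableOn_Ioc_of_le hx.1]
  exact IntegrableOn.mono_set h (Ioc_subset_Ioc_right hx.2)

lemma integral_congr_edge {g h : ℝ → ℂ}
    (hgh : g =ᵐ[volume.restrict (Ioc (0 : ℝ) Real.pi)] h) {x : ℝ}
    (hx : x ∈ Icc (0 : ℝ) Real.pi) : ∫ t in (0 : ℝ)..x, g t = ∫ t in (0 : ℝ)..x, h t := by
  rw [intervalIntegral.integral_of_le hx.1, intervalIntegral.integral_of_le hx.1]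
  exact integral_congr_ae (ae_restrict_of_ae_restrict_of_subset (Ioc_subset_Ioc_right hx.2) hgh)

lemma IsSobolevTwo.zero : IsSobolevTwo 0 0 0 0 where
  repr := Lp.coeFn_zero _ _ _
  deriv_f := fun x _ => hasDerivWithinAt_const x _ (0 : ℂ)
  deriv_p := fun x hx => by
    rw [integral_congr_edge (Lp.coeFn_zero ℂ 2 _) hx]; simp

lemma IsSobolevTwo.add {u₁ u₂ : EdgeL2} {f₁ f₂ p₁ p₂ : ℝ → ℂ} {q₁ q₂ : EdgeL2}
    (h₁ : IsSobolevTwo u₁ f₁ p₁ q₁) (h₂ : IsSobolevTwo u₂ f₂ p₂ q₂) :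
    IsSobolevTwo (u₁ + u₂) (f₁ + f₂) (p₁ + p₂) (q₁ + q₂) where
  repr := (Lp.coeFn_add _ _).trans (h₁.repr.add h₂.repr)
  deriv_f := fun x hx => (h₁.deriv_f x hx).add (h₂.deriv_f x hx)
  deriv_p := fun x hx => by
    rw [integral_congr_edge (Lp.coeFn_add q₁ q₂) hx]
    simp only [Pi.add_apply]
    rw [intervalIntegral.integral_add (intervalIntegrable_edge q₁ hx)
      (intervalIntegrable_edge q₂ hx), h₁.deriv_p x hx, h₂.deriv_p x hx]
    ring

lemma IsSobolevTwo.smul (c : ℂ) {u : EdgeL2} {f p : ℝ → ℂ} {q : EdgeL2}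
    (h : IsSobolevTwo u f p q) : IsSobolevTwo (c • u) (c • f) (c • p) (c • q) where
  repr := (Lp.coeFn_smul _ _).trans (h.repr.const_smul c)
  deriv_f := fun x hx => (h.deriv_f x hx).const_smul c
  deriv_p := fun x hx => by
    rw [integral_congr_edge (Lp.coeFn_smul c q) hx]
    simp only [Pi.smul_apply]
    rw [intervalIntegral.integral_smul, h.deriv_p x hx, smul_add]

/-- The second derivative is determined by the function. -/
lemma IsSobolevTwo.unique_zero {f p : ℝ → ℂ} {q : EdgeL2} (h : IsSobolevTwo 0 f p q) :
    (∀ x ∈ Icc (0 : ℝ) Real.pi, f x = 0) ∧ (∀ x ∈ Icc (0 : ℝ) Real.pi, p x = 0) ∧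
      q =ᵐ[volume.restrict (Ioc (0 : ℝ) Real.pi)] (0 : ℝ → ℂ) := by
  have hπ := Real.pi_pos
  have hf : EqOn f 0 (Icc (0 : ℝ) Real.pi) := by
    refine Measure.eqOn_Icc_of_ae_eq (μ := volume) hπ.ne ?_
      (fun x hx => (h.deriv_f x hx).continuousWithinAt) continuousOn_const
    rw [← restrict_Ioc_eq_restrict_Icc]
    exact h.repr.symm.trans (Lp.coeFn_zero _ _ _)
  have hp : ∀ x ∈ Icc (0 : ℝ) Real.pi, p x = 0 := fun x hx =>
    (uniqueDiffOn_Icc hπ x hx).eq_deriv _ (h.deriv_f x hx)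
      ((hasDerivWithinAt_const x _ (0 : ℂ)).congr (fun y hy => hf hy) (hf hx))
  refine ⟨hf, hp, ?_⟩
  have hint : ∀ x ∈ Icc (0 : ℝ) Real.pi, ∫ t in (0 : ℝ)..x, q t = 0 := fun x hx => by
    have h1 := h.deriv_p x hx
    rw [hp x hx, hp 0 (left_mem_Icc.2 hπ.le), zero_add] at h1
    exact h1.symm
  have hd := (intervalIntegrable_edge q (right_mem_Icc.2 hπ.le)).ae_hasDerivAt_integral
  have hne : ∀ᵐ x : ℝ, x ≠ Real.pi := by simp [ae_iff]
  rw [EventuallyEq, ae_restrict_iff' measurableSet_Ioc]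
  filter_upwards [hd, hne] with x hx hxπ hx1
  have hx0 : x ∈ Ioo (0 : ℝ) Real.pi := ⟨hx1.1, lt_of_le_of_ne hx1.2 hxπ⟩
  have hxi : x ∈ Icc (0 : ℝ) Real.pi := Ioo_subset_Icc_self hx0
  have h2 := hx (by rwa [uIcc_of_le hπ.le]) 0 (by rw [uIcc_of_le hπ.le]; exact left_mem_Icc.2 hπ.le)
  refine h2.unique ((hasDerivAt_const x (0 : ℂ)).congr_of_eventuallyEq ?_)
  filter_upwards [Ioo_mem_nhds hx0.1 hx0.2] with y hy
  exact hint y (Ioo_subset_Icc_self hy)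

/-- The graph of the Hamiltonian, as a subspace. -/
def graphSubmodule (α A : ℤ → ℝ) : Submodule ℂ (GraphL2 × GraphL2) where
  carrier := {w | InGraph α A w.1 w.2}
  zero_mem' := by
    refine ⟨0, 0, 0, fun e => IsSobolevTwo.zero, ⟨?_, ?_, ?_, ?_⟩, fun e => ?_⟩
    · simp
    · simp
    · simp
    · simp [quasiDeriv]
    · filter_upwards [Lp.coeFn_zero ℂ 2 (volume.restrict (Ioc (0 : ℝ) Real.pi))] with x hx
      have h1 : ((0 : GraphL2 × GraphL2).2 e) x = 0 := hx
      have h2 : ((0 : Edge → EdgeL2) e) x = 0 := hx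
      rw [h1, h2]
      simp
  add_mem' := by
    rintro w₁ w₂ ⟨f₁, p₁, q₁, h₁, b₁, e₁⟩ ⟨f₂, p₂, q₂, h₂, b₂, e₂⟩
    refine ⟨f₁ + f₂, p₁ + p₂, q₁ + q₂, fun e => (h₁ e).add (h₂ e), ⟨?_, ?_, ?_, ?_⟩, fun e => ?_⟩
    · intro j
      simp [b₁.cont_upper_lower j, b₂.cont_upper_lower j]
    · intro j
      simp [b₁.cont_left_upper j, b₂.cont_left_upper j]
    · intro j
      simp [b₁.cont_left_lower j, b₂.cont_left_lower j]
    · intro j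
      have a₁ := b₁.jump j
      have a₂ := b₂.jump j
      simp only [quasiDeriv, Pi.add_apply] at a₁ a₂ ⊢
      linear_combination a₁ + a₂
    · filter_upwards [Lp.coeFn_add (w₁.2 e) (w₂.2 e), Lp.coeFn_add (q₁ e) (q₂ e), e₁ e, e₂ e]
        with x hv hq h1 h2
      have hv' : ((w₁ + w₂).2 e) x = (w₁.2 e) x + (w₂.2 e) x := hv
      have hq' : ((q₁ + q₂) e) x = (q₁ e) x + (q₂ e) x := hq
      rw [hv', hq', h1, h2]
      simp only [Pi.add_apply]
      ring
  smul_mem' := by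
    rintro c w ⟨f, p, q, h, b, e₁⟩
    refine ⟨c • f, c • p, c • q, fun e => (h e).smul c, ⟨?_, ?_, ?_, ?_⟩, fun e => ?_⟩
    · intro j
      simp [b.cont_upper_lower j]
    · intro j
      simp [b.cont_left_upper j]
    · intro j
      simp [b.cont_left_lower j]
    · intro j
      have a₁ := b.jump j
      simp only [quasiDeriv, Pi.smul_apply, smul_eq_mul] at a₁ ⊢
      linear_combination c * a₁
    · filter_upwards [Lp.coeFn_smul c (w.2 e), Lp.coeFn_smul c (q e), e₁ e] with x hv hq h1
      have hv' : ((c • w).2 e) x = c * (w.2 e) x := hv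
      have hq' : ((c • q) e) x = c * (q e) x := hq
      rw [hv', hq', h1]
      simp only [Pi.smul_apply, smul_eq_mul]
      ring

/-- The Hamiltonian `-Δ_{α,A}` in `L²(Γ)` of the chain with coupling constant `α j` at the vertex
`j` and magnetic field `A j` on the ring `j`, as an unbounded operator. -/
def hamiltonian (α A : ℤ → ℝ) : GraphL2 →ₗ.[ℂ] GraphL2 := (graphSubmodule α A).toLinearPMap

lemma graphSubmodule_single_valued (α A : ℤ → ℝ) (w : GraphL2 × GraphL2)
    (hw : w ∈ graphSubmodule α A) (h0 : w.1 = 0) : w.2 = 0 := by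
  obtain ⟨f, p, q, h, -, hv⟩ := hw
  apply lp.ext
  funext e
  have he := h e
  rw [h0] at he
  obtain ⟨hf, hp, hq⟩ := IsSobolevTwo.unique_zero he
  apply Lp.ext
  filter_upwards [hv e, hq, Lp.coeFn_zero ℂ 2 (volume.restrict (Ioc (0 : ℝ) Real.pi)),
    ae_restrict_mem measurableSet_Ioc] with x h1 h2 h3 hx
  have h3' : ((0 : GraphL2) e) x = 0 := h3
  have h2' : q e x = 0 := h2
  rw [h1, h3', h2', hf x (Ioc_subset_Icc_self hx), hp x (Ioc_subset_Icc_self hx)]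
  simp

/-- The graph of the Hamiltonian is the intended one. -/
theorem mem_graph_hamiltonian (α A : ℤ → ℝ) (u v : GraphL2) :
    (u, v) ∈ (hamiltonian α A).graph ↔ InGraph α A u v := by
  rw [hamiltonian, Submodule.toLinearPMap_graph_eq _ (graphSubmodule_single_valued α A)]
  rfl

/-! ### Spectral notions -/

/-- The essential spectrum of a self-adjoint operator: the real `E` that have a singular (Weyl)
sequence, i.e. unit vectors in the domain, weakly null, with `(T - E) x_n → 0`. -/
def essSpectrum {H : Type*} [NormedAddCommGroup H] [InnerProductSpace ℂ H]
    (T : H →ₗ.[ℂ] H) : Set ℝ :=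
  {E | ∃ x : ℕ → T.domain,
    (∀ n, ‖(x n : H)‖ = 1) ∧
    (∀ y : H, Tendsto (fun n => inner ℂ y (x n : H)) atTop (𝓝 0)) ∧
    Tendsto (fun n => ‖T (x n) - (E : ℂ) • (x n : H)‖) atTop (𝓝 0)}

/-- The eigenspace `{u ∈ dom T | T u = E u}`. -/
def eigenspace {H : Type*} [NormedAddCommGroup H] [InnerProductSpace ℂ H]
    (T : H →ₗ.[ℂ] H) (E : ℝ) : Submodule ℂ H :=
  T.graph.comap (LinearMap.prod LinearMap.id ((E : ℂ) • LinearMap.id))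

/-- `E` is an eigenvalue of `T`. -/
def IsEigenvalue {H : Type*} [NormedAddCommGroup H] [InnerProductSpace ℂ H]
    (T : H →ₗ.[ℂ] H) (E : ℝ) : Prop :=
  ∃ u : T.domain, (u : H) ≠ 0 ∧ T u = (E : ℂ) • (u : H)

/-- `I` is a gap of `S ⊆ ℝ`: a connected component of the complement of `S`. -/
def IsGap (S I : Set ℝ) : Prop := ∃ x ∈ Sᶜ, I = connectedComponentIn Sᶜ x

/-- `I` is the `m`-th gap of `S`, the gaps being numbered `1, 2, 3, …` from left to right. -/
def IsNthGap (S : Set ℝ) (m : ℕ) (I : Set ℝ) : Prop :=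
  IsGap S I ∧ {J | IsGap S J ∧ ∀ x ∈ J, ∀ y ∈ I, x < y}.encard + 1 = (m : ℕ∞)

/-- In the set `I` the operator `T` has exactly one eigenvalue, and this eigenvalue is simple. -/
def HasOneSimpleEigenvalueIn {H : Type*} [NormedAddCommGroup H] [InnerProductSpace ℂ H]
    (T : H →ₗ.[ℂ] H) (I : Set ℝ) : Prop :=
  ∃ E : ℝ, {F | F ∈ I ∧ IsEigenvalue T F} = {E} ∧ Module.finrank ℂ (eigenspace T E) = 1

/-! ### The weakly perturbed chain -/

/-- The constant sequence `c`, changed to `c + ε d j` at the places `j = 1, …, n`. -/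
def perturb (c ε : ℝ) (n : ℕ) (d : ℤ → ℝ) (j : ℤ) : ℝ :=
  if 1 ≤ j ∧ j ≤ (n : ℤ) then c + ε * d j else c

/-- The Hamiltonian `-Δ_{α,A}` of the periodic chain. -/
def periodicHamiltonian (α A : ℝ) : GraphL2 →ₗ.[ℂ] GraphL2 :=
  hamiltonian (fun _ => α) (fun _ => A)

/-- The Hamiltonian `-Δ_ε` of the perturbed chain. -/
def perturbedHamiltonian (α A : ℝ) (n : ℕ) (α' A' : ℤ → ℝ) (ε : ℝ) : GraphL2 →ₗ.[ℂ] GraphL2 :=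
  hamiltonian (perturb α ε n α') (perturb A ε n A')

end ChainGraph

end

noncomputable section

namespace ChainGraph

/-! ### The fundamental solutions of `-f'' = E f` -/

/-! The problem is reduced to a difference equation for the values `U j` at the vertices. The gauge
factor `exp (i a x)` removes the field on each edge, so solutions there are combinations of `cosE E`
and `sinE E`. If the slopes at the ends are expressed through the vertex values, the `δ`-condition
multiplied by `sinPi E` becomes `hop A j * U (j + 1) + hop A (j - 1) * U (j - 1) = eta (α j) E * U
j`, where `hop A j = cos (A j π)` and `eta a E = 2 cosPi E + (a / 2) sinPi E`. For `sinPi E ≠ 0`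
this is an equivalence between eigenfunctions and `ℓ²` solutions, with quantitative versions in both
directions for approximate solutions (`exists_vertex_bounds`, `exists_inGraph_of_vertex`).

Essential spectrum. Let `κ = |cos (A π)|`. The zeros of `sinPi` are the squares `1, 4, 9, …`; they
carry eigenfunctions supported on two rings, whose translates form a singular sequence. At all other
energies, and for `κ ≠ 0`, the periodic chain has essential spectrum exactly where `|eta α E| ≤ 2
κ`: truncated plane waves give singular sequences there, and outside the vertex equation is
boundedly invertible. A local perturbation changes nothing (`essSpectrum_subset`): along a singular
sequence everything on a fixed edge tends to zero, so finitely many rings can be cut out.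

Gaps. For `|c| < 1` the function `(cosPi E - c) / sinPi E` strictly decreases on each interval
(`cell r`) between consecutive squares. Hence for `0 < κ < 1` a cell contains exactly two gaps, one
at its left end, where `η` has the sign `(-1) ^ r`, and one at its right end, with the opposite
sign. In the gap number `k + 1`, with `τ = gapSign k` the sign of `η`, the product `τ * sinPi E` has
the sign `(-1) ^ k`.

Impurity states. In a gap the vertex equation is, after a change of signs, the kernel equation of a
Jacobi operator with diagonal `τ * eta (α j) E` and off-diagonal close to `-κ`; the band edge is `τ
η = 2 κ`. The couplings change the diagonal by `ε α_j τ sinPi E / 2`. The fields change the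
off-diagonal, but the first-order changes add up to zero because `∑ A_j = 0`. So the perturbation is
attractive to first order exactly when `(-1) ^ k * ∑ α_j < 0`. Existence
(`exists_kernel_weak_coupling`): the solution decaying to the left misses decay on the right by a
continuous function of the energy, which is negative at the band edge for an attractive perturbation
and positive at a fixed point of the gap for small `ε`; a zero lies between them. Uniqueness: by
Hardy's inequality the form of the Jacobi operator is positive on sequences vanishing at the vertex
`1` (`tsum_jacobi_pos`), a subspace of codimension one. Kernel elements at two energies would, by
the monotonicity of the ratio, span a plane on which one of the two forms is nonpositive, and this
plane meets that subspace (`jacobi_kernel_unique`). The same positivity makes the eigenvalue simple.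
-/

/-- `cos (√E x)`, continued to negative `E`. -/
def cosE (E x : ℝ) : ℝ := Real.cos (√E * x) * Real.cosh (√(-E) * x)

/-- `sin (√E x) / √E`, continued to all real `E`. -/
def sinE (E x : ℝ) : ℝ := ∫ t in (0 : ℝ)..x, cosE E t

lemma continuous_cosE_uncurry : Continuous (fun z : ℝ × ℝ => cosE z.1 z.2) := by
  unfold cosE
  fun_prop

lemma continuous_cosE (E : ℝ) : Continuous (cosE E) :=
  continuous_cosE_uncurry.comp (by fun_prop : Continuous fun x : ℝ => (E, x))

@[simp] lemma cosE_zero_right (E : ℝ) : cosE E 0 = 1 := by simp [cosE]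

@[simp] lemma sinE_zero_right (E : ℝ) : sinE E 0 = 0 := by simp [sinE]

lemma cosE_of_nonneg {E : ℝ} (hE : 0 ≤ E) (x : ℝ) : cosE E x = Real.cos (√E * x) := by
  simp [cosE, Real.sqrt_eq_zero_of_nonpos (neg_nonpos.2 hE)]

lemma cosE_of_nonpos {E : ℝ} (hE : E ≤ 0) (x : ℝ) : cosE E x = Real.cosh (√(-E) * x) := by
  simp [cosE, Real.sqrt_eq_zero_of_nonpos hE]

lemma hasDerivAt_sinE (E x : ℝ) : HasDerivAt (sinE E) (cosE E x) x :=
  (continuous_cosE E).integral_hasStrictDerivAt 0 x |>.hasDerivAt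

lemma sqrt_mul_sinE {E : ℝ} (hE : 0 ≤ E) (x : ℝ) : √E * sinE E x = Real.sin (√E * x) := by
  have h : ∀ t, HasDerivAt (fun y => Real.sin (√E * y)) (√E * cosE E t) t := fun t => by
    rw [cosE_of_nonneg hE]
    simpa [mul_comm] using (((hasDerivAt_id t).const_mul (√E)).sin)
  have h2 := intervalIntegral.integral_eq_sub_of_hasDerivAt (a := 0) (b := x) (fun t _ => h t)
    ((continuous_const.mul (continuous_cosE E)).intervalIntegrable _ _)
  rw [intervalIntegral.integral_const_mul] at h2
  simpa [sinE] using h2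

lemma sqrt_neg_mul_sinE {E : ℝ} (hE : E ≤ 0) (x : ℝ) :
    √(-E) * sinE E x = Real.sinh (√(-E) * x) := by
  have h : ∀ t, HasDerivAt (fun y => Real.sinh (√(-E) * y)) (√(-E) * cosE E t) t := fun t => by
    rw [cosE_of_nonpos hE]
    simpa [mul_comm] using (((hasDerivAt_id t).const_mul (√(-E))).sinh)
  have h2 := intervalIntegral.integral_eq_sub_of_hasDerivAt (a := 0) (b := x) (fun t _ => h t)
    ((continuous_const.mul (continuous_cosE E)).intervalIntegrable _ _)
  rw [intervalIntegral.integral_const_mul] at h2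
  simpa [sinE] using h2

lemma hasDerivAt_cosE (E x : ℝ) : HasDerivAt (cosE E) (-E * sinE E x) x := by
  rcases le_total 0 E with hE | hE
  · have h : HasDerivAt (fun y => Real.cos (√E * y)) (-Real.sin (√E * x) * √E) x := by
      simpa using (((hasDerivAt_id x).const_mul (√E)).cos)
    rw [← sqrt_mul_sinE hE] at h
    have h2 : -(√E * sinE E x) * √E = -E * sinE E x := by
      linear_combination -(sinE E x) * Real.mul_self_sqrt hE
    rw [h2] at h
    exact h.congr_of_eventuallyEq (Eventually.of_forall fun y => cosE_of_nonneg hE y)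
  · have h : HasDerivAt (fun y => Real.cosh (√(-E) * y)) (Real.sinh (√(-E) * x) * √(-E)) x := by
      simpa using (((hasDerivAt_id x).const_mul (√(-E))).cosh)
    rw [← sqrt_neg_mul_sinE hE] at h
    have h2 : (√(-E) * sinE E x) * √(-E) = -E * sinE E x := by
      linear_combination (sinE E x) * Real.mul_self_sqrt (neg_nonneg.2 hE)
    rw [h2] at h
    exact h.congr_of_eventuallyEq (Eventually.of_forall fun y => cosE_of_nonpos hE y)

lemma continuous_sinE (E : ℝ) : Continuous (sinE E) :=
  continuous_iff_continuousAt.2 fun x => (hasDerivAt_sinE E x).continuousAt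

lemma cosE_sq_add (E x : ℝ) : cosE E x ^ 2 + E * sinE E x ^ 2 = 1 := by
  rcases le_total 0 E with hE | hE
  · have h := sqrt_mul_sinE hE x
    have h2 : E * sinE E x ^ 2 = (√E * sinE E x) ^ 2 := by rw [mul_pow, Real.sq_sqrt hE]
    rw [h2, h, cosE_of_nonneg hE]
    exact Real.cos_sq_add_sin_sq _
  · have h := sqrt_neg_mul_sinE hE x
    have h2 : E * sinE E x ^ 2 = -(√(-E) * sinE E x) ^ 2 := by
      rw [mul_pow, Real.sq_sqrt (neg_nonneg.2 hE)]; ring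
    rw [h2, h, cosE_of_nonpos hE, ← sub_eq_add_neg]
    exact Real.cosh_sq_sub_sinh_sq _

/-- The value of `cosE E` at the right end of an edge. -/
def cosPi (E : ℝ) : ℝ := cosE E Real.pi

/-- The value of `sinE E` at the right end of an edge. -/
def sinPi (E : ℝ) : ℝ := sinE E Real.pi

lemma continuous_cosPi : Continuous cosPi :=
  continuous_cosE_uncurry.comp (by fun_prop : Continuous fun E : ℝ => (E, Real.pi))

lemma continuous_sinPi : Continuous sinPi := by
  unfold sinPi sinE
  exact intervalIntegral.continuous_parametric_intervalIntegral_of_continuous'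
    continuous_cosE_uncurry _ _

/-! ### Integration by parts for an absolutely continuous function -/

/-- The real-valued statement applies to the real and the imaginary part, and each complex increment
is bounded by the sum of the two real increments. -/
lemma absolutelyContinuousOnInterval_integral_complex {h : ℝ → ℂ} {a b : ℝ}
    (hh : IntervalIntegrable h volume a b) :
    AbsolutelyContinuousOnInterval (fun x => ∫ t in a..x, h t) a b := by
  have hre : IntervalIntegrable (fun t => (h t).re) volume a b :=
    ⟨hh.1.re, hh.2.re⟩
  have him : IntervalIntegrable (fun t => (h t).im) volume a b :=
    ⟨hh.1.im, hh.2.im⟩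
  have h1 := hre.absolutelyContinuousOnInterval_intervalIntegral (c := a) left_mem_uIcc
  have h2 := him.absolutelyContinuousOnInterval_intervalIntegral (c := a) left_mem_uIcc
  have h3 : ∀ x ∈ uIcc a b, (∫ t in a..x, h t)
      = ((∫ t in a..x, (h t).re : ℝ) : ℂ) + ((∫ t in a..x, (h t).im : ℝ) : ℂ) * Complex.I := by
    intro x hx
    have hhx : IntervalIntegrable h volume a x :=
      hh.mono_set (uIcc_subset_uIcc left_mem_uIcc hx)
    have e1 := Complex.reCLM.intervalIntegral_comp_comm hhx
    have e2 := Complex.imCLM.intervalIntegral_comp_comm hhx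
    simp only [Complex.reCLM_apply, Complex.imCLM_apply] at e1 e2
    rw [e1, e2, Complex.re_add_im]
  unfold AbsolutelyContinuousOnInterval at h1 h2 ⊢
  have h4 := h1.add h2
  rw [add_zero] at h4
  refine squeeze_zero' (Eventually.of_forall fun _ => Finset.sum_nonneg fun _ _ => dist_nonneg) ?_ h4
  rw [eventually_inf_principal]
  filter_upwards with I hI
  rw [← Finset.sum_add_distrib]
  refine Finset.sum_le_sum fun i hi => ?_
  have hm := hI.1 i hi
  rw [h3 _ hm.1, h3 _ hm.2, dist_eq_norm, Real.dist_eq, Real.dist_eq]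
  set a1 := ∫ t in a..(I.2 i).1, (h t).re
  set a2 := ∫ t in a..(I.2 i).2, (h t).re
  set b1 := ∫ t in a..(I.2 i).1, (h t).im
  set b2 := ∫ t in a..(I.2 i).2, (h t).im
  have : ((a1 : ℂ) + b1 * Complex.I - (a2 + b2 * Complex.I))
      = ((a1 - a2 : ℝ) : ℂ) + ((b1 - b2 : ℝ) : ℂ) * Complex.I := by push_cast; ring
  rw [this]
  refine (norm_add_le _ _).trans ?_
  rw [norm_mul, Complex.norm_I, mul_one, Complex.norm_real, Complex.norm_real]
  exact le_rfl

/-- Integration by parts against an absolutely continuous function. -/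
lemma integral_mul_eq_of_eq_integral {φ φ' p h : ℝ → ℂ} {b : ℝ} (hb : 0 ≤ b)
    (hφ : ∀ x, HasDerivAt φ (φ' x) x) (hφ' : Continuous φ')
    (hh : IntervalIntegrable h volume 0 b)
    (hp : ∀ x ∈ Icc 0 b, p x = p 0 + ∫ t in (0 : ℝ)..x, h t) :
    ∫ t in (0 : ℝ)..b, φ t * h t = φ b * p b - φ 0 * p 0 - ∫ t in (0 : ℝ)..b, φ' t * p t := by
  set P : ℝ → ℂ := fun x => p 0 + ∫ t in (0 : ℝ)..x, h t with hP
  have hφc : Continuous φ := continuous_iff_continuousAt.2 fun x => (hφ x).continuousAt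
  have hc : AbsolutelyContinuousOnInterval (fun _ : ℝ => p 0) 0 b :=
    (contDiffOn_const (n := 1)).absolutelyContinuousOnInterval
  have hPac : AbsolutelyContinuousOnInterval P 0 b :=
    hc.fun_add (absolutelyContinuousOnInterval_integral_complex hh)
  have hφac : AbsolutelyContinuousOnInterval φ 0 b := by
    refine ContDiffOn.absolutelyContinuousOnInterval (ContDiff.contDiffOn ?_)
    rw [contDiff_one_iff_deriv]
    refine ⟨fun x => (hφ x).differentiableAt, ?_⟩
    have : deriv φ = φ' := funext fun x => (hφ x).deriv
    rwa [this]
  have hPc := hPac.continuousOn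
  have hi1 : IntervalIntegrable (fun t => φ t * h t) volume 0 b :=
    hh.continuousOn_mul hφc.continuousOn
  have hi2 : IntervalIntegrable (fun t => φ' t * P t) volume 0 b :=
    (hφ'.continuousOn.mul hPc).intervalIntegrable
  -- `Q` is a primitive of the almost everywhere derivative of `φ P`. Thus `φ P - Q` is absolutely
  -- continuous with derivative zero almost everywhere, hence constant, and equating its values at
  -- `0` and `b` gives the formula.
  set Q : ℝ → ℂ := fun x => ∫ t in (0 : ℝ)..x, (φ' t * P t + φ t * h t) with hQ
  have hQac : AbsolutelyContinuousOnInterval Q 0 b :=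
    absolutelyContinuousOnInterval_integral_complex (hi2.add hi1)
  have hW := (hφac.fun_smul hPac).fun_sub hQac
  obtain ⟨C, hC⟩ := hW.const_of_ae_hasDerivAt_zero (by
    filter_upwards [hh.ae_hasDerivAt_integral, (hi2.add hi1).ae_hasDerivAt_integral] with x h1 h2 hx
    have d1 : HasDerivAt P (h x) x :=
      (h1 hx 0 left_mem_uIcc).const_add (p 0)
    have d2 : HasDerivAt Q (φ' x * P x + φ x * h x) x := h2 hx 0 left_mem_uIcc
    have d3 := ((hφ x).mul d1).sub d2
    rw [sub_self] at d3
    exact d3)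
  have e0 := hC 0 left_mem_uIcc
  have eb := hC b right_mem_uIcc
  have hpb : P b = p b := (hp b ⟨hb, le_rfl⟩).symm
  have hp0 : P 0 = p 0 := by simp [hP]
  have hint : ∫ t in (0 : ℝ)..b, φ' t * P t = ∫ t in (0 : ℝ)..b, φ' t * p t := by
    refine intervalIntegral.integral_congr fun t ht => ?_
    rw [uIcc_of_le hb] at ht
    simp only [hP, hp t ht]
  simp only [smul_eq_mul] at e0 eb
  rw [hpb] at eb
  rw [hp0] at e0
  have hQb : Q b = (∫ t in (0 : ℝ)..b, φ' t * p t) + ∫ t in (0 : ℝ)..b, φ t * h t := by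
    rw [hQ, ← hint, ← intervalIntegral.integral_add hi2 hi1]
  have hQ0 : Q 0 = 0 := by simp [hQ]
  rw [hQb] at eb
  rw [hQ0] at e0
  linear_combination e0 - eb

/-! ### The edge -/

/-- Lebesgue measure on an edge. -/
abbrev edgeMeasure : Measure ℝ := volume.restrict (Ioc (0 : ℝ) Real.pi)

/-- Cauchy–Schwarz against the constant `1` on an interval of length `π`. -/
lemma edge_integral_norm_le (g : EdgeL2) : ∫ t, ‖g t‖ ∂edgeMeasure ≤ √Real.pi * ‖g‖ := by
  have hm := Lp.aestronglyMeasurable g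
  have h := eLpNorm_le_eLpNorm_mul_rpow_measure_univ (μ := edgeMeasure) (p := 1) (q := 2)
    (by norm_num) hm
  rw [integral_norm_eq_lintegral_enorm hm, Lp.norm_def, ← eLpNorm_one_eq_lintegral_enorm]
  have hu : (edgeMeasure univ) = ENNReal.ofReal Real.pi := by simp
  rw [hu] at h
  have h2 := ENNReal.toReal_mono (ENNReal.mul_ne_top (Lp.eLpNorm_ne_top g)
    (ENNReal.rpow_ne_top_of_nonneg (by norm_num) ENNReal.ofReal_ne_top)) h
  refine h2.trans (le_of_eq ?_)
  rw [ENNReal.toReal_mul, mul_comm, ← ENNReal.toReal_rpow, ENNReal.toReal_ofReal Real.pi_pos.le,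
    Real.sqrt_eq_rpow]
  norm_num

lemma edge_norm_le {u : EdgeL2} {M : ℝ} (hM : 0 ≤ M) (h : ∀ᵐ x ∂edgeMeasure, ‖u x‖ ≤ M) :
    ‖u‖ ≤ √Real.pi * M := by
  refine (Lp.norm_le_of_ae_bound hM h).trans (le_of_eq ?_)
  congr 1
  rw [measureUnivNNReal, Real.sqrt_eq_rpow]
  simp [ENNReal.coe_toNNReal_eq_toReal, Real.pi_pos.le]

/-! ### The gauge factor and Lagrange's identity -/

/-- The real magnetic field felt when running along the edge from left to right. -/
def edgeA (A : ℤ → ℝ) (e : Edge) : ℝ := if e.2 then A e.1 else -A e.1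

lemma edgeField_eq (A : ℤ → ℝ) (e : Edge) : edgeField A e = (edgeA A e : ℂ) := by
  unfold edgeField edgeA
  split_ifs <;> simp

/-- The gauge factor `exp (i a t)`. -/
def phase (a t : ℝ) : ℂ := Complex.exp (Complex.I * a * t)

@[simp] lemma norm_phase (a t : ℝ) : ‖phase a t‖ = 1 := by
  have : Complex.I * a * t = ((a * t : ℝ) : ℂ) * Complex.I := by push_cast; ring
  rw [phase, this, Complex.norm_exp_ofReal_mul_I]

lemma phase_ne_zero (a t : ℝ) : phase a t ≠ 0 := Complex.exp_ne_zero _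

@[simp] lemma phase_zero_right (a : ℝ) : phase a 0 = 1 := by simp [phase]

lemma phase_neg_mul (a t : ℝ) : phase (-a) t * phase a t = 1 := by
  rw [phase, phase, ← Complex.exp_add]
  simp

lemma phase_add_phase_neg (a t : ℝ) : phase a t + phase (-a) t = 2 * (Real.cos (a * t) : ℂ) := by
  have h := Complex.two_cos (((a * t : ℝ)) : ℂ)
  rw [Complex.ofReal_cos, h, phase, phase]
  congr 2 <;> · push_cast; ring

lemma hasDerivAt_phase (a t : ℝ) : HasDerivAt (phase a) (Complex.I * a * phase a t) t := by
  have h : HasDerivAt (fun x : ℝ => Complex.I * a * (x : ℂ)) (Complex.I * a) t := by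
    simpa using (Complex.ofRealCLM.hasDerivAt (x := t)).const_mul (Complex.I * (a : ℂ))
  exact h.cexp.congr_deriv (mul_comm _ _)

lemma continuous_phase (a : ℝ) : Continuous (phase a) :=
  continuous_iff_continuousAt.2 fun x => (hasDerivAt_phase a x).continuousAt

/-- `u` and `v = - 𝒟² u` on an edge with field `a`. -/
structure EdgeGraph (a : ℝ) (u v : EdgeL2) (f p : ℝ → ℂ) (q : EdgeL2) : Prop where
  sob : IsSobolevTwo u f p q
  eq : v =ᵐ[edgeMeasure] fun x => -(q x + 2 * Complex.I * a * p x - (a : ℂ) ^ 2 * f x)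

lemma intervalIntegrable_continuous_mul {s : ℝ → ℂ} (hs : Continuous s) (g : EdgeL2) {x : ℝ}
    (hx : x ∈ Icc (0 : ℝ) Real.pi) : IntervalIntegrable (fun t => s t * g t) volume 0 x :=
  (intervalIntegrable_edge g hx).continuousOn_mul hs.continuousOn

/-- Lagrange's identity on an edge. -/
lemma EdgeGraph.lagrange {a : ℝ} {u v : EdgeL2} {f p : ℝ → ℂ} {q : EdgeL2}
    (h : EdgeGraph a u v f p q) (E : ℝ) {s s' s'' : ℝ → ℝ}
    (hs : ∀ x, HasDerivAt s (s' x) x) (hs' : ∀ x, HasDerivAt s' (s'' x) x)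
    (hs'' : Continuous s'') {x : ℝ} (hx : x ∈ Icc (0 : ℝ) Real.pi) :
    phase a x * (s x * (p x + Complex.I * a * f x) - s' x * f x)
        - (s 0 * (p 0 + Complex.I * a * f 0) - s' 0 * f 0)
      = -((∫ t in (0 : ℝ)..x, phase a t * s t * (v - (E : ℂ) • u : EdgeL2) t)
          + ∫ t in (0 : ℝ)..x, phase a t * (s'' t + E * s t : ℝ) * u t) := by
  have hsc : Continuous s := continuous_iff_continuousAt.2 fun x => (hs x).continuousAt
  have hs'c : Continuous s' := continuous_iff_continuousAt.2 fun x => (hs' x).continuousAt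
  have hsC : ∀ x, HasDerivAt (fun y => (s y : ℂ)) (s' x) x := fun x => (hs x).ofReal_comp
  have hs'C : ∀ x, HasDerivAt (fun y => (s' y : ℂ)) (s'' x) x := fun x => (hs' x).ofReal_comp
  have hphi : ∀ t, HasDerivAt (fun y => phase a y * (s y : ℂ))
      (Complex.I * a * phase a t * s t + phase a t * s' t) t := fun t =>
    (hasDerivAt_phase a t).mul (hsC t)
  have hph := continuous_phase a
  have hsub : Icc 0 x ⊆ Icc (0 : ℝ) Real.pi := Icc_subset_Icc_right hx.2
  have ibp := integral_mul_eq_of_eq_integral (p := p) (h := q) hx.1 hphi (by fun_prop)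
    (intervalIntegrable_edge q hx) (fun y hy => h.sob.deriv_p y (hsub hy))
  have hfc : ContinuousOn f (Icc 0 x) := fun y hy =>
    (h.sob.deriv_f y (hsub hy)).continuousWithinAt.mono hsub
  have hpc : ContinuousOn p (Icc 0 x) := by
    have h1 : ContinuousOn (fun y => p 0 + ∫ t in (0 : ℝ)..y, q t) (Icc 0 x) := by
      have := (absolutelyContinuousOnInterval_integral_complex
        (intervalIntegrable_edge q hx)).continuousOn
      rw [uIcc_of_le hx.1] at this
      exact continuousOn_const.add this
    exact h1.congr fun y hy => h.sob.deriv_p y (hsub hy)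
  have hfI : ∀ {φ : ℝ → ℂ}, Continuous φ → IntervalIntegrable (fun t => φ t * f t) volume 0 x :=
    fun hφ => ContinuousOn.intervalIntegrable (by
      rw [uIcc_of_le hx.1]; exact hφ.continuousOn.mul hfc)
  have hpI : ∀ {φ : ℝ → ℂ}, Continuous φ → IntervalIntegrable (fun t => φ t * p t) volume 0 x :=
    fun hφ => ContinuousOn.intervalIntegrable (by
      rw [uIcc_of_le hx.1]; exact hφ.continuousOn.mul hpc)
  -- the smooth part
  set ψ : ℝ → ℂ := fun y => phase a y * (Complex.I * a * s y - s' y) with hψ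
  set ψ' : ℝ → ℂ := fun y => Complex.I * a * phase a y * (Complex.I * a * s y - s' y)
    + phase a y * (Complex.I * a * s' y - s'' y) with hψ'
  have hψd : ∀ t, HasDerivAt ψ (ψ' t) t := fun t =>
    (hasDerivAt_phase a t).mul (((hsC t).const_mul (Complex.I * (a : ℂ))).sub (hs'C t))
  have hψc : Continuous ψ := continuous_iff_continuousAt.2 fun y => (hψd y).continuousAt
  have hψ'c : Continuous ψ' := by fun_prop
  have ftc : ∫ t in (0 : ℝ)..x, (ψ' t * f t + ψ t * p t) = ψ x * f x - ψ 0 * f 0 := by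
    refine intervalIntegral.integral_eq_sub_of_hasDerivAt_of_le hx.1
      (hψc.continuousOn.mul hfc) (fun t ht => ?_) ((hfI hψ'c).add (hpI hψc))
    refine (hψd t).mul ?_
    exact (h.sob.deriv_f t (hsub (Ioo_subset_Icc_self ht))).hasDerivAt
      (Icc_mem_nhds ht.1 (ht.2.trans_le hx.2))
  have hI1 := intervalIntegrable_continuous_mul (s := fun t => phase a t * (s t : ℂ))
    (by fun_prop) (v - (E : ℂ) • u : EdgeL2) hx
  have hI2 := intervalIntegrable_continuous_mul
    (s := fun t => phase a t * ((s'' t + E * s t : ℝ) : ℂ)) (by fun_prop) u hx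
  have hq := intervalIntegrable_continuous_mul (s := fun t => phase a t * (s t : ℂ))
    (by fun_prop) q hx
  have hae : (∫ t in (0 : ℝ)..x, phase a t * s t * (v - (E : ℂ) • u : EdgeL2) t)
          + ∫ t in (0 : ℝ)..x, phase a t * (s'' t + E * s t : ℝ) * u t
      = -(∫ t in (0 : ℝ)..x, phase a t * s t * q t)
        - (∫ t in (0 : ℝ)..x, (Complex.I * a * phase a t * s t + phase a t * s' t) * p t)
        - ∫ t in (0 : ℝ)..x, (ψ' t * f t + ψ t * p t) := by
    have hpp : IntervalIntegrable (fun t =>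
        (Complex.I * a * phase a t * s t + phase a t * s' t) * p t) volume 0 x :=
      hpI (φ := fun t => Complex.I * a * phase a t * s t + phase a t * s' t) (by fun_prop)
    have hqn : IntervalIntegrable (fun t => -(phase a t * s t * q t)) volume 0 x := hq.neg
    have hqp : IntervalIntegrable (fun t => -(phase a t * s t * q t)
        - (Complex.I * a * phase a t * s t + phase a t * s' t) * p t) volume 0 x := hqn.sub hpp
    rw [← intervalIntegral.integral_add hI1 hI2, ← intervalIntegral.integral_neg,
      ← intervalIntegral.integral_sub hqn hpp,
      ← intervalIntegral.integral_sub hqp ((hfI hψ'c).add (hpI hψc))]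
    refine integral_congr_edge ?_ hx
    filter_upwards [h.eq, h.sob.repr, Lp.coeFn_sub v ((E : ℂ) • u), Lp.coeFn_smul (E : ℂ) u]
      with t h1 h2 h3 h4
    rw [h3, Pi.sub_apply, h4, Pi.smul_apply, h1, h2, smul_eq_mul]
    simp only [hψ, hψ']
    push_cast
    linear_combination (phase a t * s t * a ^ 2 * f t) * Complex.I_sq
  rw [hae, ftc, ibp]
  simp only [hψ, phase_zero_right]
  ring

lemma norm_integral_mul_le {s : ℝ → ℂ} {M : ℝ} (hs : ∀ t ∈ Icc (0 : ℝ) Real.pi, ‖s t‖ ≤ M)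
    (hsc : Continuous s) (g : EdgeL2) {x : ℝ} (hx : x ∈ Icc (0 : ℝ) Real.pi) :
    ‖∫ t in (0 : ℝ)..x, s t * g t‖ ≤ M * √Real.pi * ‖g‖ := by
  have hM : 0 ≤ M := (norm_nonneg _).trans (hs 0 ⟨le_rfl, Real.pi_pos.le⟩)
  have hi : IntegrableOn (fun t => M * ‖g t‖) (Ioc 0 Real.pi) :=
    ((Lp.memLp g).integrable (by norm_num)).norm.const_mul M
  have hi2 : IntegrableOn (fun t => s t * g t) (Ioc 0 Real.pi) :=
    (intervalIntegrable_iff_integrableOn_Ioc_of_le Real.pi_pos.le).1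
      (intervalIntegrable_continuous_mul hsc g ⟨Real.pi_pos.le, le_rfl⟩)
  rw [intervalIntegral.integral_of_le hx.1]
  calc ‖∫ t in Ioc 0 x, s t * g t‖ ≤ ∫ t in Ioc 0 x, ‖s t * g t‖ := norm_integral_le_integral_norm _
    _ ≤ ∫ t in Ioc 0 Real.pi, ‖s t * g t‖ :=
        setIntegral_mono_set hi2.norm (Eventually.of_forall fun _ => norm_nonneg _)
          (Ioc_subset_Ioc_right hx.2).eventuallyLE
    _ ≤ ∫ t in Ioc 0 Real.pi, M * ‖g t‖ := by
        refine setIntegral_mono_on hi2.norm hi measurableSet_Ioc fun t ht => ?_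
        rw [norm_mul]
        exact mul_le_mul_of_nonneg_right (hs t (Ioc_subset_Icc_self ht)) (norm_nonneg _)
    _ = M * ∫ t, ‖g t‖ ∂edgeMeasure := integral_const_mul _ _
    _ ≤ M * (√Real.pi * ‖g‖) := mul_le_mul_of_nonneg_left (edge_integral_norm_le g) hM
    _ = _ := by ring

/-! ### Cubics -/

/-- The cubic with value `0` and slope `1` at `0` and a double zero at `π`. -/
def hermSlope (x : ℝ) : ℝ := x * (1 - x / Real.pi) ^ 2

/-- The derivative of `hermSlope`. -/
def hermSlope' (x : ℝ) : ℝ := 1 - 4 * x / Real.pi + 3 * x ^ 2 / Real.pi ^ 2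

/-- The second derivative of `hermSlope`. -/
def hermSlope'' (x : ℝ) : ℝ := -4 / Real.pi + 6 * x / Real.pi ^ 2

/-- The cubic with value `1` and slope `0` at `0` and a double zero at `π`. -/
def hermVal (x : ℝ) : ℝ := 1 - 3 * x ^ 2 / Real.pi ^ 2 + 2 * x ^ 3 / Real.pi ^ 3

/-- The derivative of `hermVal`. -/
def hermVal' (x : ℝ) : ℝ := -6 * x / Real.pi ^ 2 + 6 * x ^ 2 / Real.pi ^ 3

/-- The second derivative of `hermVal`. -/
def hermVal'' (x : ℝ) : ℝ := -6 / Real.pi ^ 2 + 12 * x / Real.pi ^ 3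

lemma hasDerivAt_cubic (c₀ c₁ c₂ c₃ x : ℝ) :
    HasDerivAt (fun y => c₀ + c₁ * y + c₂ * y ^ 2 + c₃ * y ^ 3)
      (c₁ + c₂ * (2 * x) + c₃ * (3 * x ^ 2)) x := by
  have h := ((((hasDerivAt_id x).const_mul c₁).const_add c₀).add
    ((hasDerivAt_pow 2 x).const_mul c₂)).add ((hasDerivAt_pow 3 x).const_mul c₃)
  exact h.congr_deriv (by norm_num)

lemma hasDerivAt_hermSlope (x : ℝ) : HasDerivAt hermSlope (hermSlope' x) x := by
  have hpi := Real.pi_ne_zero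
  have h : hermSlope = fun y => 0 + 1 * y + (-2 / Real.pi) * y ^ 2 + (1 / Real.pi ^ 2) * y ^ 3 := funext fun y => by
    unfold hermSlope; field_simp; ring
  rw [h]
  exact (hasDerivAt_cubic 0 1 (-2 / Real.pi) (1 / Real.pi ^ 2) x).congr_deriv (by unfold hermSlope'; field_simp; ring)

lemma hasDerivAt_hermSlope' (x : ℝ) : HasDerivAt hermSlope' (hermSlope'' x) x := by
  have hpi := Real.pi_ne_zero
  have h : hermSlope' = fun y => 1 + (-4 / Real.pi) * y + (3 / Real.pi ^ 2) * y ^ 2 + 0 * y ^ 3 := funext fun y => by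
    unfold hermSlope'; field_simp; ring
  rw [h]
  exact (hasDerivAt_cubic 1 (-4 / Real.pi) (3 / Real.pi ^ 2) 0 x).congr_deriv (by unfold hermSlope''; field_simp; ring)

lemma hasDerivAt_hermVal (x : ℝ) : HasDerivAt hermVal (hermVal' x) x := by
  have hpi := Real.pi_ne_zero
  have h : hermVal = fun y => 1 + 0 * y + (-3 / Real.pi ^ 2) * y ^ 2 + (2 / Real.pi ^ 3) * y ^ 3 := funext fun y => by
    unfold hermVal; field_simp; ring
  rw [h]
  exact (hasDerivAt_cubic 1 0 (-3 / Real.pi ^ 2) (2 / Real.pi ^ 3) x).congr_deriv (by unfold hermVal'; field_simp; ring)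

lemma hasDerivAt_hermVal' (x : ℝ) : HasDerivAt hermVal' (hermVal'' x) x := by
  have hpi := Real.pi_ne_zero
  have h : hermVal' = fun y => 0 + (-6 / Real.pi ^ 2) * y + (6 / Real.pi ^ 3) * y ^ 2 + 0 * y ^ 3 := funext fun y => by
    unfold hermVal'; field_simp; ring
  rw [h]
  exact (hasDerivAt_cubic 0 (-6 / Real.pi ^ 2) (6 / Real.pi ^ 3) 0 x).congr_deriv (by unfold hermVal''; field_simp; ring)

lemma continuous_hermSlope'' : Continuous hermSlope'' := by unfold hermSlope''; fun_prop

lemma continuous_hermVal'' : Continuous hermVal'' := by unfold hermVal''; fun_prop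

@[simp] lemma hermSlope_zero : hermSlope 0 = 0 := by simp [hermSlope]
@[simp] lemma hermSlope'_zero : hermSlope' 0 = 1 := by simp [hermSlope']
@[simp] lemma hermSlope_pi : hermSlope Real.pi = 0 := by simp [hermSlope, Real.pi_ne_zero]
@[simp] lemma hermSlope'_pi : hermSlope' Real.pi = 0 := by
  have := Real.pi_ne_zero
  unfold hermSlope'; field_simp; ring
@[simp] lemma hermVal_zero : hermVal 0 = 1 := by simp [hermVal]
@[simp] lemma hermVal'_zero : hermVal' 0 = 0 := by simp [hermVal']
@[simp] lemma hermVal_pi : hermVal Real.pi = 0 := by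
  have := Real.pi_ne_zero
  unfold hermVal; field_simp; ring
@[simp] lemma hermVal'_pi : hermVal' Real.pi = 0 := by
  have := Real.pi_ne_zero
  unfold hermVal'; field_simp; ring

/-! ### Boundary data of a function on an edge -/

lemma hasDerivAt_comp_pi_sub {s : ℝ → ℝ} {s' x : ℝ} (h : HasDerivAt s s' (Real.pi - x)) :
    HasDerivAt (fun y => s (Real.pi - y)) (-s') x := by
  simpa using HasDerivAt.comp_const_sub Real.pi x h

/-- The boundary data of a function on an edge, in the gauge without magnetic field. -/
def trace (a : ℝ) (f p : ℝ → ℂ) : Fin 4 → ℂ :=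
  ![f 0, p 0 + Complex.I * a * f 0, phase a Real.pi * f Real.pi,
    phase a Real.pi * (p Real.pi + Complex.I * a * f Real.pi)]

/-- The boundary data are integrals of the function and of `v - E u`. -/
lemma exists_trace_kernel (E : ℝ) : ∃ s r : Fin 4 → ℝ → ℝ,
    (∀ i, Continuous (s i)) ∧ (∀ i, Continuous (r i)) ∧
    ∀ (a : ℝ) (u v : EdgeL2) (f p : ℝ → ℂ) (q : EdgeL2), EdgeGraph a u v f p q → ∀ i,
      trace a f p i = (∫ t in (0 : ℝ)..Real.pi, phase a t * s i t * (v - (E : ℂ) • u : EdgeL2) t)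
          + ∫ t in (0 : ℝ)..Real.pi, phase a t * r i t * u t := by
  have hpi : Real.pi ∈ Icc (0 : ℝ) Real.pi := ⟨Real.pi_pos.le, le_rfl⟩
  have c1 : Continuous hermSlope :=
    continuous_iff_continuousAt.2 fun x => (hasDerivAt_hermSlope x).continuousAt
  have c2 : Continuous hermVal :=
    continuous_iff_continuousAt.2 fun x => (hasDerivAt_hermVal x).continuousAt
  have c3 := continuous_hermSlope''
  have c4 := continuous_hermVal''
  -- Each cubic has a double zero at one end and, at the other, only a value or only a slope, so
  -- Lagrange's identity retains a single boundary term. Unlike solutions of the equation, these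
  -- test functions serve for every `E`, including the zeros of `sinPi`.
  refine ⟨![fun t => -hermSlope t, fun t => hermVal t, fun t => -hermSlope (Real.pi - t),
      fun t => -hermVal (Real.pi - t)],
    ![fun t => -(hermSlope'' t + E * hermSlope t), fun t => hermVal'' t + E * hermVal t,
      fun t => -(hermSlope'' (Real.pi - t) + E * hermSlope (Real.pi - t)),
      fun t => -(hermVal'' (Real.pi - t) + E * hermVal (Real.pi - t))], ?_, ?_, ?_⟩
  · intro i
    fin_cases i
    · exact c1.neg
    · exact c2
    · exact (c1.comp (by fun_prop : Continuous fun t : ℝ => Real.pi - t)).neg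
    · exact (c2.comp (by fun_prop : Continuous fun t : ℝ => Real.pi - t)).neg
  · intro i
    have c5 : Continuous fun t : ℝ => Real.pi - t := by fun_prop
    fin_cases i
    · exact (c3.add (c1.const_mul E)).neg
    · exact c4.add (c2.const_mul E)
    · exact ((c3.add (c1.const_mul E)).comp c5).neg
    · exact ((c4.add (c2.const_mul E)).comp c5).neg
  · intro a u v f p q h i
    have l1 := h.lagrange E hasDerivAt_hermSlope hasDerivAt_hermSlope' c3 hpi
    have l2 := h.lagrange E hasDerivAt_hermVal hasDerivAt_hermVal' c4 hpi
    have l3 := h.lagrange E (fun x => hasDerivAt_comp_pi_sub (hasDerivAt_hermSlope (Real.pi - x)))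
      (fun x => (hasDerivAt_comp_pi_sub (hasDerivAt_hermSlope' (Real.pi - x))).neg.congr_deriv (neg_neg _))
      (c3.comp (by fun_prop : Continuous fun t : ℝ => Real.pi - t)) hpi
    have l4 := h.lagrange E (fun x => hasDerivAt_comp_pi_sub (hasDerivAt_hermVal (Real.pi - x)))
      (fun x => (hasDerivAt_comp_pi_sub (hasDerivAt_hermVal' (Real.pi - x))).neg.congr_deriv (neg_neg _))
      (c4.comp (by fun_prop : Continuous fun t : ℝ => Real.pi - t)) hpi
    simp only [hermSlope_zero, hermSlope'_zero, hermSlope_pi, hermSlope'_pi, hermVal_zero,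
      hermVal'_zero, hermVal_pi, hermVal'_pi, sub_self, sub_zero, Complex.ofReal_zero,
      Complex.ofReal_one, Complex.ofReal_neg, neg_zero, zero_mul, mul_zero, one_mul,
      neg_mul, zero_sub, sub_neg_eq_add, zero_add] at l1 l2 l3 l4
    fin_cases i
    · simp only [trace, Fin.zero_eta, Matrix.cons_val_zero, Complex.ofReal_neg, mul_neg, neg_mul,
        intervalIntegral.integral_neg]
      rw [l1]; ring
    · simp only [trace, Fin.mk_one, Matrix.cons_val_one, Matrix.cons_val_zero]
      linear_combination -l2
    · simp only [trace, Fin.reduceFinMk, Matrix.cons_val, Complex.ofReal_neg, mul_neg, neg_mul,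
        intervalIntegral.integral_neg]
      rw [l3]; ring
    · simp only [trace, Fin.reduceFinMk, Matrix.cons_val, Complex.ofReal_neg, mul_neg, neg_mul,
        intervalIntegral.integral_neg]
      rw [l4]; ring

lemma exists_bound_Icc {s : ℝ → ℝ} (hs : Continuous s) :
    ∃ M, 0 ≤ M ∧ ∀ a, ∀ t ∈ Icc (0 : ℝ) Real.pi, ‖phase a t * (s t : ℂ)‖ ≤ M := by
  obtain ⟨M, hM⟩ := isCompact_Icc.exists_bound_of_continuousOn (s := Icc (0 : ℝ) Real.pi)
    hs.continuousOn
  refine ⟨M, (norm_nonneg _).trans (hM 0 ⟨le_rfl, Real.pi_pos.le⟩), fun a t ht => ?_⟩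
  rw [norm_mul, norm_phase, one_mul, Complex.norm_real]
  exact hM t ht

/-- The kernels are bounded on the edge and the gauge factor has modulus one, so a single constant
serves all field strengths `a`. -/
lemma exists_norm_trace_le (E : ℝ) : ∃ K, 0 ≤ K ∧
    ∀ (a : ℝ) (u v : EdgeL2) (f p : ℝ → ℂ) (q : EdgeL2), EdgeGraph a u v f p q → ∀ i,
      ‖trace a f p i‖ ≤ K * (‖u‖ + ‖v - (E : ℂ) • u‖) := by
  obtain ⟨s, r, hs, hr, h⟩ := exists_trace_kernel E
  choose M hM0 hM using fun i => exists_bound_Icc (hs i)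
  choose N hN0 hN using fun i => exists_bound_Icc (hr i)
  refine ⟨(∑ i, (M i + N i)) * √Real.pi, by
    have : 0 ≤ ∑ i, (M i + N i) := Finset.sum_nonneg fun i _ => add_nonneg (hM0 i) (hN0 i)
    positivity, fun a u v f p q hg i => ?_⟩
  rw [h a u v f p q hg i]
  have hpi : Real.pi ∈ Icc (0 : ℝ) Real.pi := ⟨Real.pi_pos.le, le_rfl⟩
  have hph := continuous_phase a
  have b1 := norm_integral_mul_le (s := fun t => phase a t * (s i t : ℂ)) (hM i a)
    (hph.mul (Complex.continuous_ofReal.comp (hs i))) (v - (E : ℂ) • u) hpi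
  have b2 := norm_integral_mul_le (s := fun t => phase a t * (r i t : ℂ)) (hN i a)
    (hph.mul (Complex.continuous_ofReal.comp (hr i))) u hpi
  refine (norm_add_le _ _).trans ((add_le_add b1 b2).trans ?_)
  have hle : M i + N i ≤ ∑ i, (M i + N i) :=
    Finset.single_le_sum (f := fun i => M i + N i)
      (fun i _ => add_nonneg (hM0 i) (hN0 i)) (Finset.mem_univ i)
  have hMi : M i ≤ ∑ i, (M i + N i) := by linarith [hN0 i]
  have hNi : N i ≤ ∑ i, (M i + N i) := by linarith [hM0 i]
  have h1 := mul_le_mul_of_nonneg_right hMi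
    (mul_nonneg (Real.sqrt_nonneg Real.pi) (norm_nonneg (v - (E : ℂ) • u)))
  have h2 := mul_le_mul_of_nonneg_right hNi
    (mul_nonneg (Real.sqrt_nonneg Real.pi) (norm_nonneg u))
  linarith

/-- Integration against a continuous function is an inner product. -/
lemma exists_inner_eq_integral {s : ℝ → ℂ} (hs : Continuous s) :
    ∃ y : EdgeL2, ∀ u : EdgeL2, inner ℂ y u = ∫ t in (0 : ℝ)..Real.pi, s t * u t := by
  obtain ⟨M, hM⟩ := isCompact_Icc.exists_bound_of_continuousOn (s := Icc (0 : ℝ) Real.pi)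
    hs.continuousOn
  have hmem : MemLp (fun t => star (s t)) 2 edgeMeasure := by
    refine MemLp.of_bound (C := M) (by
      exact (hs.star).aestronglyMeasurable) ?_
    filter_upwards [ae_restrict_mem measurableSet_Ioc] with t ht
    rw [norm_star]
    exact hM t (Ioc_subset_Icc_self ht)
  refine ⟨hmem.toLp _, fun u => ?_⟩
  rw [L2.inner_def, intervalIntegral.integral_of_le Real.pi_pos.le]
  refine integral_congr_ae ?_
  filter_upwards [hmem.coeFn_toLp] with t ht
  rw [ht]
  simp [mul_comm]

/-- In the kernel representation one integral is bounded by the residual `v - E u`, and the other is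
the inner product of `u` with a fixed vector. This is how weak convergence becomes convergence of
boundary data. -/
lemma tendsto_trace {E a : ℝ} {u v : ℕ → EdgeL2} {f p : ℕ → ℝ → ℂ} {q : ℕ → EdgeL2}
    (h : ∀ n, EdgeGraph a (u n) (v n) (f n) (p n) (q n))
    (hu : ∀ y : EdgeL2, Tendsto (fun n => inner ℂ y (u n)) atTop (𝓝 0))
    (hv : Tendsto (fun n => ‖v n - (E : ℂ) • u n‖) atTop (𝓝 0)) (i : Fin 4) :
    Tendsto (fun n => trace a (f n) (p n) i) atTop (𝓝 0) := by
  obtain ⟨s, r, hs, hr, hk⟩ := exists_trace_kernel E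
  obtain ⟨M, -, hM⟩ := exists_bound_Icc (hs i)
  have hph := continuous_phase a
  obtain ⟨y, hy⟩ := exists_inner_eq_integral (s := fun t => phase a t * (r i t : ℂ))
    (hph.mul (Complex.continuous_ofReal.comp (hr i)))
  have h1 : Tendsto (fun n => ∫ t in (0 : ℝ)..Real.pi,
      phase a t * s i t * (v n - (E : ℂ) • u n : EdgeL2) t) atTop (𝓝 0) := by
    refine squeeze_zero_norm (a := fun n => M * √Real.pi * ‖v n - (E : ℂ) • u n‖) (fun n => ?_) ?_
    · exact norm_integral_mul_le (hM a)
        (hph.mul (Complex.continuous_ofReal.comp (hs i))) _ ⟨Real.pi_pos.le, le_rfl⟩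
    · simpa using hv.const_mul (M * √Real.pi)
  have h2 := h1.add (hu y)
  rw [add_zero] at h2
  refine h2.congr fun n => ?_
  rw [hk a _ _ _ _ _ (h n) i, hy]

/-- Variation of constants: in Lagrange's identity the test function `t ↦ sinE E (x - t)` solves the
homogeneous equation, so the integral against `u` drops out. -/
lemma EdgeGraph.formula {a : ℝ} {u v : EdgeL2} {f p : ℝ → ℂ} {q : EdgeL2}
    (h : EdgeGraph a u v f p q) (E : ℝ) {x : ℝ} (hx : x ∈ Icc (0 : ℝ) Real.pi) :
    phase a x * f x = cosE E x * f 0 + sinE E x * (p 0 + Complex.I * a * f 0)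
      - ∫ t in (0 : ℝ)..x, phase a t * sinE E (x - t) * (v - (E : ℂ) • u : EdgeL2) t := by
  have d1 : ∀ t, HasDerivAt (fun y => sinE E (x - y)) (-cosE E (x - t)) t := fun t => by
    simpa using HasDerivAt.comp_const_sub x t (hasDerivAt_sinE E (x - t))
  have d2 : ∀ t, HasDerivAt (fun y => -cosE E (x - y)) (-E * sinE E (x - t)) t := fun t => by
    exact (HasDerivAt.comp_const_sub x t (hasDerivAt_cosE E (x - t))).neg.congr_deriv (by ring)
  have l := h.lagrange E d1 d2
    (((continuous_sinE E).comp (by fun_prop : Continuous fun t : ℝ => x - t)).const_mul (-E)) hx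
  simp only [sub_self, sinE_zero_right, cosE_zero_right, sub_zero, neg_mul, neg_add_cancel,
    Complex.ofReal_zero, mul_zero, zero_mul, intervalIntegral.integral_zero, add_zero,
    Complex.ofReal_neg, Complex.ofReal_one, one_mul, sub_neg_eq_add, zero_add] at l
  linear_combination l

/-- By variation of constants, the value and quasiderivative at the left end together with the
residual control the function on the whole edge, at every energy. -/
lemma exists_norm_le_of_trace (E : ℝ) : ∃ K, 0 ≤ K ∧
    ∀ (a : ℝ) (u v : EdgeL2) (f p : ℝ → ℂ) (q : EdgeL2), EdgeGraph a u v f p q →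
      ‖u‖ ≤ K * (‖trace a f p 0‖ + ‖trace a f p 1‖ + ‖v - (E : ℂ) • u‖) := by
  obtain ⟨M₁, hM₁, h₁⟩ := exists_bound_Icc (continuous_cosE E)
  obtain ⟨M₂, hM₂, h₂⟩ := exists_bound_Icc (continuous_sinE E)
  have hc : Continuous fun z : ℝ × ℝ => sinE E (z.1 - z.2) :=
    (continuous_sinE E).comp (by fun_prop)
  obtain ⟨M₃, h₃⟩ := (isCompact_Icc.prod isCompact_Icc).exists_bound_of_continuousOn
    (s := Icc (0 : ℝ) Real.pi ×ˢ Icc (0 : ℝ) Real.pi) hc.continuousOn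
  have hz : (0 : ℝ) ∈ Icc (0 : ℝ) Real.pi := ⟨le_rfl, Real.pi_pos.le⟩
  have hM₃ : 0 ≤ M₃ := (norm_nonneg _).trans (h₃ (0, 0) ⟨hz, hz⟩)
  refine ⟨√Real.pi * (M₁ + M₂ + M₃ * √Real.pi), by positivity, fun a u v f p q h => ?_⟩
  have key : ∀ x ∈ Icc (0 : ℝ) Real.pi, ‖f x‖ ≤
      (M₁ + M₂ + M₃ * √Real.pi) *
        (‖trace a f p 0‖ + ‖trace a f p 1‖ + ‖v - (E : ℂ) • u‖) := by
    intro x hx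
    have e := h.formula E hx
    have n1 : ‖f x‖ = ‖phase a x * f x‖ := by rw [norm_mul, norm_phase, one_mul]
    have b1 := norm_integral_mul_le (s := fun t => phase a t * (sinE E (x - t) : ℂ)) (M := M₃)
      (fun t ht => by
        rw [norm_mul, norm_phase, one_mul, Complex.norm_real]
        exact h₃ (x, t) ⟨hx, ht⟩)
      ((continuous_phase a).mul (Complex.continuous_ofReal.comp
        ((continuous_sinE E).comp (by fun_prop)))) (v - (E : ℂ) • u) hx
    have b2 : ‖(cosE E x : ℂ) * f 0‖ ≤ M₁ * ‖f 0‖ := by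
      have := h₁ a x hx
      rw [norm_mul, norm_phase, one_mul] at this
      rw [norm_mul]; gcongr
    have b3 : ‖(sinE E x : ℂ) * (p 0 + Complex.I * a * f 0)‖
        ≤ M₂ * ‖p 0 + Complex.I * a * f 0‖ := by
      have := h₂ a x hx
      rw [norm_mul, norm_phase, one_mul] at this
      rw [norm_mul]; gcongr
    have t0 : trace a f p 0 = f 0 := rfl
    have t1 : trace a f p 1 = p 0 + Complex.I * a * f 0 := rfl
    rw [n1, e, t0, t1]
    refine (norm_sub_le _ _).trans ((add_le_add (norm_add_le _ _) le_rfl).trans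
      ((add_le_add (add_le_add b2 b3) b1).trans ?_))
    have hα := norm_nonneg (f 0)
    have hβ := norm_nonneg (p 0 + Complex.I * a * f 0)
    have hγ := norm_nonneg (v - (E : ℂ) • u)
    have hQ : 0 ≤ M₃ * √Real.pi := by positivity
    have m1 : M₁ ≤ M₁ + M₂ + M₃ * √Real.pi := by linarith
    have m2 : M₂ ≤ M₁ + M₂ + M₃ * √Real.pi := by linarith
    have m3 : M₃ * √Real.pi ≤ M₁ + M₂ + M₃ * √Real.pi := by linarith
    rw [mul_add, mul_add]
    gcongr
  have hnn : 0 ≤ (M₁ + M₂ + M₃ * √Real.pi) *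
        (‖trace a f p 0‖ + ‖trace a f p 1‖ + ‖v - (E : ℂ) • u‖) := by positivity
  rw [mul_assoc]
  refine edge_norm_le hnn ?_
  filter_upwards [h.sob.repr, ae_restrict_mem measurableSet_Ioc] with x hx1 hx2
  rw [hx1]
  exact key x (Ioc_subset_Icc_self hx2)

/-- The slope at the left end in terms of the values at both ends. -/
lemma EdgeGraph.slope_left {a : ℝ} {u v : EdgeL2} {f p : ℝ → ℂ} {q : EdgeL2}
    (h : EdgeGraph a u v f p q) (E : ℝ) :
    sinPi E * trace a f p 1 = trace a f p 2 - cosPi E * trace a f p 0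
      + ∫ t in (0 : ℝ)..Real.pi, phase a t * sinE E (Real.pi - t)
          * (v - (E : ℂ) • u : EdgeL2) t := by
  have l := h.formula E (x := Real.pi) ⟨Real.pi_pos.le, le_rfl⟩
  change sinPi E * (p 0 + Complex.I * a * f 0) = phase a Real.pi * f Real.pi - cosPi E * f 0 + _
  unfold sinPi cosPi
  linear_combination -l

/-- The slope at the right end in terms of the values at both ends. -/
lemma EdgeGraph.slope_right {a : ℝ} {u v : EdgeL2} {f p : ℝ → ℂ} {q : EdgeL2}
    (h : EdgeGraph a u v f p q) (E : ℝ) :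
    sinPi E * trace a f p 3 = cosPi E * trace a f p 2 - trace a f p 0
      - ∫ t in (0 : ℝ)..Real.pi, phase a t * sinE E t * (v - (E : ℂ) • u : EdgeL2) t := by
  have l := h.lagrange E (hasDerivAt_sinE E) (hasDerivAt_cosE E)
    ((continuous_sinE E).const_mul (-E)) (x := Real.pi) ⟨Real.pi_pos.le, le_rfl⟩
  simp only [sinE_zero_right, cosE_zero_right, neg_mul, neg_add_cancel,
    Complex.ofReal_zero, mul_zero, zero_mul, intervalIntegral.integral_zero, add_zero,
    Complex.ofReal_one, one_mul, zero_sub] at l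
  change sinPi E * (phase a Real.pi * (p Real.pi + Complex.I * a * f Real.pi))
    = cosPi E * (phase a Real.pi * f Real.pi) - f 0 - _
  unfold sinPi cosPi
  linear_combination l

/-! ### The vertices -/

lemma hasSum_norm_sq (u : GraphL2) : HasSum (fun e => ‖u e‖ ^ 2) (‖u‖ ^ 2) := by
  have h := lp.hasSum_norm (p := 2) (by norm_num) u
  simpa using h

lemma InGraph.exists_edgeGraph {α A : ℤ → ℝ} {u v : GraphL2} (h : InGraph α A u v) :
    ∃ (f p : Edge → ℝ → ℂ) (q : Edge → EdgeL2),
      (∀ e, EdgeGraph (edgeA A e) (u e) (v e) (f e) (p e) (q e)) ∧ DeltaCoupling α A f p := by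
  obtain ⟨f, p, q, h1, h2, h3⟩ := h
  refine ⟨f, p, q, fun e => ⟨h1 e, ?_⟩, h2⟩
  rw [← edgeField_eq]
  exact h3 e

lemma DeltaCoupling.left {α A : ℤ → ℝ} {f p : Edge → ℝ → ℂ} (h : DeltaCoupling α A f p)
    (e : Edge) : trace (edgeA A e) (f e) (p e) 0 = f (e.1, true) 0 := by
  obtain ⟨j, b⟩ := e
  cases b
  · exact (h.cont_upper_lower j).symm
  · rfl

lemma DeltaCoupling.right {α A : ℤ → ℝ} {f p : Edge → ℝ → ℂ} (h : DeltaCoupling α A f p)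
    (e : Edge) : trace (edgeA A e) (f e) (p e) 2
      = phase (edgeA A e) Real.pi * f (e.1 + 1, true) 0 := by
  obtain ⟨j, b⟩ := e
  have h1 := h.cont_left_upper (j + 1)
  have h2 := h.cont_left_lower (j + 1)
  rw [add_sub_cancel_right] at h1 h2
  cases b
  · exact congrArg (fun z => phase (edgeA A (j, false)) Real.pi * z) h2
  · exact congrArg (fun z => phase (edgeA A (j, true)) Real.pi * z) h1

/-- The data at the right end contain the gauge factor of the edge, which the phase of opposite sign
undoes: `-A` on the upper semicircle and `A` on the lower one. -/
lemma DeltaCoupling.jump_trace {α A : ℤ → ℝ} {f p : Edge → ℝ → ℂ} (h : DeltaCoupling α A f p)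
    (j : ℤ) :
    trace (edgeA A (j, true)) (f (j, true)) (p (j, true)) 1
      + trace (edgeA A (j, false)) (f (j, false)) (p (j, false)) 1
      - phase (-A (j - 1)) Real.pi
        * trace (edgeA A (j - 1, true)) (f (j - 1, true)) (p (j - 1, true)) 3
      - phase (A (j - 1)) Real.pi
        * trace (edgeA A (j - 1, false)) (f (j - 1, false)) (p (j - 1, false)) 3
      = α j * f (j, true) 0 := by
  have hj := h.jump j
  simp only [quasiDeriv, edgeField_eq] at hj
  have e1 := phase_neg_mul (A (j - 1)) Real.pi
  have a1 : edgeA A (j - 1, true) = A (j - 1) := rfl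
  have a2 : edgeA A (j - 1, false) = -A (j - 1) := rfl
  rw [← hj, a1, a2]
  change _ + _ - _ * (phase (A (j - 1)) Real.pi * (p (j - 1, true) Real.pi
    + Complex.I * (A (j - 1) : ℝ) * f (j - 1, true) Real.pi)) - _ * (phase (-A (j - 1)) Real.pi
    * (p (j - 1, false) Real.pi + Complex.I * ((-A (j - 1) : ℝ) : ℂ)
      * f (j - 1, false) Real.pi)) = _
  simp only [trace, Matrix.cons_val_one, Matrix.cons_val_zero]
  linear_combination (-(p (j - 1, true) Real.pi
    + Complex.I * (A (j - 1) : ℝ) * f (j - 1, true) Real.pi) - (p (j - 1, false) Real.pi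
    + Complex.I * ((-A (j - 1) : ℝ) : ℂ) * f (j - 1, false) Real.pi)) * e1

/-- The coefficient of the vertex equation on the ring `j`. -/
def hop (A : ℤ → ℝ) (j : ℤ) : ℝ := Real.cos (A j * Real.pi)

/-- The diagonal coefficient of the vertex equation with coupling `a`. -/
def eta (a E : ℝ) : ℝ := 2 * cosPi E + a / 2 * sinPi E

lemma phase_edgeA_add (A : ℤ → ℝ) (j : ℤ) :
    phase (edgeA A (j, true)) Real.pi + phase (edgeA A (j, false)) Real.pi = 2 * (hop A j : ℂ) :=
  phase_add_phase_neg (A j) Real.pi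

/-- The defect of the vertex equation at the vertex `j`. -/
def defect (α A : ℤ → ℝ) (E : ℝ) (U : ℤ → ℂ) (j : ℤ) : ℂ :=
  hop A j * U (j + 1) + hop A (j - 1) * U (j - 1) - eta (α j) E * U j

/-- From the graph of the Hamiltonian to the vertices. -/
theorem exists_vertex_bounds (E : ℝ) : ∃ K, 0 ≤ K ∧ ∀ A : ℤ → ℝ, ∃ y z : ℤ → EdgeL2,
    ∀ (α : ℤ → ℝ) (u v : GraphL2), InGraph α A u v → ∃ U : ℤ → ℂ,
      (∀ j, U j = inner ℂ (y j) (u (j, true))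
        + inner ℂ (z j) (v (j, true) - (E : ℂ) • u (j, true))) ∧
      (∀ j, ‖U j‖ ≤ K * (‖u (j, true)‖ + ‖v (j, true) - (E : ℂ) • u (j, true)‖)) ∧
      (∀ j, ‖defect α A E U j‖
        ≤ K * (‖v (j, true) - (E : ℂ) • u (j, true)‖ + ‖v (j, false) - (E : ℂ) • u (j, false)‖
          + ‖v (j - 1, true) - (E : ℂ) • u (j - 1, true)‖
          + ‖v (j - 1, false) - (E : ℂ) • u (j - 1, false)‖)) ∧
      (sinPi E ≠ 0 → ∀ e : Edge,
        ‖u e‖ ≤ K * (‖U e.1‖ + ‖U (e.1 + 1)‖ + ‖v e - (E : ℂ) • u e‖)) := by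
  obtain ⟨K₁, hK₁, h₁⟩ := exists_norm_trace_le E
  obtain ⟨K₂, hK₂, h₂⟩ := exists_norm_le_of_trace E
  obtain ⟨M, hM, hMb⟩ := exists_bound_Icc (continuous_sinE E)
  obtain ⟨N, hN, hNb⟩ := exists_bound_Icc ((continuous_sinE E).comp
    (by fun_prop : Continuous fun t : ℝ => Real.pi - t))
  obtain ⟨s, r, hs, hr, hk⟩ := exists_trace_kernel E
  have hpi : Real.pi ∈ Icc (0 : ℝ) Real.pi := ⟨Real.pi_pos.le, le_rfl⟩
  have hbM : ∀ (a : ℝ) (g : EdgeL2), ‖∫ t in (0 : ℝ)..Real.pi, phase a t * sinE E t * g t‖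
      ≤ M * √Real.pi * ‖g‖ := fun a g =>
    norm_integral_mul_le (hMb a) ((continuous_phase a).mul (Complex.continuous_ofReal.comp
      (continuous_sinE E))) g hpi
  have hbN : ∀ (a : ℝ) (g : EdgeL2),
      ‖∫ t in (0 : ℝ)..Real.pi, phase a t * sinE E (Real.pi - t) * g t‖
      ≤ N * √Real.pi * ‖g‖ := fun a g =>
    norm_integral_mul_le (hNb a) ((continuous_phase a).mul (Complex.continuous_ofReal.comp
      ((continuous_sinE E).comp (by fun_prop)))) g hpi
  set B := M * √Real.pi with hB
  set D := N * √Real.pi with hD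
  have hB0 : 0 ≤ B := by positivity
  have hD0 : 0 ≤ D := by positivity
  set K₃ := K₂ * (1 + |sinPi E|⁻¹ * (1 + |cosPi E| + D)) with hK₃
  have hK₃0 : 0 ≤ K₃ := by positivity
  refine ⟨K₁ + (B + D) + K₃, by positivity, fun A => ?_⟩
  -- The representing vectors depend only on `E` and `A`, not on the function. This makes the vertex
  -- values linear in `u`, as is needed for the vertex map on eigenspaces.
  choose y hy using fun j : ℤ => exists_inner_eq_integral
    (s := fun t => phase (edgeA A (j, true)) t * (r 0 t : ℂ))
    ((continuous_phase _).mul (Complex.continuous_ofReal.comp (hr 0)))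
  choose z hz using fun j : ℤ => exists_inner_eq_integral
    (s := fun t => phase (edgeA A (j, true)) t * (s 0 t : ℂ))
    ((continuous_phase _).mul (Complex.continuous_ofReal.comp (hs 0)))
  refine ⟨y, z, fun α u v huv => ?_⟩
  obtain ⟨f, p, q, hg, hc⟩ := huv.exists_edgeGraph
  refine ⟨fun j => f (j, true) 0, fun j => ?_, fun j => ?_, fun j => ?_, fun hS e => ?_⟩
  · rw [hy, hz, add_comm, ← hk _ _ _ _ _ _ (hg (j, true)) 0]
    rfl
  · refine (h₁ _ _ _ _ _ _ (hg (j, true)) 0).trans ?_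
    gcongr
    linarith
  · have l1 := (hg (j, true)).slope_left E
    have l2 := (hg (j, false)).slope_left E
    have r1 := (hg (j - 1, true)).slope_right E
    have r2 := (hg (j - 1, false)).slope_right E
    have hj := hc.jump_trace j
    rw [hc.left, hc.right] at l1 l2 r1 r2
    simp only [sub_add_cancel] at r1 r2
    have b1 := hbN (edgeA A (j, true)) (v (j, true) - (E : ℂ) • u (j, true))
    have b2 := hbN (edgeA A (j, false)) (v (j, false) - (E : ℂ) • u (j, false))
    have b3 := hbM (edgeA A (j - 1, true)) (v (j - 1, true) - (E : ℂ) • u (j - 1, true))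
    have b4 := hbM (edgeA A (j - 1, false)) (v (j - 1, false) - (E : ℂ) • u (j - 1, false))
    have a1 : edgeA A (j - 1, true) = A (j - 1) := rfl
    have a2 : edgeA A (j - 1, false) = -A (j - 1) := rfl
    have p1 := phase_edgeA_add A j
    have p2 := phase_edgeA_add A (j - 1)
    rw [a1, a2] at p2
    have e1 := phase_neg_mul (A (j - 1)) Real.pi
    rw [a1] at r1 b3
    rw [a2] at r2 b4
    rw [a1, a2] at hj
    set I1 := ∫ t in (0 : ℝ)..Real.pi, phase (edgeA A (j, true)) t * sinE E (Real.pi - t)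
      * (v (j, true) - (E : ℂ) • u (j, true) : EdgeL2) t
    set I2 := ∫ t in (0 : ℝ)..Real.pi, phase (edgeA A (j, false)) t * sinE E (Real.pi - t)
      * (v (j, false) - (E : ℂ) • u (j, false) : EdgeL2) t
    set I3 := ∫ t in (0 : ℝ)..Real.pi, phase (A (j - 1)) t * sinE E t
      * (v (j - 1, true) - (E : ℂ) • u (j - 1, true) : EdgeL2) t
    set I4 := ∫ t in (0 : ℝ)..Real.pi, phase (-A (j - 1)) t * sinE E t
      * (v (j - 1, false) - (E : ℂ) • u (j - 1, false) : EdgeL2) t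
    set x := phase (A (j - 1)) Real.pi
    set x' := phase (-A (j - 1)) Real.pi
    -- `sinPi E` times the jump condition, with all four slopes eliminated by `slope_left` and
    -- `slope_right`. Nothing is divided by `sinPi E`, so the estimate is valid at the squares too.
    have key : defect α A E (fun j => f (j, true) 0) j
        = -(1 / 2 : ℂ) * (I1 + I2 + x' * I3 + x * I4) := by
      simp only [defect, eta]
      push_cast
      linear_combination (1 / 2 : ℂ) * (sinPi E * hj - l1 - l2 + x' * r1 + x * r2)
        - (1 / 2 : ℂ) * f (j + 1, true) 0 * p1 - (1 / 2 : ℂ) * f (j - 1, true) 0 * p2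
        + (cosPi E * f (j, true) 0) * e1
    have hx : ‖x‖ = 1 := norm_phase _ _
    have hx' : ‖x'‖ = 1 := norm_phase _ _
    rw [key, norm_mul]
    have n1 : ‖-(1 / 2 : ℂ)‖ ≤ 1 := by norm_num
    have n2 : ‖I1 + I2 + x' * I3 + x * I4‖ ≤ ‖I1‖ + ‖I2‖ + ‖I3‖ + ‖I4‖ := by
      refine (norm_add_le _ _).trans (add_le_add ((norm_add_le _ _).trans
        (add_le_add (norm_add_le _ _) ?_)) ?_)
      · rw [norm_mul, hx', one_mul]
      · rw [norm_mul, hx, one_mul]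
    have hK : ∀ x : ℝ, 0 ≤ x → D * x ≤ (K₁ + (B + D) + K₃) * x := fun x hx =>
      mul_le_mul_of_nonneg_right (by linarith) hx
    have hK' : ∀ x : ℝ, 0 ≤ x → B * x ≤ (K₁ + (B + D) + K₃) * x := fun x hx =>
      mul_le_mul_of_nonneg_right (by linarith) hx
    refine (mul_le_mul n1 n2 (norm_nonneg _) zero_le_one).trans ?_
    rw [one_mul, mul_add, mul_add, mul_add]
    exact add_le_add (add_le_add (add_le_add (b1.trans (hK _ (norm_nonneg _)))
      (b2.trans (hK _ (norm_nonneg _)))) (b3.trans (hK' _ (norm_nonneg _))))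
      (b4.trans (hK' _ (norm_nonneg _)))
  · have l1 := (hg e).slope_left E
    have b1 := hbN (edgeA A e) (v e - (E : ℂ) • u e)
    have b2 := h₂ _ _ _ _ _ _ (hg e)
    rw [hc.left] at l1 b2
    rw [hc.right] at l1
    have hS' : (sinPi E : ℂ) ≠ 0 := by exact_mod_cast hS
    have e1 : trace (edgeA A e) (f e) (p e) 1 = (sinPi E : ℂ)⁻¹ * (phase (edgeA A e) Real.pi
        * f (e.1 + 1, true) 0 - cosPi E * f (e.1, true) 0 +
        ∫ t in (0 : ℝ)..Real.pi, phase (edgeA A e) t * sinE E (Real.pi - t)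
          * (v e - (E : ℂ) • u e : EdgeL2) t) := by
      rw [← l1, inv_mul_cancel_left₀ hS']
    have n1 : ‖trace (edgeA A e) (f e) (p e) 1‖ ≤ |sinPi E|⁻¹ * (‖f (e.1 + 1, true) 0‖
        + |cosPi E| * ‖f (e.1, true) 0‖ + D * ‖v e - (E : ℂ) • u e‖) := by
      rw [e1, norm_mul, norm_inv, Complex.norm_real, Real.norm_eq_abs]
      gcongr
      refine (norm_add_le _ _).trans (add_le_add ((norm_sub_le _ _).trans (add_le_add ?_ ?_)) b1)
      · rw [norm_mul, norm_phase, one_mul]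
      · rw [norm_mul, Complex.norm_real, Real.norm_eq_abs]
    have hα := norm_nonneg (f (e.1, true) 0)
    have hβ := norm_nonneg (f (e.1 + 1, true) 0)
    have hγ := norm_nonneg (v e - (E : ℂ) • u e)
    refine b2.trans ?_
    simp only
    generalize ‖f (e.1, true) 0‖ = x0 at *
    generalize ‖f (e.1 + 1, true) 0‖ = x1 at *
    generalize ‖v e - (E : ℂ) • u e‖ = g at *
    have hs0 : 0 ≤ x0 + x1 + g := by positivity
    have m1 : x1 + |cosPi E| * x0 + D * g ≤ (1 + |cosPi E| + D) * (x0 + x1 + g) := by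
      have a1 := mul_le_mul_of_nonneg_left (show x0 ≤ x0 + x1 + g by linarith)
        (abs_nonneg (cosPi E))
      have a2 := mul_le_mul_of_nonneg_left (show g ≤ x0 + x1 + g by linarith) hD0
      linarith
    have m2 : |sinPi E|⁻¹ * (x1 + |cosPi E| * x0 + D * g)
        ≤ |sinPi E|⁻¹ * ((1 + |cosPi E| + D) * (x0 + x1 + g)) := by gcongr
    calc K₂ * (x0 + ‖trace (edgeA A e) (f e) (p e) 1‖ + g)
        ≤ K₂ * (x0 + |sinPi E|⁻¹ * ((1 + |cosPi E| + D) * (x0 + x1 + g)) + g) := by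
          gcongr; exact n1.trans m2
      _ ≤ K₂ * ((x0 + x1 + g) + |sinPi E|⁻¹ * ((1 + |cosPi E| + D) * (x0 + x1 + g))) := by
          gcongr ?_ * ?_; linarith
      _ = K₃ * (x0 + x1 + g) := by rw [hK₃]; ring
      _ ≤ (K₁ + (B + D) + K₃) * (x0 + x1 + g) := by gcongr; linarith

/-! ### Edge functions with prescribed vertex values -/

lemma memLp_edge_of_continuous {f : ℝ → ℂ} (hf : Continuous f) : MemLp f 2 edgeMeasure := by
  obtain ⟨M, hM⟩ := isCompact_Icc.exists_bound_of_continuousOn (s := Icc (0 : ℝ) Real.pi)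
    hf.continuousOn
  refine MemLp.of_bound (C := M) hf.aestronglyMeasurable ?_
  filter_upwards [ae_restrict_mem measurableSet_Ioc] with t ht
  exact hM t (Ioc_subset_Icc_self ht)

/-- The class in `L²` of a continuous function on an edge. -/
def edgeLp (f : ℝ → ℂ) (hf : Continuous f) : EdgeL2 := (memLp_edge_of_continuous hf).toLp f

lemma coeFn_edgeLp {f : ℝ → ℂ} (hf : Continuous f) : edgeLp f hf =ᵐ[edgeMeasure] f :=
  MemLp.coeFn_toLp _

lemma norm_edgeLp_le {f : ℝ → ℂ} (hf : Continuous f) {M : ℝ} (hM : 0 ≤ M)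
    (h : ∀ x ∈ Icc (0 : ℝ) Real.pi, ‖f x‖ ≤ M) : ‖edgeLp f hf‖ ≤ √Real.pi * M := by
  refine edge_norm_le hM ?_
  filter_upwards [coeFn_edgeLp hf, ae_restrict_mem measurableSet_Ioc] with t h1 h2
  rw [h1]
  exact h t (Ioc_subset_Icc_self h2)

lemma summable_edge {w : ℤ → ℝ} (hw0 : ∀ j, 0 ≤ w j) (hw : Summable w) :
    Summable fun e : Edge => w e.1 := by
  have h := hw.mul_of_nonneg (Summable.of_finite (f := fun _ : Bool => (1 : ℝ)))
    hw0 (fun _ => zero_le_one)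
  simpa using h

/-- The function `exp (- i a x) F` on an edge, with `F` of class `C²`. -/
lemma edgeGraph_of_gauge (a : ℝ) {F P Q : ℝ → ℂ} (hF : ∀ x, HasDerivAt F (P x) x)
    (hP : ∀ x, HasDerivAt P (Q x) x) (hQ : Continuous Q) :
    ∃ (hu : Continuous fun x => phase (-a) x * F x) (hv : Continuous fun x => -(phase (-a) x * Q x))
      (p : ℝ → ℂ) (q : EdgeL2),
      EdgeGraph a (edgeLp _ hu) (edgeLp _ hv) (fun x => phase (-a) x * F x) p q ∧
      p 0 + Complex.I * a * F 0 = P 0 ∧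
      p Real.pi + Complex.I * a * (phase (-a) Real.pi * F Real.pi)
        = phase (-a) Real.pi * P Real.pi := by
  have hFc : Continuous F := continuous_iff_continuousAt.2 fun x => (hF x).continuousAt
  have hPc : Continuous P := continuous_iff_continuousAt.2 fun x => (hP x).continuousAt
  have hph := continuous_phase (-a)
  have hu : Continuous fun x => phase (-a) x * F x := by fun_prop
  have hv : Continuous fun x => -(phase (-a) x * Q x) := by fun_prop
  set p : ℝ → ℂ := fun x => phase (-a) x * (P x - Complex.I * a * F x) with hp
  set q : ℝ → ℂ := fun x => phase (-a) x * (Q x - 2 * Complex.I * a * P x - (a : ℂ) ^ 2 * F x)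
    with hq
  have hqc : Continuous q := by fun_prop
  have d1 : ∀ x, HasDerivAt (fun x => phase (-a) x * F x) (p x) x := fun x => by
    refine ((hasDerivAt_phase (-a) x).mul (hF x)).congr_deriv ?_
    simp only [hp]; push_cast; ring
  have d2 : ∀ x, HasDerivAt p (q x) x := fun x => by
    refine ((hasDerivAt_phase (-a) x).mul
      ((hP x).sub ((hF x).const_mul (Complex.I * (a : ℂ))))).congr_deriv ?_
    simp only [hq, Pi.sub_apply]; push_cast
    linear_combination (phase (-a) x * a ^ 2 * F x) * Complex.I_sq
  refine ⟨hu, hv, p, edgeLp q hqc, ⟨⟨coeFn_edgeLp hu, fun x _ => (d1 x).hasDerivWithinAt,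
    fun x hx => ?_⟩, ?_⟩, ?_, ?_⟩
  · rw [integral_congr_edge (coeFn_edgeLp hqc) hx, intervalIntegral.integral_eq_sub_of_hasDerivAt
      (fun t _ => d2 t) (hqc.intervalIntegrable _ _)]
    ring
  · filter_upwards [coeFn_edgeLp hv, coeFn_edgeLp hqc] with x h1 h2
    rw [h1, h2]
    simp only [hp, hq]
    linear_combination (-2 * phase (-a) x * a ^ 2 * F x) * Complex.I_sq
  · simp [hp]
  · simp only [hp]; ring

/-- Elements of the graph of the Hamiltonian from functions of class `C²` on the edges, given in
the gauge without magnetic field. -/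
theorem exists_inGraph {α A : ℤ → ℝ} {F P Q : Edge → ℝ → ℂ} {w : Edge → ℝ} {U : ℤ → ℂ}
    (hF : ∀ e x, HasDerivAt (F e) (P e x) x) (hP : ∀ e x, HasDerivAt (P e) (Q e x) x)
    (hQ : ∀ e, Continuous (Q e)) (hw : Summable fun e => w e ^ 2)
    (hFw : ∀ e, ∀ x ∈ Icc (0 : ℝ) Real.pi, ‖F e x‖ ≤ w e)
    (hQw : ∀ e, ∀ x ∈ Icc (0 : ℝ) Real.pi, ‖Q e x‖ ≤ w e)
    (hL : ∀ e, F e 0 = U e.1)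
    (hR : ∀ e, F e Real.pi = phase (edgeA A e) Real.pi * U (e.1 + 1))
    (hJ : ∀ j, P (j, true) 0 + P (j, false) 0 - phase (-A (j - 1)) Real.pi * P (j - 1, true) Real.pi
      - phase (A (j - 1)) Real.pi * P (j - 1, false) Real.pi = α j * U j) :
    ∃ u v : GraphL2, InGraph α A u v ∧
      (∀ e, u e =ᵐ[edgeMeasure] fun x => phase (-edgeA A e) x * F e x) ∧
      (∀ e, v e =ᵐ[edgeMeasure] fun x => -(phase (-edgeA A e) x * Q e x)) ∧
      (∀ e, ∃ f p q, EdgeGraph (edgeA A e) (u e) (v e) f p q ∧ f 0 = U e.1 ∧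
        trace (edgeA A e) f p 1 = P e 0) := by
  choose hu hv p q hg hp0 hpπ using fun e => edgeGraph_of_gauge (edgeA A e) (hF e) (hP e) (hQ e)
  have hw0 : ∀ e, 0 ≤ w e := fun e => (norm_nonneg _).trans (hFw e 0 ⟨le_rfl, Real.pi_pos.le⟩)
  have hmem : ∀ x : (e : Edge) → EdgeL2, (∀ e, ‖x e‖ ≤ √Real.pi * w e) → Memℓp x 2 := by
    intro x hx
    refine memℓp_gen ?_
    refine Summable.of_nonneg_of_le (f := fun e => Real.pi * w e ^ 2) (fun e => by positivity)
      (fun e => ?_) (hw.mul_left _)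
    have : ‖x e‖ ^ (2 : ENNReal).toReal = ‖x e‖ ^ 2 := by norm_num
    rw [this]
    calc ‖x e‖ ^ 2 ≤ (√Real.pi * w e) ^ 2 := by gcongr; exact hx e
      _ = Real.pi * w e ^ 2 := by rw [mul_pow, Real.sq_sqrt Real.pi_pos.le]
  let u : GraphL2 := ⟨fun e => edgeLp _ (hu e), hmem _ fun e =>
    norm_edgeLp_le (hu e) (hw0 e) fun x hx => by
      rw [norm_mul, norm_phase, one_mul]; exact hFw e x hx⟩
  let v : GraphL2 := ⟨fun e => edgeLp _ (hv e), hmem _ fun e =>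
    norm_edgeLp_le (hv e) (hw0 e) fun x hx => by
      rw [norm_neg, norm_mul, norm_phase, one_mul]; exact hQw e x hx⟩
  have hphm : ∀ e x, phase (-edgeA A e) x * phase (edgeA A e) x = 1 := fun e x => phase_neg_mul _ _
  have hv0 : ∀ e, phase (-edgeA A e) 0 * F e 0 = U e.1 := fun e => by simp [hL]
  have hvπ : ∀ e, phase (-edgeA A e) Real.pi * F e Real.pi = U (e.1 + 1) := fun e => by
    rw [hR, ← mul_assoc, hphm, one_mul]
  refine ⟨u, v, ⟨fun e x => phase (-edgeA A e) x * F e x, p, q, fun e => (hg e).sob,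
    ⟨fun j => ?_, fun j => ?_, fun j => ?_, fun j => ?_⟩, fun e => ?_⟩,
    fun e => coeFn_edgeLp (hu e), fun e => coeFn_edgeLp (hv e),
    fun e => ⟨_, _, _, hg e, hv0 e, by rw [← hp0 e]; simp [trace]⟩⟩
  · rw [hv0, hv0]
  · rw [hv0, hvπ, sub_add_cancel]
  · rw [hv0, hvπ, sub_add_cancel]
  · have q0 : ∀ e, quasiDeriv A e (fun x => phase (-edgeA A e) x * F e x) (p e) 0 = P e 0 :=
      fun e => by
        rw [← hp0 e]
        simp [quasiDeriv, edgeField_eq]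
    have qπ : ∀ e, quasiDeriv A e (fun x => phase (-edgeA A e) x * F e x) (p e) Real.pi
        = phase (-edgeA A e) Real.pi * P e Real.pi := fun e => by
      rw [← hpπ e]
      simp [quasiDeriv, edgeField_eq]
    have a1 : -edgeA A (j - 1, true) = -A (j - 1) := rfl
    have a2 : -edgeA A (j - 1, false) = A (j - 1) := neg_neg _
    rw [q0, q0, qπ, qπ, a1, a2, hJ, hv0]
  · rw [edgeField_eq]
    exact (hg e).eq

lemma sq_sum_three_le (a b c : ℝ) : (a + b + c) ^ 2 ≤ 3 * (a ^ 2 + b ^ 2 + c ^ 2) := by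
  nlinarith [sq_nonneg (a - b), sq_nonneg (a - c), sq_nonneg (b - c)]

set_option maxHeartbeats 1000000 in
/-- From the vertices to the graph of the Hamiltonian. -/
theorem exists_inGraph_of_vertex {E : ℝ} (hS : sinPi E ≠ 0) : ∃ K, 0 ≤ K ∧
    ∀ (α A : ℤ → ℝ) (U : ℤ → ℂ), Summable (fun j => ‖U j‖ ^ 2) →
      Summable (fun j => ‖defect α A E U j‖ ^ 2) →
      ∃ u v : GraphL2, InGraph α A u v ∧
        (∀ e, ‖u e‖ ≤ K * (‖U e.1‖ + ‖U (e.1 + 1)‖ + ‖defect α A E U e.1‖)) ∧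
        (∀ e, ‖v e - (E : ℂ) • u e‖ ≤ K * ‖defect α A E U e.1‖) ∧
        (∀ j, ‖U j‖ ≤ K * (‖u (j, true)‖ + ‖v (j, true) - (E : ℂ) • u (j, true)‖)) := by
  obtain ⟨K₁, hK₁, h₁⟩ := exists_norm_trace_le E
  have hpic : Continuous fun t : ℝ => Real.pi - t := by fun_prop
  have hsl : Continuous hermSlope :=
    continuous_iff_continuousAt.2 fun x => (hasDerivAt_hermSlope x).continuousAt
  have c3 := continuous_hermSlope''
  obtain ⟨M₁, hM₁, hb₁⟩ := exists_bound_Icc (continuous_sinE E)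
  obtain ⟨M₂, hM₂, hb₂⟩ := exists_bound_Icc ((continuous_sinE E).comp hpic)
  obtain ⟨M₃, hM₃, hb₃⟩ := exists_bound_Icc hsl
  obtain ⟨M₄, hM₄, hb₄⟩ := exists_bound_Icc c3
  simp only [norm_mul, norm_phase, one_mul, Complex.norm_real, forall_const] at hb₁ hb₂ hb₃ hb₄
  set S := |sinPi E| with hSdef
  have hSpos : 0 < S := abs_pos.2 hS
  have hSC : (sinPi E : ℂ) ≠ 0 := by exact_mod_cast hS
  set L := (1 + |E|) * (M₁ + M₂ + 2 * (M₃ + M₄)) / S with hL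
  have hL0 : 0 ≤ L := by positivity
  refine ⟨√Real.pi * L + K₁, by positivity, fun α A U hU hd => ?_⟩
  -- The interpolation of `U` by solutions of the edge equation violates the jump condition at `j`
  -- by `2 / sinPi E` times the defect. A multiple of `hermSlope` on the upper semicircle alone
  -- repairs this: it changes the slope at the left end and neither the vertex values nor the slope
  -- at the right end.
  set d : ℤ → ℂ := fun j => -(2 / (sinPi E : ℂ)) * defect α A E U j with hddef
  have hdn : ∀ j, ‖d j‖ = 2 / S * ‖defect α A E U j‖ := fun j => by
    simp only [hddef, norm_mul, norm_neg, norm_div, Complex.norm_real, Real.norm_eq_abs,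
      Complex.norm_ofNat]
    rfl
  set δ : Edge → ℂ := fun e => if e.2 then d e.1 else 0 with hδ
  have hδn : ∀ e, ‖δ e‖ ≤ 2 / S * ‖defect α A E U e.1‖ := fun e => by
    simp only [hδ]
    split_ifs
    · exact (hdn _).le
    · rw [norm_zero]; positivity
  set y : Edge → ℂ := fun e => phase (edgeA A e) Real.pi * U (e.1 + 1) with hy
  set F : Edge → ℝ → ℂ := fun e x => (U e.1 * (sinE E (Real.pi - x) : ℝ) + y e * (sinE E x : ℝ))
    / sinPi E + δ e * (hermSlope x : ℝ) with hF
  set P : Edge → ℝ → ℂ := fun e x => (U e.1 * (-cosE E (Real.pi - x) : ℝ) + y e * (cosE E x : ℝ))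
    / sinPi E + δ e * (hermSlope' x : ℝ) with hP
  set Q : Edge → ℝ → ℂ := fun e x => (U e.1 * (-E * sinE E (Real.pi - x) : ℝ)
    + y e * (-E * sinE E x : ℝ)) / sinPi E + δ e * (hermSlope'' x : ℝ) with hQ
  have hFd : ∀ e x, HasDerivAt (F e) (P e x) x := fun e x =>
    (((((hasDerivAt_comp_pi_sub (hasDerivAt_sinE E (Real.pi - x))).ofReal_comp).const_mul
      (U e.1)).add ((hasDerivAt_sinE E x).ofReal_comp.const_mul (y e))).div_const _).add
      ((hasDerivAt_hermSlope x).ofReal_comp.const_mul (δ e))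
  have hPd : ∀ e x, HasDerivAt (P e) (Q e x) x := fun e x => by
    have := (hasDerivAt_comp_pi_sub (hasDerivAt_cosE E (Real.pi - x))).neg
    rw [neg_neg] at this
    exact ((((this.ofReal_comp).const_mul
      (U e.1)).add ((hasDerivAt_cosE E x).ofReal_comp.const_mul (y e))).div_const _).add
      ((hasDerivAt_hermSlope' x).ofReal_comp.const_mul (δ e))
  have cS := continuous_sinE E
  have hQc : ∀ e, Continuous (Q e) := fun e => by fun_prop
  set w : Edge → ℝ := fun e => L * (‖U e.1‖ + ‖U (e.1 + 1)‖ + ‖defect α A E U e.1‖) with hw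
  have hyn : ∀ e, ‖y e‖ = ‖U (e.1 + 1)‖ := fun e => by
    simp only [hy]; rw [norm_mul, norm_phase, one_mul]
  have hLge : ∀ m : ℝ, 0 ≤ m → m ≤ M₁ + M₂ + 2 * (M₃ + M₄) → m / S ≤ L ∧ |E| * m / S ≤ L :=
    fun m hm0 hm => by
      have hE := abs_nonneg E
      constructor <;> · rw [hL]; gcongr; nlinarith
  -- a bound for all the functions that occur
  have hgen : ∀ e, ∀ a b c : ℝ, |a| / S ≤ L → |b| / S ≤ L → 2 * |c| / S ≤ L →
      ‖(U e.1 * (a : ℂ) + y e * (b : ℂ)) / sinPi E + δ e * (c : ℂ)‖ ≤ w e := by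
    intro e a b c ha hb hc
    refine (norm_add_le _ _).trans ?_
    rw [norm_div, norm_mul, Complex.norm_real, Complex.norm_real, Real.norm_eq_abs, ← hSdef]
    have n1 : ‖U e.1 * (a : ℂ) + y e * (b : ℂ)‖ ≤ ‖U e.1‖ * |a| + ‖U (e.1 + 1)‖ * |b| := by
      refine (norm_add_le _ _).trans ?_
      rw [norm_mul, norm_mul, hyn]
      simp
    have n2 := mul_le_mul_of_nonneg_right (hδn e) (norm_nonneg c)
    calc ‖U e.1 * (a : ℂ) + y e * (b : ℂ)‖ / S + ‖δ e‖ * ‖c‖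
        ≤ (‖U e.1‖ * |a| + ‖U (e.1 + 1)‖ * |b|) / S
          + 2 / S * ‖defect α A E U e.1‖ * ‖c‖ := by gcongr
      _ = ‖U e.1‖ * (|a| / S) + ‖U (e.1 + 1)‖ * (|b| / S)
          + ‖defect α A E U e.1‖ * (2 * |c| / S) := by rw [Real.norm_eq_abs]; ring
      _ ≤ ‖U e.1‖ * L + ‖U (e.1 + 1)‖ * L + ‖defect α A E U e.1‖ * L := by gcongr
      _ = w e := by simp only [hw]; ring
  have hFw : ∀ e, ∀ x ∈ Icc (0 : ℝ) Real.pi, ‖F e x‖ ≤ w e := fun e x hx => by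
    refine hgen e _ _ _ ?_ ?_ ?_
    · exact (hLge _ (abs_nonneg _) ((hb₂ x hx).trans (by linarith))).1
    · exact (hLge _ (abs_nonneg _) ((hb₁ x hx).trans (by linarith))).1
    · have := hb₃ x hx
      rw [Real.norm_eq_abs] at this
      exact (hLge _ (by positivity) (by linarith)).1
  have hQw : ∀ e, ∀ x ∈ Icc (0 : ℝ) Real.pi, ‖Q e x‖ ≤ w e := fun e x hx => by
    refine hgen e _ _ _ ?_ ?_ ?_
    · rw [abs_mul, abs_neg]
      exact (hLge _ (abs_nonneg _) ((hb₂ x hx).trans (by linarith))).2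
    · rw [abs_mul, abs_neg]
      exact (hLge _ (abs_nonneg _) ((hb₁ x hx).trans (by linarith))).2
    · have := hb₄ x hx
      rw [Real.norm_eq_abs] at this
      exact (hLge _ (by positivity) (by linarith)).1
  have hws : Summable fun e => w e ^ 2 := by
    have hU1 : Summable fun j : ℤ => ‖U (j + 1)‖ ^ 2 :=
      (Equiv.addRight (1 : ℤ)).summable_iff.2 hU
    have hs := ((hU.add hU1).add hd).mul_left (3 * L ^ 2)
    refine Summable.of_nonneg_of_le (fun e => sq_nonneg _) (fun e => ?_)
      (summable_edge (fun j => by positivity) hs)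
    have := sq_sum_three_le ‖U e.1‖ ‖U (e.1 + 1)‖ ‖defect α A E U e.1‖
    simp only [hw]
    rw [mul_pow]
    nlinarith [sq_nonneg L, mul_le_mul_of_nonneg_left this (sq_nonneg L)]
  have hS1 : sinE E Real.pi = sinPi E := rfl
  have hC1 : cosE E Real.pi = cosPi E := rfl
  obtain ⟨u, v, huv, hu, hv, hg⟩ := exists_inGraph (α := α) (A := A) (U := U) hFd hPd hQc hws hFw hQw
    (fun e => by
      simp only [hF, sub_zero, sinE_zero_right, hermSlope_zero, Complex.ofReal_zero, mul_zero,
        add_zero, hS1]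
      rw [mul_div_assoc, div_self hSC, mul_one])
    (fun e => by
      simp only [hF, sub_self, sinE_zero_right, hermSlope_pi, Complex.ofReal_zero, mul_zero,
        add_zero, zero_add, hS1]
      rw [mul_div_assoc, div_self hSC, mul_one])
    (fun j => by
      have a1 : edgeA A (j - 1, true) = A (j - 1) := rfl
      have a2 : edgeA A (j - 1, false) = -A (j - 1) := rfl
      have p1 := phase_edgeA_add A j
      have p2 := phase_edgeA_add A (j - 1)
      have e1 := phase_neg_mul (A (j - 1)) Real.pi
      rw [a1, a2] at p2
      simp only [hP, hδ, hy, sub_zero, sub_self, cosE_zero_right, hermSlope'_zero, hermSlope'_pi,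
        Complex.ofReal_zero, Complex.ofReal_one, mul_zero, mul_one, add_zero, if_true,
        Bool.false_eq_true, if_false, sub_add_cancel, hC1, hddef, defect, eta, a1, a2]
      field_simp
      push_cast
      linear_combination U (j + 1) * p1 + U (j - 1) * p2 - (2 * cosPi E * U j) * e1)
  refine ⟨u, v, huv, fun e => ?_, fun e => ?_, fun j => ?_⟩
  · have h1 : ‖u e‖ ≤ √Real.pi * w e := by
      refine edge_norm_le ((norm_nonneg _).trans (hFw e 0 ⟨le_rfl, Real.pi_pos.le⟩)) ?_
      filter_upwards [hu e, ae_restrict_mem measurableSet_Ioc] with x hx1 hx2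
      rw [hx1, norm_mul, norm_phase, one_mul]
      exact hFw e x (Ioc_subset_Icc_self hx2)
    refine h1.trans ?_
    simp only [hw]
    rw [← mul_assoc]
    gcongr
    linarith
  · have h1 : ‖v e - (E : ℂ) • u e‖ ≤ √Real.pi * (L * ‖defect α A E U e.1‖) := by
      refine edge_norm_le (by positivity) ?_
      filter_upwards [hu e, hv e, ae_restrict_mem measurableSet_Ioc,
        Lp.coeFn_sub (v e) ((E : ℂ) • u e), Lp.coeFn_smul (E : ℂ) (u e)] with x hx1 hx2 hx3 hx4 hx5
      have hx := Ioc_subset_Icc_self hx3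
      -- The remaining part of `F` solves `-F'' = E F`, so only the cubic correction, which is
      -- proportional to the defect, contributes.
      have e1 : (v e - (E : ℂ) • u e : EdgeL2) x = -(phase (-edgeA A e) x
          * (δ e * ((hermSlope'' x + E * hermSlope x : ℝ) : ℂ))) := by
        rw [hx4, Pi.sub_apply, hx5, Pi.smul_apply, hx1, hx2, smul_eq_mul]
        simp only [hF, hQ]
        push_cast
        ring
      rw [e1, norm_neg, norm_mul, norm_phase, one_mul, norm_mul, Complex.norm_real,
        Real.norm_eq_abs]
      have b3 := hb₃ x hx
      have b4 := hb₄ x hx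
      rw [Real.norm_eq_abs] at b3 b4
      have b5 : |hermSlope'' x + E * hermSlope x| ≤ (1 + |E|) * (M₃ + M₄) := by
        refine (abs_add_le _ _).trans ?_
        rw [abs_mul]
        have hE := abs_nonneg E
        nlinarith [mul_le_mul_of_nonneg_left b3 hE]
      calc ‖δ e‖ * |hermSlope'' x + E * hermSlope x|
          ≤ (2 / S * ‖defect α A E U e.1‖) * ((1 + |E|) * (M₃ + M₄)) := by
            gcongr; exact hδn e
        _ = ((1 + |E|) * (2 * (M₃ + M₄)) / S) * ‖defect α A E U e.1‖ := by ring
        _ ≤ L * ‖defect α A E U e.1‖ := by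
            rw [hL]; gcongr; linarith
    refine h1.trans ?_
    rw [← mul_assoc]
    gcongr
    linarith
  · obtain ⟨f, p, q, hg1, hf, -⟩ := hg (j, true)
    have h2 := h₁ _ _ _ _ _ _ hg1 0
    have h3 : trace (edgeA A (j, true)) f p 0 = U j := hf
    rw [h3] at h2
    refine h2.trans ?_
    gcongr
    have : 0 ≤ √Real.pi * L := by positivity
    linarith

/-! ### Weyl sequences -/

lemma mem_essSpectrum_iff {α A : ℤ → ℝ} {E : ℝ} :
    E ∈ essSpectrum (hamiltonian α A) ↔ ∃ u v : ℕ → GraphL2, (∀ n, InGraph α A (u n) (v n)) ∧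
      (∀ n, ‖u n‖ = 1) ∧ (∀ y : GraphL2, Tendsto (fun n => inner ℂ y (u n)) atTop (𝓝 0)) ∧
      Tendsto (fun n => ‖v n - (E : ℂ) • u n‖) atTop (𝓝 0) := by
  constructor
  · rintro ⟨x, h1, h2, h3⟩
    refine ⟨fun n => x n, fun n => hamiltonian α A (x n), fun n => ?_, h1, h2, h3⟩
    rw [← mem_graph_hamiltonian]
    exact LinearPMap.mem_graph _ _
  · rintro ⟨u, v, hg, h1, h2, h3⟩
    have hx : ∀ n, ∃ x : (hamiltonian α A).domain, (x : GraphL2) = u n ∧ hamiltonian α A x = v n :=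
      fun n => (LinearPMap.mem_graph_iff _).1 ((mem_graph_hamiltonian α A _ _).2 (hg n))
    choose x hxu hxv using hx
    refine ⟨x, fun n => by rw [hxu, h1], fun y => ?_, ?_⟩
    · simp only [hxu]; exact h2 y
    · simp only [hxu, hxv]; exact h3

/-- The test vector `y` is replaced by a finitely supported one: the error is controlled by the
uniform bound, and the finite sum by coordinatewise convergence. -/
lemma tendsto_inner_of_coord {x : ℕ → GraphL2} (hx : ∀ n, ‖x n‖ ≤ 1)
    (h : ∀ e, Tendsto (fun n => ‖x n e‖) atTop (𝓝 0)) (y : GraphL2) :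
    Tendsto (fun n => inner ℂ y (x n)) atTop (𝓝 0) := by
  classical
  rw [Metric.tendsto_nhds]
  intro ε hε
  have hs := lp.hasSum_single (p := 2) (by norm_num) y
  obtain ⟨s, hs⟩ := (hs.eventually (Metric.ball_mem_nhds y (half_pos hε))).exists
  have hs' : ‖y - ∑ e ∈ s, lp.single 2 e (y e)‖ < ε / 2 := by
    rw [← dist_eq_norm, dist_comm]; exact hs
  have hfin : Tendsto (fun n => ∑ e ∈ s, ‖y e‖ * ‖x n e‖) atTop (𝓝 0) := by
    have := tendsto_finsetSum s fun e _ => (h e).const_mul ‖y e‖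
    simpa using this
  filter_upwards [hfin.eventually (gt_mem_nhds (half_pos hε))] with n hn
  rw [dist_zero_right]
  have e1 : inner ℂ y (x n) = inner ℂ (y - ∑ e ∈ s, lp.single 2 e (y e)) (x n)
      + ∑ e ∈ s, inner ℂ (y e) (x n e) := by
    rw [inner_sub_left, sum_inner]
    simp only [lp.inner_single_left, sub_add_cancel]
  rw [e1]
  have b1 := norm_inner_le_norm (𝕜 := ℂ) (y - ∑ e ∈ s, lp.single 2 e (y e)) (x n)
  have b2 : ‖∑ e ∈ s, inner ℂ (y e) (x n e)‖ ≤ ∑ e ∈ s, ‖y e‖ * ‖x n e‖ :=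
    (norm_sum_le _ _).trans (Finset.sum_le_sum fun e _ => norm_inner_le_norm _ _)
  have b3 := mul_le_mul_of_nonneg_left (hx n)
    (norm_nonneg (y - ∑ e ∈ s, lp.single 2 e (y e)))
  refine (norm_add_le _ _).trans_lt ?_
  linarith

lemma InGraph.smul {α A : ℤ → ℝ} {u v : GraphL2} (h : InGraph α A u v) (c : ℂ) :
    InGraph α A (c • u) (c • v) :=
  (graphSubmodule α A).smul_mem c (x := (u, v)) h

/-- A singular sequence, not normalized, with coordinates tending to zero. -/
lemma mem_essSpectrum_of_seq {α A : ℤ → ℝ} {E : ℝ} {u v : ℕ → GraphL2}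
    (hg : ∀ n, InGraph α A (u n) (v n)) (h0 : ∀ n, u n ≠ 0)
    (h1 : Tendsto (fun n => ‖v n - (E : ℂ) • u n‖ / ‖u n‖) atTop (𝓝 0))
    (h2 : ∀ e, Tendsto (fun n => ‖u n e‖ / ‖u n‖) atTop (𝓝 0)) :
    E ∈ essSpectrum (hamiltonian α A) := by
  rw [mem_essSpectrum_iff]
  have hn : ∀ n, ‖((‖u n‖⁻¹ : ℝ) : ℂ)‖ = ‖u n‖⁻¹ := fun n => by simp
  have hnorm : ∀ n, ‖((‖u n‖⁻¹ : ℝ) : ℂ) • u n‖ = 1 := fun n => by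
    rw [norm_smul, hn, inv_mul_cancel₀ (norm_ne_zero_iff.2 (h0 n))]
  refine ⟨fun n => ((‖u n‖⁻¹ : ℝ) : ℂ) • u n, fun n => ((‖u n‖⁻¹ : ℝ) : ℂ) • v n,
    fun n => (hg n).smul _, hnorm, tendsto_inner_of_coord (fun n => (hnorm n).le) fun e => ?_, ?_⟩
  · refine (h2 e).congr fun n => ?_
    change _ = ‖((‖u n‖⁻¹ : ℝ) : ℂ) • (u n e)‖
    rw [norm_smul, hn, div_eq_inv_mul]
  · refine h1.congr fun n => ?_
    rw [smul_comm, ← smul_sub, norm_smul, hn, div_eq_inv_mul]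

/-! ### The essential spectrum of the periodic chain -/

/-- The coefficients of the eigenfunctions supported by two neighbouring rings. -/
def flatCoeff (A C : ℝ) (k : ℤ) (e : Edge) : ℂ :=
  if e.1 = k then (if e.2 then 1 else -1)
  else if e.1 = k + 1 then (if e.2 then -(C * phase A Real.pi) else C * phase (-A) Real.pi)
  else 0

/-- When `sinPi E = 0`, the function `sinE E` vanishes at both ends of each edge, so only the sums
of slopes at the vertices matter. The coefficients in `flatCoeff` make them cancel at the three
vertices of two neighbouring rings. Translating the resulting eigenfunction along the chain gives a
singular sequence. -/
lemma flat_mem_essSpectrum (α A : ℝ) {E : ℝ} (hS : sinPi E = 0) :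
    E ∈ essSpectrum (periodicHamiltonian α A) := by
  have hC : cosPi E ^ 2 = 1 := by
    have h : cosPi E ^ 2 + E * sinPi E ^ 2 = 1 := cosE_sq_add E Real.pi
    rw [hS] at h
    simpa using h
  have hC' : (cosPi E : ℂ) ^ 2 = 1 := by exact_mod_cast hC
  obtain ⟨M, hM, hb⟩ := exists_bound_Icc (continuous_sinE E)
  simp only [norm_mul, norm_phase, one_mul, Complex.norm_real, forall_const] at hb
  have hS1 : sinE E Real.pi = 0 := hS
  have hC1 : cosE E Real.pi = cosPi E := rfl
  have cS := continuous_sinE E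
  have key : ∀ k : ℤ, ∃ u v : GraphL2, InGraph (fun _ => α) (fun _ => A) u v ∧
      (∀ e, u e =ᵐ[edgeMeasure] fun x => phase (-edgeA (fun _ => A) e) x *
        (flatCoeff A (cosPi E) k e * sinE E x)) ∧
      (∀ e, v e =ᵐ[edgeMeasure] fun x => -(phase (-edgeA (fun _ => A) e) x *
        (flatCoeff A (cosPi E) k e * (-E * sinE E x : ℝ)))) ∧
      (∀ e, ∃ f p q, EdgeGraph (edgeA (fun _ => A) e) (u e) (v e) f p q ∧ f 0 = 0 ∧
        trace (edgeA (fun _ => A) e) f p 1 = flatCoeff A (cosPi E) k e * (cosE E 0 : ℝ)) := by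
    intro k
    set b := flatCoeff A (cosPi E) k with hb'
    have hsupp : ∀ e : Edge, e ∉ (({k, k + 1} : Finset ℤ) ×ˢ Finset.univ) → b e = 0 := by
      rintro ⟨j, i⟩ he
      simp only [Finset.mem_product, Finset.mem_insert, Finset.mem_singleton, Finset.mem_univ,
        and_true, not_or] at he
      simp [hb', flatCoeff, he.1, he.2]
    refine exists_inGraph (U := fun _ => 0) (F := fun e x => b e * (sinE E x : ℝ))
      (P := fun e x => b e * (cosE E x : ℝ)) (Q := fun e x => b e * (-E * sinE E x : ℝ))
      (w := fun e => (1 + |E|) * M * ‖b e‖)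
      (fun e x => (hasDerivAt_sinE E x).ofReal_comp.const_mul _)
      (fun e x => (hasDerivAt_cosE E x).ofReal_comp.const_mul _) (fun e => by fun_prop)
      (summable_of_ne_finset_zero (s := ({k, k + 1} : Finset ℤ) ×ˢ Finset.univ) fun e he => by
        simp [hsupp e he]) (fun e x hx => ?_) (fun e x hx => ?_) (fun e => by simp)
      (fun e => by simp [hS1]) (fun j => ?_)
    · rw [norm_mul, Complex.norm_real, mul_comm]
      have := hb x hx
      have h2 : M ≤ (1 + |E|) * M := by nlinarith [abs_nonneg E]
      gcongr
      exact this.trans h2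
    · rw [norm_mul, Complex.norm_real, mul_comm, norm_mul, norm_neg, Real.norm_eq_abs E]
      have := hb x hx
      gcongr
      linarith
    · have e1 := phase_neg_mul A Real.pi
      have hk1 : k + 1 ≠ k := by omega
      have hk2 : k + 1 + 1 ≠ k := by omega
      have hk3 : k - 1 ≠ k := by omega
      have hk4 : k - 1 ≠ k + 1 := by omega
      simp only [hb', cosE_zero_right, hC1, Complex.ofReal_one, mul_one, mul_zero]
      by_cases h1 : j = k
      · subst h1
        simp [flatCoeff]
        rw [if_neg hk4, if_neg hk4]
        simp
      by_cases h2 : j = k + 1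
      · subst h2
        simp [flatCoeff]
        ring
      by_cases h3 : j = k + 1 + 1
      · subst h3
        simp [flatCoeff, hk2]
        ring
      · have h4 : j - 1 ≠ k := by omega
        have h5 : j - 1 ≠ k + 1 := by omega
        simp [flatCoeff, h1, h2, h4, h5]
  choose u v hg hu hv ht using fun n : ℕ => key n
  have hvE : ∀ n, v n = (E : ℂ) • u n := fun n => by
    apply lp.ext
    funext e
    apply Lp.ext
    change v n e =ᵐ[_] ((E : ℂ) • u n e : EdgeL2)
    filter_upwards [hu n e, hv n e, Lp.coeFn_smul (E : ℂ) (u n e)] with x h1 h2 h3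
    rw [h2, h3, Pi.smul_apply, h1, smul_eq_mul]
    push_cast
    ring
  obtain ⟨K, hK, hKb⟩ := exists_norm_trace_le E
  -- The slope at the left end of the edge `(n, true)` has modulus one, and boundary data are
  -- bounded by the norm: the norms stay away from zero uniformly in `n`.
  have hlow : ∀ n, 1 ≤ K * ‖u n‖ := fun n => by
    obtain ⟨f, p, q, h1, -, h3⟩ := ht n ((n : ℤ), true)
    have h4 := hKb _ _ _ _ _ _ h1 1
    rw [h3] at h4
    have h5 : v n ((n : ℤ), true) - (E : ℂ) • u n ((n : ℤ), true) = 0 := by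
      rw [hvE n]; exact sub_self _
    rw [h5, norm_zero, add_zero] at h4
    have h6 : ‖flatCoeff A (cosPi E) (n : ℤ) ((n : ℤ), true) * ((cosE E 0 : ℝ) : ℂ)‖ = 1 := by
      simp [flatCoeff]
    rw [h6] at h4
    exact h4.trans (mul_le_mul_of_nonneg_left (lp.norm_apply_le_norm (by norm_num) _ _) hK)
  refine mem_essSpectrum_of_seq hg (fun n h0 => ?_) ?_ (fun e => ?_)
  · have := hlow n
    rw [h0, norm_zero, mul_zero] at this
    linarith
  · simp [hvE]
  · refine tendsto_const_nhds.congr' ?_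
    filter_upwards [eventually_gt_atTop e.1.toNat] with n hn
    have h1 : e.1 ≠ (n : ℤ) := by omega
    have h2 : e.1 ≠ (n : ℤ) + 1 := by omega
    have h3 : u n e = 0 := by
      apply Lp.ext
      filter_upwards [hu n e, Lp.coeFn_zero ℂ 2 edgeMeasure] with x hx1 hx2
      rw [hx1]
      have : (0 : EdgeL2) x = 0 := hx2
      rw [this]
      simp [flatCoeff, h1, h2]
    rw [h3]
    simp

/-! ### Estimates between the chain and its vertices -/

lemma sq_add_le_two (a b : ℝ) : (a + b) ^ 2 ≤ 2 * (a ^ 2 + b ^ 2) := by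
  nlinarith [sq_nonneg (a - b)]

lemma tsum_vertex_sq_le {K : ℝ} {U : ℤ → ℂ} {u g : GraphL2}
    (h : ∀ j, ‖U j‖ ≤ K * (‖u (j, true)‖ + ‖g (j, true)‖)) :
    Summable (fun j => ‖U j‖ ^ 2) ∧
      ∑' j, ‖U j‖ ^ 2 ≤ 2 * K ^ 2 * (‖u‖ ^ 2 + ‖g‖ ^ 2) := by
  have hu := hasSum_norm_sq u
  have hg := hasSum_norm_sq g
  have hinj : Function.Injective fun j : ℤ => ((j, true) : Edge) := fun a b h => by
    simpa using h
  have hu1 : Summable fun j : ℤ => ‖u (j, true)‖ ^ 2 := hu.summable.comp_injective hinj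
  have hg1 : Summable fun j : ℤ => ‖g (j, true)‖ ^ 2 := hg.summable.comp_injective hinj
  have hb := (hu1.add hg1).mul_left (2 * K ^ 2)
  have hle : ∀ j, ‖U j‖ ^ 2 ≤ 2 * K ^ 2 * (‖u (j, true)‖ ^ 2 + ‖g (j, true)‖ ^ 2) := fun j => by
    have h1 := pow_le_pow_left₀ (norm_nonneg _) (h j) 2
    have h2 := sq_add_le_two ‖u (j, true)‖ ‖g (j, true)‖
    rw [mul_pow] at h1
    nlinarith [mul_le_mul_of_nonneg_left h2 (sq_nonneg K)]
  have hs : Summable (fun j => ‖U j‖ ^ 2) :=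
    Summable.of_nonneg_of_le (fun j => sq_nonneg _) hle hb
  refine ⟨hs, (hs.tsum_le_tsum hle hb).trans ?_⟩
  have t1 : ∑' j : ℤ, ‖u (j, true)‖ ^ 2 ≤ ‖u‖ ^ 2 := by
    rw [← hu.tsum_eq]
    exact hu1.tsum_le_tsum_of_inj _ hinj (fun _ _ => sq_nonneg _) (fun _ => le_rfl) hu.summable
  have t2 : ∑' j : ℤ, ‖g (j, true)‖ ^ 2 ≤ ‖g‖ ^ 2 := by
    rw [← hg.tsum_eq]
    exact hg1.tsum_le_tsum_of_inj _ hinj (fun _ _ => sq_nonneg _) (fun _ => le_rfl) hg.summable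
  have e1 : ∑' j : ℤ, 2 * K ^ 2 * (‖u (j, true)‖ ^ 2 + ‖g (j, true)‖ ^ 2)
      = 2 * K ^ 2 * (∑' j : ℤ, ‖u (j, true)‖ ^ 2 + ∑' j : ℤ, ‖g (j, true)‖ ^ 2) := by
    rw [tsum_mul_left, hu1.tsum_add hg1]
  refine e1.le.trans ?_
  gcongr

lemma tsum_shift_sub (w : ℤ → ℝ) (a : ℤ) : ∑' j, w (j + a) = ∑' j, w j :=
  (Equiv.addRight a).tsum_eq w

lemma summable_shift {w : ℤ → ℝ} (hw : Summable w) (a : ℤ) : Summable fun j => w (j + a) :=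
  (Equiv.addRight a).summable_iff.2 hw

/-- Outside the bands the vertex equation is boundedly invertible. -/
lemma tsum_sq_le_of_defect {c η : ℝ} (h : 2 * |c| < |η|) {U r : ℤ → ℂ}
    (hU : Summable fun j => ‖U j‖ ^ 2) (hr : Summable fun j => ‖r j‖ ^ 2)
    (heq : ∀ j, r j = c * U (j + 1) + c * U (j - 1) - η * U j) :
    (|η| - 2 * |c|) ^ 2 * ∑' j, ‖U j‖ ^ 2 ≤ ∑' j, ‖r j‖ ^ 2 := by
  set δ := |η| - 2 * |c| with hδ
  have hδ0 : 0 < δ := by linarith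
  set w : ℤ → ℝ := fun j => ‖U j‖ ^ 2 with hw
  have hp := summable_shift hU 1
  have hm := summable_shift hU (-1)
  -- The triangle inequality for `|η| ‖U j‖` is multiplied by `δ ‖U j‖`, and the products are split
  -- by `2 x y ≤ x² + y²`. After summation over `j` the shifted terms on the right cancel the term
  -- `δ |c| (2 w j)` on the left.
  have hle : ∀ j, δ ^ 2 * w j + δ * |c| * (2 * w j)
      ≤ ‖r j‖ ^ 2 + δ * |c| * (w (j + 1) + w (j + -1)) := fun j => by
    have h1 : |η| * ‖U j‖ ≤ |c| * ‖U (j + 1)‖ + |c| * ‖U (j - 1)‖ + ‖r j‖ := by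
      have e1 : (η : ℂ) * U j = c * U (j + 1) + c * U (j - 1) - r j := by rw [heq]; ring
      have e2 : |η| * ‖U j‖ = ‖(η : ℂ) * U j‖ := by
        rw [norm_mul, Complex.norm_real, Real.norm_eq_abs]
      rw [e2, e1]
      refine (norm_sub_le _ _).trans (add_le_add ((norm_add_le _ _).trans ?_) le_rfl)
      rw [norm_mul, norm_mul, Complex.norm_real, Real.norm_eq_abs]
    have h2 : |η| = δ + 2 * |c| := by rw [hδ]; ring
    rw [h2] at h1
    simp only [hw]
    rw [← sub_eq_add_neg]
    set x := ‖U j‖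
    set y := ‖U (j + 1)‖
    set z := ‖U (j - 1)‖
    have hx : 0 ≤ x := norm_nonneg _
    have hc : 0 ≤ |c| := abs_nonneg c
    have h3 := mul_le_mul_of_nonneg_left h1 (mul_nonneg hδ0.le hx)
    nlinarith [sq_nonneg (δ * x - ‖r j‖), mul_nonneg (mul_nonneg hδ0.le hc) (sq_nonneg (x - y)),
      mul_nonneg (mul_nonneg hδ0.le hc) (sq_nonneg (x - z))]
  have hs := Summable.tsum_le_tsum hle
    ((hU.mul_left (δ ^ 2)).add ((hU.mul_left 2).mul_left (δ * |c|)))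
    (hr.add ((hp.add hm).mul_left (δ * |c|)))
  rw [(hU.mul_left (δ ^ 2)).tsum_add ((hU.mul_left 2).mul_left (δ * |c|)),
    hr.tsum_add ((hp.add hm).mul_left (δ * |c|)), tsum_mul_left, tsum_mul_left, tsum_mul_left,
    tsum_mul_left, hp.tsum_add hm, tsum_shift_sub w 1, tsum_shift_sub w (-1)] at hs
  linarith

lemma tsum_edge {w : ℤ → ℝ} (hw0 : ∀ j, 0 ≤ w j) (hw : Summable w) :
    ∑' e : Edge, w e.1 = 2 * ∑' j, w j := by
  rw [(summable_edge hw0 hw).tsum_prod]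
  simp [← two_mul, tsum_mul_left]

lemma sq_sum_four_le (a b c d : ℝ) :
    (a + b + c + d) ^ 2 ≤ 4 * (a ^ 2 + b ^ 2 + c ^ 2 + d ^ 2) := by
  nlinarith [sq_nonneg (a - b), sq_nonneg (a - c), sq_nonneg (a - d), sq_nonneg (b - c),
    sq_nonneg (b - d), sq_nonneg (c - d)]

/-- Off the bands the residual controls everything: it bounds the defect, the defect bounds the
vertex values by `tsum_sq_le_of_defect`, and vertex values and residual bound `u`. Unit vectors with
residual tending to zero are then impossible. -/
theorem abs_eta_le_of_mem_essSpectrum {α A E : ℝ} (hS : sinPi E ≠ 0)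
    (hE : E ∈ essSpectrum (periodicHamiltonian α A)) :
    |eta α E| ≤ 2 * |Real.cos (A * Real.pi)| := by
  by_contra! hlt
  obtain ⟨u, v, hg, h1, -, h3⟩ := mem_essSpectrum_iff.1 hE
  obtain ⟨K, hK, hKA⟩ := exists_vertex_bounds E
  obtain ⟨y, z, hyz⟩ := hKA (fun _ => A)
  set δ := |eta α E| - 2 * |Real.cos (A * Real.pi)| with hδ
  have hδ0 : 0 < δ := by linarith
  -- a priori estimate
  have main : ∀ n, 1 ≤ (48 * K ^ 4 / δ ^ 2 * 2 + 3 * K ^ 2) * ‖v n - (E : ℂ) • u n‖ ^ 2 := by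
    intro n
    set g : GraphL2 := v n - (E : ℂ) • u n with hgdef
    have hge : ∀ e, g e = v n e - (E : ℂ) • u n e := fun e => rfl
    obtain ⟨U, -, hU, hr, hue⟩ := hyz _ _ _ (hg n)
    simp only [← hge] at hU hr hue
    obtain ⟨hUs, -⟩ := tsum_vertex_sq_le hU
    set G : ℤ → ℝ := fun j => ‖g (j, true)‖ ^ 2 + ‖g (j, false)‖ ^ 2 with hG
    have hgs := hasSum_norm_sq g
    have i1 : Function.Injective fun j : ℤ => ((j, true) : Edge) := fun a b h => by simpa using h
    have i2 : Function.Injective fun j : ℤ => ((j, false) : Edge) := fun a b h => by simpa using h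
    have hGs : Summable G := (hgs.summable.comp_injective i1).add (hgs.summable.comp_injective i2)
    have hGt : ∑' j, G j = ‖g‖ ^ 2 := by
      rw [← hgs.tsum_eq, hgs.summable.tsum_prod]
      refine tsum_congr fun j => ?_
      rw [tsum_bool, add_comm]
    have hGm := summable_shift hGs (-1)
    have hrG : ∀ j, ‖defect (fun _ => α) (fun _ => A) E U j‖ ^ 2
        ≤ 4 * K ^ 2 * (G j + G (j + -1)) := fun j => by
      have a1 := pow_le_pow_left₀ (norm_nonneg _) (hr j) 2
      have a2 := sq_sum_four_le ‖g (j, true)‖ ‖g (j, false)‖ ‖g (j - 1, true)‖ ‖g (j - 1, false)‖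
      rw [mul_pow] at a1
      simp only [hG]
      rw [← sub_eq_add_neg]
      nlinarith [mul_le_mul_of_nonneg_left a2 (sq_nonneg K)]
    have hrs : Summable fun j => ‖defect (fun _ => α) (fun _ => A) E U j‖ ^ 2 :=
      Summable.of_nonneg_of_le (fun _ => sq_nonneg _) hrG ((hGs.add hGm).mul_left _)
    have hrt : ∑' j, ‖defect (fun _ => α) (fun _ => A) E U j‖ ^ 2 ≤ 8 * K ^ 2 * ‖g‖ ^ 2 := by
      refine (hrs.tsum_le_tsum hrG ((hGs.add hGm).mul_left _)).trans (le_of_eq ?_)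
      rw [tsum_mul_left, hGs.tsum_add hGm, tsum_shift_sub G (-1), hGt]
      ring
    have hest := tsum_sq_le_of_defect (r := defect (fun _ => α) (fun _ => A) E U) hlt hUs hrs
      (fun j => rfl)
    set X := ∑' j, ‖U j‖ ^ 2
    have hUp := summable_shift hUs 1
    have hue2 : ∀ e : Edge, ‖u n e‖ ^ 2 ≤ 3 * K ^ 2 * ‖g e‖ ^ 2
        + 3 * K ^ 2 * (‖U e.1‖ ^ 2 + ‖U (e.1 + 1)‖ ^ 2) := fun e => by
      have a1 := pow_le_pow_left₀ (norm_nonneg _) (hue hS e) 2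
      have a2 := sq_sum_three_le ‖U e.1‖ ‖U (e.1 + 1)‖ ‖g e‖
      rw [mul_pow] at a1
      nlinarith [mul_le_mul_of_nonneg_left a2 (sq_nonneg K)]
    have hVs := hUs.add hUp
    have hVe := summable_edge (fun j => by positivity) hVs
    have hsum := (hasSum_norm_sq (u n)).summable.tsum_le_tsum hue2
      ((hgs.summable.mul_left _).add (hVe.mul_left _))
    rw [(hasSum_norm_sq (u n)).tsum_eq, h1 n, (hgs.summable.mul_left _).tsum_add (hVe.mul_left _),
      tsum_mul_left, tsum_mul_left, hgs.tsum_eq,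
      tsum_edge (w := fun j => ‖U j‖ ^ 2 + ‖U (j + 1)‖ ^ 2) (fun j => by positivity) hVs,
      hUs.tsum_add hUp, tsum_shift_sub (fun j => ‖U j‖ ^ 2) 1] at hsum
    have hX : X ≤ 8 * K ^ 2 * ‖g‖ ^ 2 / δ ^ 2 := by
      rw [le_div_iff₀ (by positivity)]
      linarith
    calc (1 : ℝ) ≤ 3 * K ^ 2 * ‖g‖ ^ 2 + 3 * K ^ 2 * (2 * (X + X)) := by linarith
      _ ≤ 3 * K ^ 2 * ‖g‖ ^ 2 + 3 * K ^ 2 * (2 * (8 * K ^ 2 * ‖g‖ ^ 2 / δ ^ 2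
          + 8 * K ^ 2 * ‖g‖ ^ 2 / δ ^ 2)) := by gcongr
      _ = (48 * K ^ 4 / δ ^ 2 * 2 + 3 * K ^ 2) * ‖g‖ ^ 2 := by ring
  have hlim : Tendsto (fun n => (48 * K ^ 4 / δ ^ 2 * 2 + 3 * K ^ 2)
      * ‖v n - (E : ℂ) • u n‖ ^ 2) atTop (𝓝 0) := by
    simpa using (h3.pow 2).const_mul (48 * K ^ 4 / δ ^ 2 * 2 + 3 * K ^ 2)
  have := ge_of_tendsto' hlim main
  linarith

/-- With `η = 2 c cos θ` the plane wave `exp (i θ j)` solves the vertex equation. Its truncation to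
`1, …, N` has a bounded defect living on at most four vertices, whereas the norm of the
corresponding function on the graph tends to infinity with `N`. After normalization both the
residual and every single coordinate tend to zero. -/
theorem mem_essSpectrum_of_abs_eta_le {α A E : ℝ} (hS : sinPi E ≠ 0)
    (hA : Real.cos (A * Real.pi) ≠ 0) (hE : |eta α E| ≤ 2 * |Real.cos (A * Real.pi)|) :
    E ∈ essSpectrum (periodicHamiltonian α A) := by
  set c := Real.cos (A * Real.pi) with hc
  set η := eta α E with hη
  obtain ⟨K, hK, hKb⟩ := exists_inGraph_of_vertex hS
  have hq : |η / (2 * c)| ≤ 1 := by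
    rw [abs_div, abs_mul, abs_two, div_le_one (by positivity)]
    exact hE
  set θ := Real.arccos (η / (2 * c)) with hθ
  have hcos : Real.cos θ = η / (2 * c) := Real.cos_arccos (abs_le.1 hq).1 (abs_le.1 hq).2
  set z : ℂ := Complex.exp (θ * Complex.I) with hz
  have hz0 : z ≠ 0 := Complex.exp_ne_zero _
  have hzn : ‖z‖ = 1 := Complex.norm_exp_ofReal_mul_I θ
  have hzj : ∀ j : ℤ, ‖z ^ j‖ = 1 := fun j => by rw [norm_zpow, hzn, one_zpow]
  have hzz : (c : ℂ) * (z + z⁻¹) = η := by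
    have h1 : z + z⁻¹ = 2 * (Real.cos θ : ℂ) := by
      rw [Complex.ofReal_cos, Complex.two_cos, hz, ← Complex.exp_neg, neg_mul]
    have hcC : (c : ℂ) ≠ 0 := by exact_mod_cast hA
    rw [h1, hcos]
    push_cast
    field_simp
  set U : ℕ → ℤ → ℂ := fun N j => if 1 ≤ j ∧ j ≤ (N : ℤ) then z ^ j else 0 with hU
  have hUn : ∀ N j, ‖U N j‖ ≤ 1 := fun N j => by
    simp only [hU]
    split_ifs
    · exact (hzj j).le
    · simp
  set D := 4 * |c| with hD
  have hdn : ∀ N j, ‖defect (fun _ => α) (fun _ => A) E (U N) j‖ ≤ D := fun N j => by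
    have e : defect (fun _ => α) (fun _ => A) E (U N) j
        = c * U N (j + 1) + c * U N (j - 1) - η * U N j := rfl
    rw [e]
    refine (norm_sub_le _ _).trans ((add_le_add (norm_add_le _ _) le_rfl).trans ?_)
    rw [norm_mul, norm_mul, norm_mul, Complex.norm_real, Complex.norm_real, Real.norm_eq_abs,
      Real.norm_eq_abs]
    have a1 := mul_le_mul_of_nonneg_left (hUn N (j + 1)) (abs_nonneg c)
    have a2 := mul_le_mul_of_nonneg_left (hUn N (j - 1)) (abs_nonneg c)
    have a3 := mul_le_mul_of_nonneg_left (hUn N j) (abs_nonneg η)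
    linarith
  have hd0 : ∀ (N : ℕ) (j : ℤ), j ∉ ({0, 1, (N : ℤ), (N : ℤ) + 1} : Finset ℤ) →
      defect (fun _ => α) (fun _ => A) E (U N) j = 0 := fun N j hj => by
    have e : defect (fun _ => α) (fun _ => A) E (U N) j
        = c * U N (j + 1) + c * U N (j - 1) - η * U N j := rfl
    simp only [Finset.mem_insert, Finset.mem_singleton, not_or] at hj
    rw [e]
    simp only [hU]
    by_cases h : 1 ≤ j ∧ j ≤ (N : ℤ)
    · rw [if_pos (by omega), if_pos (by omega), if_pos h, zpow_add_one₀ hz0, zpow_sub_one₀ hz0]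
      linear_combination z ^ j * hzz
    · rw [if_neg (by omega), if_neg (by omega), if_neg h]
      simp
  have hds : ∀ N, Summable fun j => ‖defect (fun _ => α) (fun _ => A) E (U N) j‖ ^ 2 := fun N =>
    summable_of_ne_finset_zero (s := {0, 1, (N : ℤ), (N : ℤ) + 1}) fun j hj => by
      rw [hd0 N j hj]; simp
  have hdt : ∀ N, ∑' j, ‖defect (fun _ => α) (fun _ => A) E (U N) j‖ ^ 2 ≤ 4 * D ^ 2 := fun N => by
    rw [tsum_eq_sum (s := {0, 1, (N : ℤ), (N : ℤ) + 1}) fun j hj => by rw [hd0 N j hj]; simp]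
    refine (Finset.sum_le_card_nsmul _ _ (D ^ 2) fun j _ =>
      pow_le_pow_left₀ (norm_nonneg _) (hdn N j) 2).trans ?_
    rw [nsmul_eq_mul]
    gcongr
    exact_mod_cast Finset.card_le_four
  have hUs : ∀ N, Summable fun j => ‖U N j‖ ^ 2 := fun N =>
    summable_of_ne_finset_zero (s := Finset.Icc 1 (N : ℤ)) fun j hj => by
      have : ¬(1 ≤ j ∧ j ≤ (N : ℤ)) := by simpa using hj
      simp [hU, this]
  have hUt : ∀ N, ∑' j, ‖U N j‖ ^ 2 = N := fun N => by
    rw [tsum_eq_sum (s := Finset.Icc 1 (N : ℤ)) fun j hj => by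
      have : ¬(1 ≤ j ∧ j ≤ (N : ℤ)) := by simpa using hj
      simp [hU, this]]
    rw [Finset.sum_congr rfl (g := fun _ => (1 : ℝ)) fun j hj => by
      simp only [hU]; rw [if_pos (by simpa using hj), hzj, one_pow]]
    simp
  choose u v hg hu hv hlow using fun N => hKb _ _ (U N) (hUs N) (hds N)
  have hG : ∀ N, ‖v N - (E : ℂ) • u N‖ ^ 2 ≤ 8 * K ^ 2 * D ^ 2 := fun N => by
    have hs := hasSum_norm_sq (v N - (E : ℂ) • u N)
    rw [← hs.tsum_eq]
    have hb := ((summable_edge (fun j => sq_nonneg _) (hds N)).mul_left (K ^ 2))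
    refine (hs.summable.tsum_le_tsum (fun e => ?_) hb).trans ?_
    · rw [← mul_pow]
      exact pow_le_pow_left₀ (norm_nonneg _) (hv N e) 2
    · rw [tsum_mul_left, tsum_edge (fun j => sq_nonneg _) (hds N)]
      nlinarith [mul_le_mul_of_nonneg_left (hdt N) (sq_nonneg K)]
  have hge : ∀ N e, (v N - (E : ℂ) • u N) e = v N e - (E : ℂ) • u N e := fun _ _ => rfl
  have hbig : ∀ N : ℕ, (N : ℝ) ≤ 2 * K ^ 2 * (‖u N‖ ^ 2 + 8 * K ^ 2 * D ^ 2) := fun N => by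
    have h1 := (tsum_vertex_sq_le (u := u N) (g := v N - (E : ℂ) • u N) (hlow N)).2
    rw [hUt] at h1
    refine h1.trans ?_
    gcongr
    exact hG N
  have hK0 : 0 < K := by
    rcases hK.eq_or_lt with h | h
    · have := hbig 1
      rw [← h] at this
      norm_num at this
    · exact h
  have hinf : Tendsto (fun N => ‖u N‖ ^ 2) atTop atTop := by
    have h1 : Tendsto (fun N : ℕ => (N : ℝ) / (2 * K ^ 2) + -(8 * K ^ 2 * D ^ 2)) atTop atTop :=
      tendsto_atTop_add_const_right _ _
        (tendsto_natCast_atTop_atTop.atTop_div_const (by positivity))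
    refine tendsto_atTop_mono (fun N => ?_) h1
    have h2 := hbig N
    rw [mul_comm (2 * K ^ 2), ← div_le_iff₀ (by positivity)] at h2
    linarith
  have hinf' : Tendsto (fun N => ‖u N‖) atTop atTop := by
    refine (Real.tendsto_sqrt_atTop.comp hinf).congr fun N => ?_
    exact Real.sqrt_sq (norm_nonneg _)
  obtain ⟨N₀, hN₀⟩ := (hinf'.eventually (eventually_gt_atTop 0)).exists_forall_of_atTop
  have hsh : Tendsto (fun N => ‖u (N + N₀)‖) atTop atTop :=
    hinf'.comp (tendsto_add_atTop_nat N₀)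
  refine mem_essSpectrum_of_seq (fun n => hg (n + N₀)) (fun n h => ?_) ?_ (fun e => ?_)
  · have := hN₀ (n + N₀) (by omega)
    rw [h, norm_zero] at this
    exact lt_irrefl _ this
  · refine squeeze_zero (fun n => by positivity) (fun n => ?_)
      (hsh.const_div_atTop (√(8 * K ^ 2 * D ^ 2)))
    gcongr
    rw [← Real.sqrt_sq (norm_nonneg (v (n + N₀) - (E : ℂ) • u (n + N₀)))]
    exact Real.sqrt_le_sqrt (hG _)
  · refine squeeze_zero (fun n => by positivity) (fun n => ?_)
      (hsh.const_div_atTop (K * (1 + 1 + D)))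
    gcongr
    refine (hu _ e).trans ?_
    gcongr
    · exact hUn _ _
    · exact hUn _ _
    · exact hdn _ _

/-! ### Stability of the essential spectrum -/

lemma mem_essSpectrum_of_tendsto {α A : ℤ → ℝ} {E : ℝ} {u v : ℕ → GraphL2}
    (hg : ∀ n, InGraph α A (u n) (v n)) (h1 : Tendsto (fun n => ‖u n‖) atTop (𝓝 1))
    (h2 : ∀ y : GraphL2, Tendsto (fun n => inner ℂ y (u n)) atTop (𝓝 0))
    (h3 : Tendsto (fun n => ‖v n - (E : ℂ) • u n‖) atTop (𝓝 0)) :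
    E ∈ essSpectrum (hamiltonian α A) := by
  rw [mem_essSpectrum_iff]
  obtain ⟨N, hN⟩ := (h1.eventually (lt_mem_nhds zero_lt_one)).exists_forall_of_atTop
  have hsh := tendsto_add_atTop_nat N
  have hinv : Tendsto (fun n => ‖u (n + N)‖⁻¹) atTop (𝓝 1) := by
    simpa using (h1.comp hsh).inv₀ one_ne_zero
  have hn : ∀ n, ‖((‖u n‖⁻¹ : ℝ) : ℂ)‖ = ‖u n‖⁻¹ := fun n => by simp
  refine ⟨fun n => ((‖u (n + N)‖⁻¹ : ℝ) : ℂ) • u (n + N),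
    fun n => ((‖u (n + N)‖⁻¹ : ℝ) : ℂ) • v (n + N),
    fun n => (hg _).smul _, fun n => ?_, fun y => ?_, ?_⟩
  · rw [norm_smul, hn, inv_mul_cancel₀ (hN _ (by omega)).ne']
  · have h4 := ((Complex.continuous_ofReal.tendsto 1).comp hinv).mul ((h2 y).comp hsh)
    rw [mul_zero] at h4
    refine h4.congr fun n => ?_
    rw [inner_smul_right]
    rfl
  · have h4 := hinv.mul (h3.comp hsh)
    rw [mul_zero] at h4
    refine h4.congr fun n => ?_
    rw [smul_comm, ← smul_sub, norm_smul, hn]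
    rfl

lemma EdgeGraph.zero (a : ℝ) : EdgeGraph a 0 0 0 0 0 where
  sob := IsSobolevTwo.zero
  eq := by
    filter_upwards [Lp.coeFn_zero ℂ 2 edgeMeasure] with x hx
    have hx' : (0 : EdgeL2) x = 0 := hx
    rw [hx']
    simp

lemma EdgeGraph.sub {a : ℝ} {u v u' v' : EdgeL2} {f p f' p' : ℝ → ℂ} {q q' : EdgeL2}
    (h : EdgeGraph a u v f p q) (h' : EdgeGraph a u' v' f' p' q') :
    EdgeGraph a (u - u') (v - v') (f - f') (p - p') (q - q') where
  sob := by
    have := h.sob.add (h'.sob.smul (-1))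
    simpa [sub_eq_add_neg] using this
  eq := by
    filter_upwards [h.eq, h'.eq, Lp.coeFn_sub v v', Lp.coeFn_sub q q'] with x h1 h2 h3 h4
    rw [h3, h4, Pi.sub_apply, Pi.sub_apply, h1, h2]
    simp only [Pi.sub_apply]
    ring

lemma trace_sub (a : ℝ) (f p f' p' : ℝ → ℂ) (i : Fin 4) :
    trace a (f - f') (p - p') i = trace a f p i - trace a f' p' i := by
  fin_cases i <;> simp [trace] <;> ring

lemma trace_zero (a : ℝ) (i : Fin 4) : trace a 0 0 i = 0 := by
  fin_cases i <;> simp [trace]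

/-- Functions on an edge with given boundary data at one of the ends and none at the other. -/
lemma exists_cap (E a : ℝ) : ∃ K, 0 ≤ K ∧ ∀ x y : ℂ,
    (∃ d d' f p q, EdgeGraph a d d' f p q ∧ trace a f p 0 = x ∧ trace a f p 1 = y ∧
      trace a f p 2 = 0 ∧ trace a f p 3 = 0 ∧ ‖d‖ ≤ K * (‖x‖ + ‖y‖) ∧
      ‖d' - (E : ℂ) • d‖ ≤ K * (‖x‖ + ‖y‖)) ∧
    (∃ d d' f p q, EdgeGraph a d d' f p q ∧ trace a f p 0 = 0 ∧ trace a f p 1 = 0 ∧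
      trace a f p 2 = x ∧ trace a f p 3 = y ∧ ‖d‖ ≤ K * (‖x‖ + ‖y‖) ∧
      ‖d' - (E : ℂ) • d‖ ≤ K * (‖x‖ + ‖y‖)) := by
  have cv : Continuous hermVal :=
    continuous_iff_continuousAt.2 fun x => (hasDerivAt_hermVal x).continuousAt
  have cs : Continuous hermSlope :=
    continuous_iff_continuousAt.2 fun x => (hasDerivAt_hermSlope x).continuousAt
  have cv2 := continuous_hermVal''
  have cs2 := continuous_hermSlope''
  have cpi : Continuous fun x : ℝ => Real.pi - x := by fun_prop
  obtain ⟨M₁, hM₁, hb₁⟩ := exists_bound_Icc cv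
  obtain ⟨M₂, hM₂, hb₂⟩ := exists_bound_Icc cs
  obtain ⟨M₃, hM₃, hb₃⟩ := exists_bound_Icc cv2
  obtain ⟨M₄, hM₄, hb₄⟩ := exists_bound_Icc cs2
  simp only [norm_mul, norm_phase, one_mul, Complex.norm_real, forall_const] at hb₁ hb₂ hb₃ hb₄
  set M := M₁ + M₂ + M₃ + M₄ with hM
  have hM0 : 0 ≤ M := by positivity
  have hcomb : ∀ (x y : ℂ) (b c : ℝ), ‖b‖ ≤ M → ‖c‖ ≤ M →
      ‖x * (b : ℂ) + y * (c : ℂ)‖ ≤ M * (‖x‖ + ‖y‖) := fun x y b c hb hc => by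
    refine (norm_add_le _ _).trans ?_
    rw [norm_mul, norm_mul, Complex.norm_real, Complex.norm_real, mul_add, mul_comm M, mul_comm M]
    gcongr
  have hnorm : ∀ (x y : ℂ) (F Q : ℝ → ℂ) (hu : Continuous fun t => phase (-a) t * F t)
      (hv : Continuous fun t => -(phase (-a) t * Q t)),
      (∀ t ∈ Icc (0 : ℝ) Real.pi, ‖F t‖ ≤ M * (‖x‖ + ‖y‖)) →
      (∀ t ∈ Icc (0 : ℝ) Real.pi, ‖Q t‖ ≤ M * (‖x‖ + ‖y‖)) →
      ‖edgeLp _ hu‖ ≤ √Real.pi * M * (1 + |E|) * (‖x‖ + ‖y‖) ∧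
      ‖edgeLp _ hv - (E : ℂ) • edgeLp _ hu‖ ≤ √Real.pi * M * (1 + |E|) * (‖x‖ + ‖y‖) := by
    intro x y F Q hu hv hF hQ
    have n0 : 0 ≤ M * (‖x‖ + ‖y‖) := by positivity
    have n1 : ‖edgeLp _ hu‖ ≤ √Real.pi * (M * (‖x‖ + ‖y‖)) := norm_edgeLp_le hu n0 fun t ht => by
      rw [norm_mul, norm_phase, one_mul]; exact hF t ht
    have n2 : ‖edgeLp _ hv‖ ≤ √Real.pi * (M * (‖x‖ + ‖y‖)) := norm_edgeLp_le hv n0 fun t ht => by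
      rw [norm_neg, norm_mul, norm_phase, one_mul]; exact hQ t ht
    have n3 : 0 ≤ √Real.pi * (M * (‖x‖ + ‖y‖)) := by positivity
    have hE := abs_nonneg E
    constructor
    · nlinarith
    · refine (norm_sub_le _ _).trans ?_
      rw [norm_smul, Complex.norm_real, Real.norm_eq_abs]
      nlinarith [mul_le_mul_of_nonneg_left n1 hE]
  have hpm := phase_neg_mul a Real.pi
  refine ⟨√Real.pi * M * (1 + |E|), by positivity, fun x y => ⟨?_, ?_⟩⟩
  · obtain ⟨hu, hv, p, q, hg, h0, hπ⟩ := edgeGraph_of_gauge a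
      (F := fun t => x * (hermVal t : ℂ) + y * (hermSlope t : ℂ))
      (P := fun t => x * (hermVal' t : ℂ) + y * (hermSlope' t : ℂ))
      (Q := fun t => x * (hermVal'' t : ℂ) + y * (hermSlope'' t : ℂ))
      (fun t => ((hasDerivAt_hermVal t).ofReal_comp.const_mul x).add
        ((hasDerivAt_hermSlope t).ofReal_comp.const_mul y))
      (fun t => ((hasDerivAt_hermVal' t).ofReal_comp.const_mul x).add
        ((hasDerivAt_hermSlope' t).ofReal_comp.const_mul y)) (by fun_prop)
    obtain ⟨n1, n2⟩ := hnorm x y _ _ hu hv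
      (fun t ht => hcomb _ _ _ _ ((hb₁ t ht).trans (by linarith)) ((hb₂ t ht).trans (by linarith)))
      (fun t ht => hcomb _ _ _ _ ((hb₃ t ht).trans (by linarith)) ((hb₄ t ht).trans (by linarith)))
    refine ⟨_, _, _, p, q, hg, ?_, ?_, ?_, ?_, n1, n2⟩
    · simp [trace]
    · simp at h0
      simp [trace, h0]
    · simp [trace]
    · simp at hπ
      simp [trace, hπ]
  · obtain ⟨hu, hv, p, q, hg, h0, hπ⟩ := edgeGraph_of_gauge a
      (F := fun t => x * (hermVal (Real.pi - t) : ℂ) + y * ((-hermSlope (Real.pi - t) : ℝ) : ℂ))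
      (P := fun t => x * ((-hermVal' (Real.pi - t) : ℝ) : ℂ)
        + y * ((hermSlope' (Real.pi - t) : ℝ) : ℂ))
      (Q := fun t => x * ((hermVal'' (Real.pi - t) : ℝ) : ℂ)
        + y * ((-hermSlope'' (Real.pi - t) : ℝ) : ℂ))
      (fun t => ((hasDerivAt_comp_pi_sub (hasDerivAt_hermVal _)).ofReal_comp.const_mul x).add
        (((hasDerivAt_comp_pi_sub (hasDerivAt_hermSlope _)).neg.congr_deriv
          (neg_neg _)).ofReal_comp.const_mul y))
      (fun t => (((hasDerivAt_comp_pi_sub (hasDerivAt_hermVal' _)).neg.congr_deriv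
          (neg_neg _)).ofReal_comp.const_mul x).add
        ((hasDerivAt_comp_pi_sub (hasDerivAt_hermSlope' _)).ofReal_comp.const_mul y))
      (by fun_prop)
    have hm : ∀ t ∈ Icc (0 : ℝ) Real.pi, Real.pi - t ∈ Icc (0 : ℝ) Real.pi := fun t ht =>
      ⟨by linarith [ht.2], by linarith [ht.1]⟩
    obtain ⟨n1, n2⟩ := hnorm x y _ _ hu hv
      (fun t ht => hcomb _ _ _ _ ((hb₁ _ (hm t ht)).trans (by linarith))
        (by rw [norm_neg]; exact (hb₂ _ (hm t ht)).trans (by linarith)))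
      (fun t ht => hcomb _ _ _ _ ((hb₃ _ (hm t ht)).trans (by linarith))
        (by rw [norm_neg]; exact (hb₄ _ (hm t ht)).trans (by linarith)))
    refine ⟨_, _, _, p, q, hg, ?_, ?_, ?_, ?_, n1, n2⟩
    · simp [trace]
    · simp at h0
      simp [trace, h0]
    · simp [trace]
      linear_combination x * hpm
    · simp at hπ
      simp [trace, hπ]
      linear_combination y * hpm

lemma DeltaCoupling.of_trace {α A : ℤ → ℝ} {f p : Edge → ℝ → ℂ} {U : ℤ → ℂ}
    (hL : ∀ e, trace (edgeA A e) (f e) (p e) 0 = U e.1)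
    (hR : ∀ e, trace (edgeA A e) (f e) (p e) 2 = phase (edgeA A e) Real.pi * U (e.1 + 1))
    (hJ : ∀ j, trace (edgeA A (j, true)) (f (j, true)) (p (j, true)) 1
      + trace (edgeA A (j, false)) (f (j, false)) (p (j, false)) 1
      - phase (-A (j - 1)) Real.pi
        * trace (edgeA A (j - 1, true)) (f (j - 1, true)) (p (j - 1, true)) 3
      - phase (A (j - 1)) Real.pi
        * trace (edgeA A (j - 1, false)) (f (j - 1, false)) (p (j - 1, false)) 3
      = α j * U j) : DeltaCoupling α A f p := by
  have h0 : ∀ e, f e 0 = U e.1 := hL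
  have hπ : ∀ e, f e Real.pi = U (e.1 + 1) := fun e =>
    mul_left_cancel₀ (phase_ne_zero (edgeA A e) Real.pi) (hR e)
  refine ⟨fun j => ?_, fun j => ?_, fun j => ?_, fun j => ?_⟩
  · rw [h0, h0]
  · rw [h0, hπ, sub_add_cancel]
  · rw [h0, hπ, sub_add_cancel]
  · rw [h0, ← hJ]
    have e1 := phase_neg_mul (A (j - 1)) Real.pi
    have a1 : edgeA A (j - 1, true) = A (j - 1) := rfl
    have a2 : edgeA A (j - 1, false) = -A (j - 1) := rfl
    simp only [quasiDeriv, edgeField_eq, trace, Matrix.cons_val, a1, a2]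
    linear_combination ((p (j - 1, true) Real.pi
      + Complex.I * (A (j - 1) : ℝ) * f (j - 1, true) Real.pi) + (p (j - 1, false) Real.pi
      + Complex.I * ((-A (j - 1) : ℝ) : ℂ) * f (j - 1, false) Real.pi)) * e1

/-- Changing finitely many coordinates of an `ℓ²` vector adds a finite sum of vectors supported on
single edges, so the triangle inequality bounds the change. -/
lemma norm_add_sum_single (u : GraphL2) (s : Finset Edge) (d : Edge → EdgeL2)
    (hd : ∀ e ∉ s, d e = u e) :
    ∃ w : GraphL2, (∀ e, (u + w) e = d e) ∧ ‖w‖ ≤ ∑ e ∈ s, ‖d e - u e‖ := by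
  classical
  refine ⟨∑ e ∈ s, lp.single 2 e (d e - u e), fun e => ?_, ?_⟩
  · have h1 : (∑ e' ∈ s, lp.single 2 e' (d e' - u e') : GraphL2) e
        = ∑ e' ∈ s, (lp.single 2 e' (d e' - u e') : GraphL2) e := by
      rw [lp.coeFn_sum, Finset.sum_apply]
    change u e + (∑ e' ∈ s, lp.single 2 e' (d e' - u e') : GraphL2) e = d e
    rw [h1]
    by_cases he : e ∈ s
    · rw [Finset.sum_eq_single_of_mem e he fun b _ hb => lp.single_apply_ne 2 _ _ hb.symm,
        lp.single_apply_self]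
      abel
    · rw [Finset.sum_eq_zero fun b hb => lp.single_apply_ne 2 b _
        (fun h : e = b => he (by rw [h]; exact hb)), add_zero,
        hd e he]
  · refine (norm_sum_le _ _).trans (Finset.sum_le_sum fun e _ => ?_)
    rw [lp.norm_single (by norm_num)]

/-- Cutting off an edge function on the rings `0, …, N`, with interpolation on the rings `-1` and
`N + 1`. -/
lemma exists_cut {A A' : ℤ → ℝ} {N : ℤ} (hN : 0 ≤ N)
    (hA : ∀ j, ¬(0 ≤ j ∧ j ≤ N) → A' j = A j) (E : ℝ) (e : Edge) : ∃ K, 0 ≤ K ∧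
    ∀ u v f p q, EdgeGraph (edgeA A e) u v f p q → ∃ u' v' f' p' q',
      EdgeGraph (edgeA A' e) u' v' f' p' q' ∧
      (∀ i : Fin 4, trace (edgeA A' e) f' p' i =
        if (i = 0 ∨ i = 1) then (if 0 ≤ e.1 ∧ e.1 ≤ N + 1 then 0 else trace (edgeA A e) f p i)
        else (if -1 ≤ e.1 ∧ e.1 ≤ N then 0 else trace (edgeA A e) f p i)) ∧
      (¬(-1 ≤ e.1 ∧ e.1 ≤ N + 1) → u' = u ∧ v' = v) ∧
      ‖u' - u‖ ≤ ‖u‖ + ‖v - (E : ℂ) • u‖ + K * ∑ i, ‖trace (edgeA A e) f p i‖ ∧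
      ‖(v' - v) - (E : ℂ) • (u' - u)‖
        ≤ ‖u‖ + ‖v - (E : ℂ) • u‖ + K * ∑ i, ‖trace (edgeA A e) f p i‖ := by
  obtain ⟨K, hK, hcap⟩ := exists_cap E (edgeA A e)
  refine ⟨K, hK, fun u v f p q h => ?_⟩
  have hu := norm_nonneg u
  have hv := norm_nonneg (v - (E : ℂ) • u)
  have hsum : ∑ i, ‖trace (edgeA A e) f p i‖ = ‖trace (edgeA A e) f p 0‖
      + ‖trace (edgeA A e) f p 1‖ + ‖trace (edgeA A e) f p 2‖ + ‖trace (edgeA A e) f p 3‖ :=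
    Fin.sum_univ_four _
  have hsum0 : 0 ≤ K * ∑ i, ‖trace (edgeA A e) f p i‖ := by positivity
  have hb1 : K * (‖trace (edgeA A e) f p 0‖ + ‖trace (edgeA A e) f p 1‖)
      ≤ K * ∑ i, ‖trace (edgeA A e) f p i‖ := by
    rw [hsum]
    refine mul_le_mul_of_nonneg_left ?_ hK
    linarith [norm_nonneg (trace (edgeA A e) f p 2), norm_nonneg (trace (edgeA A e) f p 3)]
  have hb2 : K * (‖trace (edgeA A e) f p 2‖ + ‖trace (edgeA A e) f p 3‖)
      ≤ K * ∑ i, ‖trace (edgeA A e) f p i‖ := by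
    rw [hsum]
    refine mul_le_mul_of_nonneg_left ?_ hK
    linarith [norm_nonneg (trace (edgeA A e) f p 0), norm_nonneg (trace (edgeA A e) f p 1)]
  by_cases h1 : 0 ≤ e.1 ∧ e.1 ≤ N
  · refine ⟨0, 0, 0, 0, 0, EdgeGraph.zero _, fun i => ?_, fun hn => absurd h1 (by omega), ?_, ?_⟩
    · rw [trace_zero, if_pos (show 0 ≤ e.1 ∧ e.1 ≤ N + 1 by omega),
        if_pos (show -1 ≤ e.1 ∧ e.1 ≤ N by omega), ite_self]
    · rw [zero_sub, norm_neg]; linarith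
    · rw [zero_sub, zero_sub, smul_neg, sub_neg_eq_add, neg_add_eq_sub, norm_sub_rev]
      linarith
  have hAe : edgeA A' e = edgeA A e := by
    unfold edgeA
    rw [hA _ h1]
  rw [hAe]
  have hsub : ∀ d d' : EdgeL2, ((v - d') - v) - (E : ℂ) • ((u - d) - u) = -(d' - (E : ℂ) • d) :=
    fun d d' => by rw [smul_sub, smul_sub]; abel
  -- On the ring `-1` only the data at the right end are removed, and on the ring `N + 1` only those
  -- at the left end. The conditions at the vertices `-1` and `N + 2` therefore remain untouched.
  by_cases h2 : e.1 = -1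
  · obtain ⟨-, d, d', f', p', q', hg, t0, t1, t2, t3, n1, n2⟩ :=
      hcap (trace (edgeA A e) f p 2) (trace (edgeA A e) f p 3)
    refine ⟨u - d, v - d', f - f', p - p', q - q', h.sub hg, fun i => ?_,
      fun hn => absurd h2 (by omega), ?_, ?_⟩
    · rw [trace_sub, if_neg (show ¬(0 ≤ e.1 ∧ e.1 ≤ N + 1) by omega),
        if_pos (show -1 ≤ e.1 ∧ e.1 ≤ N by omega)]
      fin_cases i
      · simp [t0]
      · simp [t1]
      · simp [t2]
      · simp [t3]
    · rw [sub_sub_cancel_left, norm_neg]; linarith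
    · rw [hsub, norm_neg]; linarith
  by_cases h3 : e.1 = N + 1
  · obtain ⟨⟨d, d', f', p', q', hg, t0, t1, t2, t3, n1, n2⟩, -⟩ :=
      hcap (trace (edgeA A e) f p 0) (trace (edgeA A e) f p 1)
    refine ⟨u - d, v - d', f - f', p - p', q - q', h.sub hg, fun i => ?_,
      fun hn => absurd h3 (by omega), ?_, ?_⟩
    · rw [trace_sub, if_pos (show (0 ≤ e.1 ∧ e.1 ≤ N + 1) by omega),
        if_neg (show ¬(-1 ≤ e.1 ∧ e.1 ≤ N) by omega)]
      fin_cases i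
      · simp [t0]
      · simp [t1]
      · simp [t2]
      · simp [t3]
    · rw [sub_sub_cancel_left, norm_neg]; linarith
    · rw [hsub, norm_neg]; linarith
  · refine ⟨u, v, f, p, q, h, fun i => ?_, fun _ => ⟨rfl, rfl⟩, ?_, ?_⟩
    · rw [if_neg (show ¬(0 ≤ e.1 ∧ e.1 ≤ N + 1) by omega),
        if_neg (show ¬(-1 ≤ e.1 ∧ e.1 ≤ N) by omega), ite_self]
    · rw [sub_self, norm_zero]; linarith
    · rw [sub_self, sub_self, smul_zero, sub_zero, norm_zero]; linarith

/-- A singular sequence is cut off so as to vanish, together with its boundary data, wherever the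
coefficients differ; the result lies in the graph of the other operator. The cut costs only norms
and boundary data on finitely many edges, and these tend to zero, so the modified sequence is still
singular. -/
theorem essSpectrum_subset {α A α' A' : ℤ → ℝ} {N : ℤ} (hN : 0 ≤ N)
    (hα : ∀ j, ¬(0 ≤ j ∧ j ≤ N) → α' j = α j) (hA : ∀ j, ¬(0 ≤ j ∧ j ≤ N) → A' j = A j) :
    essSpectrum (hamiltonian α A) ⊆ essSpectrum (hamiltonian α' A') := by
  intro E hE
  obtain ⟨u, v, hg, h1, h2, h3⟩ := mem_essSpectrum_iff.1 hE
  choose f p q heg hc using fun n => (hg n).exists_edgeGraph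
  choose K hK hcut using exists_cut (A := A) hN hA E
  choose u' v' f' p' q' heg' ht hout hnu hnv using fun n e => hcut e _ _ _ _ _ (heg n e)
  -- everything at a fixed edge tends to zero
  have hve : ∀ e, Tendsto (fun n => ‖v n e - (E : ℂ) • u n e‖) atTop (𝓝 0) := fun e =>
    squeeze_zero (fun n => norm_nonneg _)
      (fun n => lp.norm_apply_le_norm (by norm_num) (v n - (E : ℂ) • u n) e) h3
  have hweak : ∀ e (y : EdgeL2), Tendsto (fun n => inner ℂ y (u n e)) atTop (𝓝 0) := fun e y => by
    classical
    refine (h2 (lp.single 2 e y)).congr fun n => ?_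
    exact lp.inner_single_left _ _ _
  have htr : ∀ e i, Tendsto (fun n => ‖trace (edgeA A e) (f n e) (p n e) i‖) atTop (𝓝 0) :=
    fun e i => by
      simpa using (tendsto_trace (fun n => heg n e) (hweak e) (hve e) i).norm
  -- On a single edge weak convergence improves to norm convergence, because boundary data and
  -- residual determine the function.
  have hue : ∀ e, Tendsto (fun n => ‖u n e‖) atTop (𝓝 0) := fun e => by
    obtain ⟨K₂, -, hK₂⟩ := exists_norm_le_of_trace E
    refine squeeze_zero (fun n => norm_nonneg _) (fun n => hK₂ _ _ _ _ _ _ (heg n e)) ?_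
    simpa using (((htr e 0).add (htr e 1)).add (hve e)).const_mul K₂
  set B : ℕ → Edge → ℝ := fun n e => ‖u n e‖ + ‖v n e - (E : ℂ) • u n e‖
    + K e * ∑ i, ‖trace (edgeA A e) (f n e) (p n e) i‖ with hB
  have hBlim : ∀ e, Tendsto (fun n => B n e) atTop (𝓝 0) := fun e => by
    have := ((hue e).add (hve e)).add
      ((tendsto_finsetSum Finset.univ fun i _ => htr e i).const_mul (K e))
    rw [add_zero, Finset.sum_const_zero, mul_zero, add_zero] at this
    exact this
  set s : Finset Edge := Finset.Icc (-1) (N + 1) ×ˢ Finset.univ with hs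
  have hsmem : ∀ e, e ∉ s → ¬(-1 ≤ e.1 ∧ e.1 ≤ N + 1) := fun e he h => he (by
    simp only [hs, Finset.mem_product, Finset.mem_Icc, Finset.mem_univ, and_true]; exact h)
  have hBs : Tendsto (fun n => ∑ e ∈ s, B n e) atTop (𝓝 0) := by
    simpa using tendsto_finsetSum s fun e _ => hBlim e
  choose w hw hwn using fun n => norm_add_sum_single (u n) s (u' n) fun e he =>
    (hout n e (hsmem e he)).1
  choose w' hw' hwn' using fun n => norm_add_sum_single (v n - (E : ℂ) • u n) s
    (fun e => v' n e - (E : ℂ) • u' n e) fun e he => by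
      rw [(hout n e (hsmem e he)).1, (hout n e (hsmem e he)).2]; rfl
  have hwlim : Tendsto (fun n => ‖w n‖) atTop (𝓝 0) :=
    squeeze_zero (fun n => norm_nonneg _) (fun n => (hwn n).trans
      (Finset.sum_le_sum fun e _ => hnu n e)) hBs
  have hwlim' : Tendsto (fun n => ‖w' n‖) atTop (𝓝 0) := by
    refine squeeze_zero (fun n => norm_nonneg _) (fun n => (hwn' n).trans
      (Finset.sum_le_sum fun e _ => ?_)) hBs
    refine le_trans (le_of_eq ?_) (hnv n e)
    change ‖(v' n e - (E : ℂ) • u' n e) - (v n e - (E : ℂ) • u n e)‖ = _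
    congr 1
    rw [smul_sub]; abel
  have hv' : ∀ n e, (v n + w' n + (E : ℂ) • w n) e = v' n e := fun n e => by
    have a1 := hw n e
    have a2 := hw' n e
    change u n e + w n e = u' n e at a1
    change (v n e - (E : ℂ) • u n e) + w' n e = v' n e - (E : ℂ) • u' n e at a2
    change v n e + w' n e + (E : ℂ) • w n e = v' n e
    rw [← a1, smul_add] at a2
    have a3 : v' n e = (v n e - (E : ℂ) • u n e) + w' n e
        + ((E : ℂ) • u n e + (E : ℂ) • w n e) := by rw [a2]; abel
    rw [a3]; abel
  refine mem_essSpectrum_of_tendsto (u := fun n => u n + w n)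
    (v := fun n => v n + w' n + (E : ℂ) • w n) (fun n => ?_) ?_ (fun y => ?_) ?_
  · refine ⟨f' n, p' n, q' n, fun e => ?_, ?_, fun e => ?_⟩
    · rw [hw]; exact (heg' n e).sob
    · refine DeltaCoupling.of_trace
        (U := fun j => if 0 ≤ j ∧ j ≤ N + 1 then 0 else f n (j, true) 0) (fun e => ?_)
        (fun e => ?_) (fun j => ?_)
      · rw [ht, if_pos (Or.inl rfl), (hc n).left]
      · rw [ht, if_neg (by decide), (hc n).right]
        by_cases he : -1 ≤ e.1 ∧ e.1 ≤ N
        · rw [if_pos he, if_pos (by omega), mul_zero]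
        · have : A' e.1 = A e.1 := hA _ (by omega)
          rw [if_neg he, if_neg (by omega)]
          simp only [edgeA, this]
      · have hT1 : ∀ e, trace (edgeA A' e) (f' n e) (p' n e) 1
            = if 0 ≤ e.1 ∧ e.1 ≤ N + 1 then 0 else trace (edgeA A e) (f n e) (p n e) 1 :=
          fun e => by rw [ht, if_pos (Or.inr rfl)]
        have hT3 : ∀ e, trace (edgeA A' e) (f' n e) (p' n e) 3
            = if -1 ≤ e.1 ∧ e.1 ≤ N then 0 else trace (edgeA A e) (f n e) (p n e) 3 :=
          fun e => by rw [ht, if_neg (by decide)]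
        rw [hT1, hT1, hT3, hT3]
        simp only
        by_cases hj : 0 ≤ j ∧ j ≤ N + 1
        · have hj' : -1 ≤ j - 1 ∧ j - 1 ≤ N := by omega
          rw [if_pos hj, if_pos hj, if_pos hj', if_pos hj', if_pos hj]
          ring
        · have hj' : ¬(-1 ≤ j - 1 ∧ j - 1 ≤ N) := by omega
          rw [if_neg hj, if_neg hj, if_neg hj', if_neg hj', if_neg hj,
            hA _ (by omega), hα _ (by omega)]
          exact (hc n).jump_trace j
    · rw [hv', edgeField_eq]
      exact (heg' n e).eq
  · have hle : ∀ n, |‖u n + w n‖ - 1| ≤ ‖w n‖ := fun n => by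
      have := abs_norm_sub_norm_le (u n + w n) (u n)
      rwa [h1, add_sub_cancel_left] at this
    have := squeeze_zero (fun n => abs_nonneg _) hle hwlim
    rw [tendsto_iff_norm_sub_tendsto_zero]
    simpa using this
  · simp only [inner_add_right]
    rw [← add_zero (0 : ℂ)]
    refine (h2 y).add (squeeze_zero_norm (fun n => norm_inner_le_norm y (w n)) ?_)
    simpa using hwlim.const_mul ‖y‖
  · refine squeeze_zero (fun n => norm_nonneg _) (fun n => ?_) (by simpa using h3.add hwlim')
    have : v n + w' n + (E : ℂ) • w n - (E : ℂ) • (u n + w n) = (v n - (E : ℂ) • u n) + w' n := by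
      rw [smul_add]; abel
    rw [this]
    exact norm_add_le _ _

/-- The relation between the coefficients is symmetric, so `essSpectrum_subset` is applied in both
directions, on the rings `0, …, n`. -/
theorem essSpectrum_perturbedHamiltonian (α A : ℝ) (n : ℕ) (α' A' : ℤ → ℝ) (ε : ℝ) :
    essSpectrum (perturbedHamiltonian α A n α' A' ε) = essSpectrum (periodicHamiltonian α A) := by
  have h : ∀ (c : ℝ) (d : ℤ → ℝ) (j : ℤ), ¬(0 ≤ j ∧ j ≤ (n : ℤ)) → perturb c ε n d j = c :=
    fun c d j hj => if_neg (by omega)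
  refine Subset.antisymm ?_ ?_
  · exact essSpectrum_subset (N := n) (by omega) (fun j hj => (h _ _ j hj).symm)
      (fun j hj => (h _ _ j hj).symm)
  · exact essSpectrum_subset (N := n) (by omega) (h _ _) (h _ _)

/-! ### Jacobi operators on the line: uniqueness -/

/-- The Jacobi operator with diagonal `d` and off-diagonal `-c`. -/
def jacobi (c d W : ℤ → ℝ) (j : ℤ) : ℝ := d j * W j - c j * W (j + 1) - c (j - 1) * W (j - 1)

lemma summable_mul_of_sq {U V : ℤ → ℝ} (hU : Summable fun j => U j ^ 2)
    (hV : Summable fun j => V j ^ 2) : Summable fun j => U j * V j := by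
  refine Summable.of_norm_bounded (hU.add hV) fun j => ?_
  rw [Real.norm_eq_abs, abs_le]
  constructor <;> nlinarith [sq_nonneg (U j + V j), sq_nonneg (U j - V j)]

lemma summable_bdd_mul {a w : ℤ → ℝ} {M : ℝ} (ha : ∀ j, |a j| ≤ M) (hw : Summable w) :
    Summable fun j => a j * w j := by
  refine Summable.of_norm_bounded (hw.abs.mul_left M) fun j => ?_
  rw [norm_mul, Real.norm_eq_abs, Real.norm_eq_abs]
  exact mul_le_mul_of_nonneg_right (ha j) (abs_nonneg _)

lemma summable_sq_shift {U : ℤ → ℝ} (hU : Summable fun j => U j ^ 2) (a : ℤ) :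
    Summable fun j => U (j + a) ^ 2 := summable_shift hU a

section

variable {c d : ℤ → ℝ} {M : ℝ} {U V : ℤ → ℝ}

/-- Summation by parts: shifting the index in the term with `c (j - 1)` gives a form in which each
bond appears once and whose symmetry in `U` and `V` is visible. -/
lemma hasSum_jacobi_mul (hc : ∀ j, |c j| ≤ M) (hd : ∀ j, |d j| ≤ M)
    (hU : Summable fun j => U j ^ 2) (hV : Summable fun j => V j ^ 2) :
    HasSum (fun j => jacobi c d U j * V j)
      (∑' j, (d j * (U j * V j) - c j * (U (j + 1) * V j + U j * V (j + 1)))) := by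
  have s1 := summable_bdd_mul hd (summable_mul_of_sq hU hV)
  have s2 := summable_bdd_mul hc (summable_mul_of_sq (summable_sq_shift hU 1) hV)
  have s3 := summable_bdd_mul hc (summable_mul_of_sq hU (summable_sq_shift hV 1))
  have s4 := summable_shift s3 (-1)
  have e4 := tsum_shift_sub (fun j => c j * (U j * V (j + 1))) (-1)
  have h := (s1.hasSum.sub s2.hasSum).sub s4.hasSum
  rw [e4, ← s1.tsum_sub s2, ← (s1.sub s2).tsum_sub s3] at h
  have e1 : (fun j => jacobi c d U j * V j) = fun j => d j * (U j * V j) - c j * (U (j + 1) * V j)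
      - c (j + -1) * (U (j + -1) * V (j + -1 + 1)) := funext fun j => by
    simp only [jacobi, ← sub_eq_add_neg, sub_add_cancel]
    ring
  have e2 : ∑' j, (d j * (U j * V j) - c j * (U (j + 1) * V j + U j * V (j + 1)))
      = ∑' j, (d j * (U j * V j) - c j * (U (j + 1) * V j) - c j * (U j * V (j + 1))) :=
    tsum_congr fun j => by ring
  rw [e1, e2]
  exact h

lemma tsum_jacobi_mul_comm (hc : ∀ j, |c j| ≤ M) (hd : ∀ j, |d j| ≤ M)
    (hU : Summable fun j => U j ^ 2) (hV : Summable fun j => V j ^ 2) :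
    ∑' j, jacobi c d U j * V j = ∑' j, jacobi c d V j * U j := by
  rw [(hasSum_jacobi_mul hc hd hU hV).tsum_eq, (hasSum_jacobi_mul hc hd hV hU).tsum_eq]
  exact tsum_congr fun j => by ring

/-- The form of a weakly perturbed Jacobi operator is positive on sequences vanishing at `1`. -/
lemma tsum_jacobi_pos {κ x τ : ℝ} {n : ℕ} (hx : 2 * κ < x) (hτ : 0 ≤ τ)
    (hτκ : 3 * τ * (n * (n + 1)) ≤ κ / 2)
    (hc : ∀ j, |c j| ≤ M) (hd : ∀ j, |d j| ≤ M) (hc2 : ∀ j, κ / 2 ≤ c j)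
    (hcτ : ∀ j, c j ≤ κ + τ)
    (hcκ : ∀ j, ¬(1 ≤ j ∧ j ≤ (n : ℤ)) → c j = κ)
    (hdτ : ∀ j, 1 ≤ j ∧ j ≤ (n : ℤ) → x - (x - 2 * κ) / 2 - τ ≤ d j)
    (hdx : ∀ j, ¬(1 ≤ j ∧ j ≤ (n : ℤ)) → d j = x)
    (hU : Summable fun j => U j ^ 2) (hU1 : U 1 = 0) (hU0 : U ≠ 0) :
    0 < ∑' j, jacobi c d U j * U j := by
  have hUp := summable_sq_shift hU 1
  have hUU := summable_mul_of_sq hUp hU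
  have hDs : Summable fun j => (U (j + 1) - U j) ^ 2 := by
    refine ((hUp.add hU).sub (hUU.mul_left 2)).congr fun j => by ring
  set X := ∑' j, (U (j + 1) - U j) ^ 2 with hX
  have hX0 : 0 ≤ X := tsum_nonneg fun j => sq_nonneg _
  -- Hardy's inequality
  have hH : ∀ k : ℕ, U (k + 1) ^ 2 ≤ k * X := by
    intro k
    -- Telescoping from `U 1 = 0`; Cauchy–Schwarz is then applied to the `k` increments.
    have h1 : U (k + 1) = ∑ i ∈ Finset.range k, (U ((i : ℤ) + 1 + 1) - U ((i : ℤ) + 1)) := by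
      have := Finset.sum_range_sub (fun i : ℕ => U ((i : ℤ) + 1)) k
      simp only [Nat.cast_add, Nat.cast_one, Nat.cast_zero, zero_add, hU1, sub_zero] at this
      exact this.symm
    have h2 := sq_sum_le_card_mul_sum_sq (s := Finset.range k)
      (f := fun i : ℕ => U ((i : ℤ) + 1 + 1) - U ((i : ℤ) + 1))
    rw [← h1, Finset.card_range] at h2
    refine h2.trans (mul_le_mul_of_nonneg_left ?_ (Nat.cast_nonneg k))
    have hinj : Function.Injective fun i : ℕ => (i : ℤ) + 1 := fun a b h => by simpa using h
    have h3 := (hDs.comp_injective hinj).sum_le_tsum (Finset.range k) fun i _ => sq_nonneg _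
    refine h3.trans ?_
    exact (hDs.comp_injective hinj).tsum_le_tsum_of_inj _ hinj (fun _ _ => sq_nonneg _)
      (fun _ => le_rfl) hDs
  -- The sites `1, …, n + 1`: the site `n + 1` has an unperturbed diagonal entry but its left bond
  -- `c n` may be perturbed.
  set s : Finset ℤ := (Finset.range (n + 1)).map ⟨fun i : ℕ => (i : ℤ) + 1, fun a b h => by
    simpa using h⟩ with hs
  have hsmem : ∀ j : ℤ, j ∉ s → ¬(1 ≤ j ∧ j ≤ (n : ℤ) + 1) := fun j hj h => hj (by
    rw [hs, Finset.mem_map]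
    exact ⟨(j - 1).toNat, Finset.mem_range.2 (by omega), by
      change ((j - 1).toNat : ℤ) + 1 = j; omega⟩)
  set b : ℤ → ℝ := fun j => if j ∈ s then U j ^ 2 else 0 with hb
  have hbsum : HasSum b (∑ j ∈ s, U j ^ 2) := by
    have : HasSum b (∑ j ∈ s, b j) := hasSum_sum_of_ne_finset_zero fun j hj => if_neg hj
    rwa [Finset.sum_congr rfl fun j hj => if_pos hj] at this
  have hHsum : ∑ j ∈ s, U j ^ 2 ≤ n * (n + 1) * X := by
    rw [hs, Finset.sum_map]
    refine (Finset.sum_le_card_nsmul _ _ (n * X) fun i hi => ?_).trans ?_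
    · refine (hH i).trans (mul_le_mul_of_nonneg_right ?_ hX0)
      exact_mod_cast Nat.lt_succ_iff.1 (Finset.mem_range.1 hi)
    · rw [Finset.card_range, nsmul_eq_mul]
      push_cast
      linarith
  have hq := (hasSum_jacobi_mul hc hd hU hU).tsum_eq
  have s1 : Summable fun j => d j * (U j * U j) :=
    summable_bdd_mul hd (summable_mul_of_sq hU hU)
  have s2 : Summable fun j => c j * (U (j + 1) * U j + U j * U (j + 1)) :=
    summable_bdd_mul hc (hUU.add (summable_mul_of_sq hU hUp))
  have s3 : Summable fun j => c j * (U (j + 1) ^ 2 + U j ^ 2) := summable_bdd_mul hc (hUp.add hU)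
  have s3' : Summable fun j => c j * U (j + 1) ^ 2 := summable_bdd_mul hc hUp
  have s3'' : Summable fun j => c j * U j ^ 2 := summable_bdd_mul hc hU
  have s4 := summable_shift s3' (-1)
  have e4 := tsum_shift_sub (fun j => c j * U (j + 1) ^ 2) (-1)
  have s5 : Summable fun j => c j * (U (j + 1) - U j) ^ 2 := summable_bdd_mul hc hDs
  -- On each bond `-2 a b = (a - b)² - a² - b²`, and the square at the right end of the bond is
  -- moved to its own site by a shift of the index.
  have hsplit : ∑' j, (d j * (U j * U j) - c j * (U (j + 1) * U j + U j * U (j + 1)))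
      = ∑' j, ((d j * (U j * U j) - c j * U j ^ 2 - c (j + -1) * U (j + -1 + 1) ^ 2)
        + c j * (U (j + 1) - U j) ^ 2) := by
    rw [((s1.sub s3'').sub s4).tsum_add s5, (s1.sub s3'').tsum_sub s4, s1.tsum_sub s3'', e4,
      ← s1.tsum_sub s3'', ← (s1.sub s3'').tsum_sub s3', ← ((s1.sub s3'').sub s3').tsum_add s5]
    exact tsum_congr fun j => by ring
  -- The potential left over at `j` is `d j - c j - c (j - 1)`. It equals `x - 2 κ` off `s` and is
  -- at least `(x - 2 κ) / 2 - 3 τ` on `s`: one `τ` comes from the diagonal and one from each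
  -- adjacent bond. Hardy's inequality absorbs the loss in the gradient term with coefficient `κ /
  -- 2`.
  have hle : ∀ j, (x - 2 * κ) / 2 * U j ^ 2 - 3 * τ * b j + κ / 2 * (U (j + 1) - U j) ^ 2
      ≤ (d j * (U j * U j) - c j * U j ^ 2 - c (j + -1) * U (j + -1 + 1) ^ 2)
        + c j * (U (j + 1) - U j) ^ 2 := fun j => by
    have h1 := mul_le_mul_of_nonneg_right (hc2 j) (sq_nonneg (U (j + 1) - U j))
    rw [neg_add_cancel_right]
    have h2 : (x - 2 * κ) / 2 * U j ^ 2 - 3 * τ * b j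
        ≤ (d j - c j - c (j + -1)) * U j ^ 2 := by
      by_cases hj : j ∈ s
      · simp only [hb, if_pos hj]
        rw [← sub_mul]
        refine mul_le_mul_of_nonneg_right ?_ (sq_nonneg _)
        have a1 := hcτ j
        have a2 := hcτ (j + -1)
        by_cases hj1 : 1 ≤ j ∧ j ≤ (n : ℤ)
        · have := hdτ j hj1
          linarith
        · have := hdx j hj1
          linarith
      · have hj1 := hsmem j hj
        have a1 := hcκ j (by omega)
        have a2 := hcκ (j + -1) (by omega)
        have a3 := hdx j (by omega)
        simp only [hb, if_neg hj, a1, a2, a3]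
        nlinarith [sq_nonneg (U j)]
    nlinarith
  have hLs : HasSum (fun j => (x - 2 * κ) / 2 * U j ^ 2 - 3 * τ * b j
      + κ / 2 * (U (j + 1) - U j) ^ 2)
      ((x - 2 * κ) / 2 * ∑' j, U j ^ 2 - 3 * τ * (∑ j ∈ s, U j ^ 2) + κ / 2 * X) :=
    ((hU.hasSum.mul_left _).sub (hbsum.mul_left _)).add (hDs.hasSum.mul_left _)
  have hfin := hLs.summable.tsum_le_tsum hle (((s1.sub s3'').sub s4).add s5)
  rw [hLs.tsum_eq, ← hsplit, ← hq] at hfin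
  obtain ⟨i, hi⟩ := Function.ne_iff.1 hU0
  have hpos : 0 < ∑' j, U j ^ 2 := hU.tsum_pos (fun j => sq_nonneg _) i (by
    have : U i ≠ 0 := hi
    positivity)
  have h5 := mul_le_mul_of_nonneg_left hHsum (mul_nonneg zero_le_three hτ)
  have h6 := mul_le_mul_of_nonneg_right hτκ hX0
  have h7 : 0 < (x - 2 * κ) / 2 * ∑' j, U j ^ 2 := mul_pos (by linarith) hpos
  linarith

end

/-- If the form of a Jacobi operator is positive on the sequences vanishing at `1`, then so is the
form of an operator below it, and both cannot have a kernel. -/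
lemma jacobi_kernel_unique {c d₁ d₂ : ℤ → ℝ} {M ρ p : ℝ} {U V : ℤ → ℝ}
    (hc : ∀ j, |c j| ≤ M) (hd₂ : ∀ j, |d₂ j| ≤ M)
    (hpos : ∀ W : ℤ → ℝ, Summable (fun j => W j ^ 2) → W 1 = 0 → W ≠ 0 →
      0 < ∑' j, jacobi c d₂ W j * W j)
    (hd : ∀ j, d₂ j = ρ * d₁ j + 2 * p) (hp : ∀ j, |c j * (1 - ρ)| < -p)
    (hU : Summable fun j => U j ^ 2) (hV : Summable fun j => V j ^ 2)
    (hJU : ∀ j, jacobi c d₁ U j = 0) (hJV : ∀ j, jacobi c d₂ V j = 0)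
    (hU0 : U ≠ 0) (hV0 : V ≠ 0) : False := by
  have hV1 : V 1 ≠ 0 := fun h => by
    have := hpos V hV h hV0
    simp [hJV] at this
  -- the form is negative at `U`
  have hneg : ∑' j, jacobi c d₂ U j * U j < 0 := by
    -- Subtracting `ρ` times the equation satisfied by `U` leaves a Jacobi operator with constant
    -- diagonal `2 p` and off-diagonal entries smaller than `-p` in modulus, which is negative by
    -- diagonal dominance.
    have e0 : ∀ j, jacobi c d₂ U j = jacobi (fun j => c j * (1 - ρ)) (fun _ => 2 * p) U j :=
      fun j => by
        have := hJU j
        simp only [jacobi] at this ⊢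
        rw [hd]
        linear_combination ρ * this
    have hp0 := hp 0
    have hp1 : 0 < -p := (abs_nonneg _).trans_lt hp0
    have hc' : ∀ j, |c j * (1 - ρ)| ≤ 2 * |p| := fun j => by
      have := hp j
      rw [abs_of_neg (by linarith : p < 0)]
      linarith
    have hpp : ∀ j : ℤ, |2 * p| ≤ 2 * |p| := fun j => by rw [abs_mul, abs_two]
    rw [tsum_congr fun j => by rw [e0 j], (hasSum_jacobi_mul hc' hpp hU hU).tsum_eq]
    have hUp := summable_sq_shift hU 1
    have s1 := hU.mul_left p
    have s1' : Summable fun j => p * U (j + 1) ^ 2 := hUp.mul_left p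
    have s2 := summable_bdd_mul hc' ((summable_mul_of_sq hUp hU).add (summable_mul_of_sq hU hUp))
    have e1 : ∑' j, (2 * p * (U j * U j)
          - c j * (1 - ρ) * (U (j + 1) * U j + U j * U (j + 1)))
        = ∑' j, (p * U j ^ 2 + p * U (j + 1) ^ 2
          - c j * (1 - ρ) * (U (j + 1) * U j + U j * U (j + 1))) := by
      have s0 : Summable fun j => 2 * p * (U j * U j) :=
        (summable_mul_of_sq hU hU).mul_left _
      rw [s0.tsum_sub s2, (s1.add s1').tsum_sub s2, s1.tsum_add s1',
        tsum_shift_sub (fun j => p * U j ^ 2) 1, ← s1.tsum_add s1]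
      congr 1
      exact tsum_congr fun j => by ring
    rw [e1]
    have hterm : ∀ j, p * U j ^ 2 + p * U (j + 1) ^ 2
          - c j * (1 - ρ) * (U (j + 1) * U j + U j * U (j + 1))
        ≤ -(-p - |c j * (1 - ρ)|) * U j ^ 2 := fun j => by
      have h1 := hp j
      have h2 := neg_abs_le (c j * (1 - ρ))
      have h3 := le_abs_self (c j * (1 - ρ))
      set y := c j * (1 - ρ)
      rcases le_total 0 y with hy | hy
      · rw [abs_of_nonneg hy] at *
        nlinarith [mul_nonneg hy (sq_nonneg (U j + U (j + 1))),
          mul_nonneg (sub_nonneg.2 h1.le) (sq_nonneg (U (j + 1)))]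
      · rw [abs_of_nonpos hy] at *
        nlinarith [mul_nonneg (neg_nonneg.2 hy) (sq_nonneg (U j - U (j + 1))),
          mul_nonneg (sub_nonneg.2 h1.le) (sq_nonneg (U (j + 1)))]
    obtain ⟨i, hi⟩ := Function.ne_iff.1 hU0
    have hi' : U i ≠ 0 := hi
    have hlt := Summable.tsum_lt_tsum (i := i) (fun j => (hterm j).trans (by
        have := hp j
        nlinarith [sq_nonneg (U j)] : _ ≤ (0 : ℝ))) ((hterm i).trans_lt (by
        have h1 := hp i
        have h2 : 0 < U i ^ 2 := by positivity
        nlinarith)) ((s1.add s1').sub s2) summable_zero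
    simpa using hlt
  -- The combination of `U` and `V` that vanishes at `1`. Since `V` is in the kernel, the form at
  -- `W` is `V 1 ^ 2` times the negative form at `U`; positivity forces `W = 0`, and then the form
  -- at `U` would be zero.
  set W : ℤ → ℝ := fun j => V 1 * U j - U 1 * V j with hW
  have hWs : Summable fun j => W j ^ 2 := by
    have := ((hU.mul_left (V 1 ^ 2)).add (hV.mul_left (U 1 ^ 2))).sub
      ((summable_mul_of_sq hU hV).mul_left (2 * (V 1 * U 1)))
    exact this.congr fun j => by simp only [hW]; ring
  have hJW : ∀ j, jacobi c d₂ W j = V 1 * jacobi c d₂ U j := fun j => by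
    have := hJV j
    simp only [jacobi, hW] at this ⊢
    linear_combination (-U 1) * this
  have hq : ∑' j, jacobi c d₂ W j * W j = V 1 ^ 2 * ∑' j, jacobi c d₂ U j * U j := by
    have h1 := hasSum_jacobi_mul hc hd₂ hU hU
    have h2 := hasSum_jacobi_mul hc hd₂ hU hV
    have h3 : ∑' j, jacobi c d₂ U j * V j = 0 := by
      rw [tsum_jacobi_mul_comm hc hd₂ hU hV]
      simp [hJV]
    have h4 := (h1.summable.hasSum.mul_left (V 1 ^ 2)).sub
      (h2.summable.hasSum.mul_left (V 1 * U 1))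
    rw [h3, mul_zero, sub_zero] at h4
    rw [← h4.tsum_eq]
    refine tsum_congr fun j => ?_
    rw [hJW]
    simp only [hW]
    ring
  have hW0 : W = 0 := by
    by_contra hne
    have h1 := hpos W hWs (by simp only [hW]; ring) hne
    rw [hq] at h1
    have h2 : 0 < V 1 ^ 2 := by positivity
    nlinarith
  rw [hW0] at hq
  have h2 : 0 < V 1 ^ 2 := by positivity
  simp only [Pi.zero_apply, mul_zero, tsum_zero] at hq
  nlinarith

/-! ### Jacobi operators on the line: existence -/

/-- The solution of the recurrence with values `μ` and `1` at `0` and `1`. -/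
def jacobiSol (c d : ℤ → ℝ) (μ : ℝ) : ℕ → ℝ
  | 0 => μ
  | 1 => 1
  | k + 2 => (d (k + 1) * jacobiSol c d μ (k + 1) - c k * jacobiSol c d μ k) / c (k + 1)

lemma jacobiSol_rec {c d : ℤ → ℝ} (μ : ℝ) {k : ℕ} (hc : c (k + 1) ≠ 0) :
    c (k + 1) * jacobiSol c d μ (k + 2)
      = d (k + 1) * jacobiSol c d μ (k + 1) - c k * jacobiSol c d μ k := by
  rw [jacobiSol]
  field_simp

/-- Used twice: for `ε → 0` at a fixed energy, and for continuity in the energy at a fixed `ε`. -/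
lemma tendsto_jacobiSol {ι : Type*} {l : Filter ι} {c d : ι → ℤ → ℝ} {μ : ι → ℝ}
    {c₀ d₀ : ℤ → ℝ} {μ₀ : ℝ} (hc : ∀ j, Tendsto (fun i => c i j) l (𝓝 (c₀ j)))
    (hd : ∀ j, Tendsto (fun i => d i j) l (𝓝 (d₀ j))) (hμ : Tendsto μ l (𝓝 μ₀))
    (hc₀ : ∀ j, c₀ j ≠ 0) (k : ℕ) :
    Tendsto (fun i => jacobiSol (c i) (d i) (μ i) k) l (𝓝 (jacobiSol c₀ d₀ μ₀ k)) := by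
  induction k using Nat.strong_induction_on with
  | _ k ih =>
    match k, ih with
    | 0, _ => simpa [jacobiSol] using hμ
    | 1, _ => simp only [jacobiSol]; exact tendsto_const_nhds
    | k + 2, ih =>
      simp only [jacobiSol]
      exact (((hd _).mul (ih (k + 1) (by omega))).sub ((hc _).mul (ih k (by omega)))).div
        (hc _) (hc₀ _)

/-- The initial values `μ` and `1` single out the solution `μ ^ (1 - k)` of the free recurrence,
which for `μ < 1` decays to the left and grows to the right. -/
lemma jacobiSol_const {κ μ : ℝ} (hκ : κ ≠ 0) (hμ : μ ≠ 0) (k : ℕ) :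
    jacobiSol (fun _ => κ) (fun _ => κ * (μ + μ⁻¹)) μ k * μ ^ k = μ := by
  induction k using Nat.strong_induction_on with
  | _ k ih =>
    match k, ih with
    | 0, _ => simp [jacobiSol]
    | 1, _ => simp [jacobiSol]
    | k + 2, ih =>
      have h1 := ih (k + 1) (by omega)
      have h0 := ih k (by omega)
      simp only [jacobiSol]
      have e : (κ * (μ + μ⁻¹) * jacobiSol (fun _ => κ) (fun _ => κ * (μ + μ⁻¹)) μ (k + 1)
          - κ * jacobiSol (fun _ => κ) (fun _ => κ * (μ + μ⁻¹)) μ k) / κ * μ ^ (k + 2)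
        = (μ ^ 2 + 1) * (jacobiSol (fun _ => κ) (fun _ => κ * (μ + μ⁻¹)) μ (k + 1) * μ ^ (k + 1))
          - μ ^ 2 * (jacobiSol (fun _ => κ) (fun _ => κ * (μ + μ⁻¹)) μ k * μ ^ k) := by
        field_simp
        ring
      rw [e, h1, h0]
      ring

/-- The recurrence says that the flux `c k (Y (k + 1) - Y k)` grows at each site by the potential `d
- c - c` times `Y`. It starts at zero for initial values `1, 1`, which is the case of the band edge.
-/
lemma jacobiSol_flux {c d : ℤ → ℝ} (hc : ∀ j, c j ≠ 0) (k : ℕ) :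
    c k * (jacobiSol c d 1 (k + 1) - jacobiSol c d 1 k)
      = ∑ i ∈ Finset.range k, (d (i + 1) - c (i + 1) - c i) * jacobiSol c d 1 (i + 1) := by
  induction k with
  | zero => simp [jacobiSol]
  | succ k ih =>
    rw [Finset.sum_range_succ, ← ih]
    have := jacobiSol_rec (c := c) (d := d) 1 (k := k) (hc _)
    push_cast
    linear_combination this

/-- The root in `(0, 1]` of `κ (μ + 1 / μ) = x`. -/
def decayRate (κ x : ℝ) : ℝ := (x - √(x ^ 2 - 4 * κ ^ 2)) / (2 * κ)

lemma continuous_decayRate (κ : ℝ) : Continuous (decayRate κ) := by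
  unfold decayRate
  fun_prop

lemma decayRate_edge {κ : ℝ} (hκ : 0 < κ) : decayRate κ (2 * κ) = 1 := by
  unfold decayRate
  rw [show (2 * κ) ^ 2 - 4 * κ ^ 2 = 0 by ring, Real.sqrt_zero, sub_zero, div_self (by positivity)]

lemma decayRate_spec {κ x : ℝ} (hκ : 0 < κ) (hx : 2 * κ < x) :
    0 < decayRate κ x ∧ decayRate κ x < 1 ∧ κ * (decayRate κ x + (decayRate κ x)⁻¹) = x := by
  have h0 : 0 < x ^ 2 - 4 * κ ^ 2 := by nlinarith
  have h1 := Real.sq_sqrt h0.le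
  have h2 := Real.sqrt_pos.2 h0
  set r := √(x ^ 2 - 4 * κ ^ 2) with hr
  have h3 : r < x := by
    have : r ^ 2 < x ^ 2 := by nlinarith
    exact lt_of_pow_lt_pow_left₀ 2 (by linarith) this
  have h4 : x - 2 * κ < r := by
    by_contra! hle
    nlinarith
  have hd : decayRate κ x = (x - r) / (2 * κ) := rfl
  have hpos : 0 < (x - r) / (2 * κ) := div_pos (by linarith) (by positivity)
  refine ⟨hd ▸ hpos, ?_, ?_⟩
  · rw [hd, div_lt_one (by positivity)]; linarith
  · rw [hd]
    have : x - r ≠ 0 := by linarith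
    field_simp
    nlinarith

lemma sum_range_eq_sum_Icc (g : ℤ → ℝ) (n : ℕ) :
    ∑ i ∈ Finset.range n, g (i + 1) = ∑ j ∈ Finset.Icc (1 : ℤ) n, g j := by
  induction n with
  | zero => simp
  | succ n ih =>
    rw [Finset.sum_range_succ, ih]
    have : Finset.Icc (1 : ℤ) ((n + 1 : ℕ) : ℤ) = insert ((n : ℤ) + 1) (Finset.Icc (1 : ℤ) n) := by
      ext j
      simp only [Finset.mem_Icc, Finset.mem_insert]
      push_cast
      omega
    rw [this, Finset.sum_insert (by simp), add_comm]

/-- A decaying solution on the whole line from a decaying solution on the right. -/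
lemma exists_kernel_of_match {c d : ℤ → ℝ} {κ x : ℝ} {n : ℕ} (hκ : 0 < κ) (hx : 2 * κ < x)
    (hc0 : ∀ j, c j ≠ 0) (hc : ∀ j, ¬(1 ≤ j ∧ j ≤ (n : ℤ)) → c j = κ)
    (hd : ∀ j, ¬(1 ≤ j ∧ j ≤ (n : ℤ)) → d j = x)
    (hm : jacobiSol c d (decayRate κ x) (n + 2)
      = decayRate κ x * jacobiSol c d (decayRate κ x) (n + 1)) :
    ∃ W : ℤ → ℝ, Summable (fun j => W j ^ 2) ∧ W ≠ 0 ∧ ∀ j, jacobi c d W j = 0 := by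
  obtain ⟨hμ0, hμ1, hμx⟩ := decayRate_spec hκ hx
  set μ := decayRate κ x with hμ
  set Y := jacobiSol c d μ with hY
  have hY0 : Y 0 = μ := rfl
  have hY1 : Y 1 = 1 := rfl
  -- Beyond the site `n` the coefficients are constant and `μ` is a root of the characteristic
  -- equation, so a single matching condition propagates to all later sites.
  have hdec : ∀ k : ℕ, Y (n + 1 + (k + 1)) = μ * Y (n + 1 + k) := by
    intro k
    induction k with
    | zero => exact hm
    | succ k ih =>
      have hr := jacobiSol_rec (c := c) (d := d) μ (k := n + 1 + k) (hc0 _)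
      rw [hc _ (by push_cast; omega), hc _ (by push_cast; omega), hd _ (by push_cast; omega)] at hr
      change κ * Y (n + 1 + (k + 1) + 1) = x * Y (n + 1 + (k + 1)) - κ * Y (n + 1 + k) at hr
      have h1 : Y (n + 1 + k) = μ⁻¹ * Y (n + 1 + (k + 1)) := by
        rw [ih, inv_mul_cancel_left₀ hμ0.ne']
      rw [h1, ← hμx] at hr
      have h2 : κ * Y (n + 1 + (k + 1) + 1) = κ * (μ * Y (n + 1 + (k + 1))) := by
        rw [hr]; ring
      exact mul_left_cancel₀ hκ.ne' h2
  have hpow : ∀ k : ℕ, Y (n + 1 + k) = μ ^ k * Y (n + 1) := by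
    intro k
    induction k with
    | zero => simp
    | succ k ih => rw [hdec, ih]; ring
  -- To the left the solution continues as `μ ^ (1 - j)`, in accordance with the values `μ` at `0`
  -- and `1` at `1`.
  set W : ℤ → ℝ := fun j => if 0 ≤ j then Y j.toNat else μ ^ (1 - j).toNat with hW
  have hWn : ∀ k : ℕ, W k = Y k := fun k => by simp [hW]
  have hWneg : ∀ k : ℕ, W (-k) = μ ^ (k + 1) := fun k => by
    rcases Nat.eq_zero_or_pos k with rfl | hk
    · simp [hW, hY0]
    · simp only [hW]
      rw [if_neg (by omega)]
      congr 1
      omega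
  have hμs : Summable fun k : ℕ => (μ ^ k) ^ 2 := by
    refine (summable_geometric_of_lt_one (sq_nonneg μ)
      (pow_lt_one₀ hμ0.le hμ1 two_ne_zero)).congr fun k => ?_
    rw [← pow_mul, ← pow_mul, mul_comm]
  refine ⟨W, ?_, fun h => ?_, fun j => ?_⟩
  · refine Summable.of_nat_of_neg ?_ ?_
    · rw [← summable_nat_add_iff (n + 1)]
      refine (hμs.mul_right (Y (n + 1) ^ 2)).congr fun k => ?_
      rw [hWn, add_comm k, hpow]
      ring
    · refine (hμs.mul_left (μ ^ 2)).congr fun k => ?_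
      rw [hWneg]
      ring
  · have h1 : W ((1 : ℕ) : ℤ) = 0 := by rw [h]; rfl
    rw [hWn, hY1] at h1
    exact one_ne_zero h1
  · rcases lt_trichotomy j 0 with hj | hj | hj
    · obtain ⟨k, rfl⟩ : ∃ k : ℕ, j = -((k : ℤ) + 1) := ⟨(-j - 1).toNat, by omega⟩
      have a1 : W (-((k : ℤ) + 1)) = μ ^ (k + 2) := by
        have := hWneg (k + 1)
        push_cast at this
        exact this
      have a2 : W (-((k : ℤ) + 1) + 1) = μ ^ (k + 1) := by
        rw [← hWneg k, neg_add, neg_add_cancel_right]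
      have a3 : W (-((k : ℤ) + 1) - 1) = μ ^ (k + 3) := by
        have := hWneg (k + 2)
        rw [← this]; congr 1
      simp only [jacobi]
      rw [a1, a2, a3, hc _ (by omega), hc _ (by omega), hd _ (by omega), ← hμx]
      field_simp
      ring
    · subst hj
      have a1 : W 0 = μ := hWn 0
      have a2 : W (0 + 1) = 1 := hWn 1
      have a3 : W (0 - 1) = μ ^ 2 := hWneg 1
      simp only [jacobi]
      rw [a1, a2, a3, hc _ (by omega), hc _ (by omega), hd _ (by omega), ← hμx]
      field_simp
      ring
    · obtain ⟨k, rfl⟩ : ∃ k : ℕ, j = (k : ℤ) + 1 := ⟨(j - 1).toNat, by omega⟩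
      have a1 : W ((k : ℤ) + 1) = Y (k + 1) := by exact_mod_cast hWn (k + 1)
      have a2 : W ((k : ℤ) + 1 + 1) = Y (k + 2) := by exact_mod_cast hWn (k + 2)
      have a3 : W ((k : ℤ) + 1 - 1) = Y k := by rw [add_sub_cancel_right]; exact hWn k
      have hr := jacobiSol_rec (c := c) (d := d) μ (k := k) (hc0 _)
      simp only [jacobi]
      rw [a1, a2, a3, add_sub_cancel_right]
      change c (k + 1) * Y (k + 2) = d (k + 1) * Y (k + 1) - c k * Y k at hr
      linarith

/-- Weak coupling: a kernel appears near the edge `x = 2 κ` of the essential spectrum. -/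
theorem exists_kernel_weak_coupling {κ : ℝ} (hκ : 0 < κ) {n : ℕ} {x s : ℝ → ℝ} {β : ℤ → ℝ}
    {c : ℝ → ℤ → ℝ} {c' : ℤ → ℝ} {E₀ E₁ : ℝ} (hx : Continuous x) (hs : Continuous s)
    (hc : ∀ ε j, ¬(1 ≤ j ∧ j ≤ (n : ℤ)) → c ε j = κ) (hc0 : ∀ j, c 0 j = κ)
    (hc' : ∀ j, HasDerivAt (fun ε => c ε j) (c' j) 0)
    (hsum' : ∑ j ∈ Finset.Icc (1 : ℤ) n, c' j = 0)
    (hβ : ∀ j, ¬(1 ≤ j ∧ j ≤ (n : ℤ)) → β j = 0)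
    (hsumβ : ∑ j ∈ Finset.Icc (1 : ℤ) n, β j < 0)
    (hx₀ : x E₀ = 2 * κ) (hs₀ : 0 < s E₀)
    (hx₁ : ∀ E ∈ uIcc E₁ E₀, E ≠ E₀ → 2 * κ < x E) (hE : E₁ ≠ E₀) :
    ∀ᶠ ε in 𝓝[>] (0 : ℝ), ∃ E ∈ uIcc E₁ E₀, E ≠ E₀ ∧ ∃ W : ℤ → ℝ,
      Summable (fun j => W j ^ 2) ∧ W ≠ 0 ∧
      ∀ j, jacobi (c ε) (fun j => x E + ε * (β j * s E)) W j = 0 := by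
  have hc'0 : ∀ j, ¬(1 ≤ j ∧ j ≤ (n : ℤ)) → c' j = 0 := fun j hj => by
    have h1 := hc' j
    have h2 : (fun ε => c ε j) = fun _ => κ := funext fun ε => hc ε j hj
    rw [h2] at h1
    exact h1.unique (hasDerivAt_const 0 κ)
  have hcl : ∀ j, Tendsto (fun ε => c ε j) (𝓝[>] 0) (𝓝 κ) := fun j => by
    have := (hc' j).continuousAt.tendsto
    rw [hc0] at this
    exact this.mono_left nhdsWithin_le_nhds
  have hid : Tendsto (fun ε : ℝ => ε) (𝓝[>] 0) (𝓝 0) := tendsto_id.mono_left nhdsWithin_le_nhds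
  set d : ℝ → ℝ → ℤ → ℝ := fun ε E j => x E + ε * (β j * s E) with hd
  have hdl : ∀ E j, Tendsto (fun ε => d ε E j) (𝓝[>] 0) (𝓝 (x E)) := fun E j => by
    have := (hid.mul_const (β j * s E)).const_add (x E)
    simpa using this
  -- The mismatch, to the right of the perturbed sites, between the solution decaying at `-∞` and
  -- the ratio required for decay at `+∞`. Its zeros inside the gap give kernel elements.
  set F : ℝ → ℝ → ℝ := fun ε E => jacobiSol (c ε) (d ε E) (decayRate κ (x E)) (n + 2)
    - decayRate κ (x E) * jacobiSol (c ε) (d ε E) (decayRate κ (x E)) (n + 1) with hF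
  have hκ0 : κ ≠ 0 := hκ.ne'
  have hYl : ∀ E k, Tendsto (fun ε => jacobiSol (c ε) (d ε E) (decayRate κ (x E)) k) (𝓝[>] 0)
      (𝓝 (jacobiSol (fun _ => κ) (fun _ => x E) (decayRate κ (x E)) k)) := fun E k =>
    tendsto_jacobiSol hcl (hdl E) tendsto_const_nhds (fun _ => hκ0) k
  -- the sign inside the gap
  have hpos : ∀ᶠ ε in 𝓝[>] (0 : ℝ), 0 < F ε E₁ := by
    obtain ⟨h1, h2, h3⟩ := decayRate_spec hκ (hx₁ E₁ left_mem_uIcc hE)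
    have hl := (hYl E₁ (n + 2)).sub ((hYl E₁ (n + 1)).const_mul (decayRate κ (x E₁)))
    refine hl.eventually (lt_mem_nhds ?_)
    set μ := decayRate κ (x E₁)
    rw [← h3]
    have e2 := jacobiSol_const hκ0 h1.ne' (n + 2)
    have e1 := jacobiSol_const hκ0 h1.ne' (n + 1)
    -- For the free recurrence the mismatch times `μ ^ (n + 2)` is `μ - μ ^ 3`, which is positive
    -- because `0 < μ < 1`.
    refine pos_of_mul_pos_left (b := μ ^ (n + 2)) ?_ (by positivity)
    have e3 : (jacobiSol (fun _ => κ) (fun _ => κ * (μ + μ⁻¹)) μ (n + 2)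
        - μ * jacobiSol (fun _ => κ) (fun _ => κ * (μ + μ⁻¹)) μ (n + 1)) * μ ^ (n + 2)
        = jacobiSol (fun _ => κ) (fun _ => κ * (μ + μ⁻¹)) μ (n + 2) * μ ^ (n + 2)
        - μ ^ 2 * (jacobiSol (fun _ => κ) (fun _ => κ * (μ + μ⁻¹)) μ (n + 1) * μ ^ (n + 1)) := by
      ring
    rw [e3, e2, e1]
    nlinarith [mul_pos h1 h1]
  have hcne : ∀ᶠ ε in 𝓝[>] (0 : ℝ), ∀ j, c ε j ≠ 0 := by
    have : ∀ᶠ ε in 𝓝[>] (0 : ℝ), ∀ j ∈ Finset.Icc (1 : ℤ) n, c ε j ≠ 0 :=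
      (Finset.eventually_all _).2 fun j _ => (hcl j).eventually_ne hκ0
    filter_upwards [this] with ε h j
    by_cases hj : 1 ≤ j ∧ j ≤ (n : ℤ)
    · exact h j (Finset.mem_Icc.2 hj)
    · rw [hc ε j hj]; exact hκ0
  -- the sign at the edge
  have hneg : ∀ᶠ ε in 𝓝[>] (0 : ℝ), F ε E₀ < 0 := by
    have hμ : decayRate κ (x E₀) = 1 := by rw [hx₀, decayRate_edge hκ]
    have hslope : ∀ j, Tendsto (fun ε => (κ - c ε j) / ε) (𝓝[>] 0) (𝓝 (-c' j)) := fun j => by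
      have h1 := (hasDerivAt_iff_tendsto_slope.1 (hc' j)).mono_left
        (nhdsWithin_mono 0 (show Ioi (0 : ℝ) ⊆ {0}ᶜ from fun y hy => ne_of_gt hy))
      refine h1.neg.congr fun ε => ?_
      rw [slope_def_field, hc0, sub_zero, ← neg_div, neg_sub]
    have hone : ∀ k, jacobiSol (fun _ => κ) (fun _ => x E₀) 1 k = 1 := fun k => by
      have := jacobiSol_const hκ0 (one_ne_zero (α := ℝ)) k
      rw [one_pow, mul_one, show κ * (1 + (1 : ℝ)⁻¹) = x E₀ by rw [hx₀]; ring] at this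
      exact this
    have hY1 : ∀ k, Tendsto (fun ε => jacobiSol (c ε) (d ε E₀) 1 k) (𝓝[>] 0) (𝓝 1) := fun k => by
      have := hYl E₀ k
      rwa [hμ, hone] at this
    have hlim : Tendsto (fun ε => ∑ i ∈ Finset.range (n + 1),
        (β (i + 1) * s E₀ + (κ - c ε (i + 1)) / ε + (κ - c ε i) / ε)
          * jacobiSol (c ε) (d ε E₀) 1 (i + 1)) (𝓝[>] 0)
        (𝓝 (∑ i ∈ Finset.range (n + 1),
          (β ((i : ℤ) + 1) * s E₀ + -c' ((i : ℤ) + 1) + -c' (i : ℤ)) * 1)) :=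
      tendsto_finsetSum _ fun i _ =>
        (((hslope _).const_add _).add (hslope _)).mul (hY1 _)
    -- Each bond is adjacent to two sites, so the derivatives `c'` enter twice, with a shift. Both
    -- sums vanish, and only the diagonal survives to first order. The site `n + 1` is included
    -- because its left bond is perturbed.
    have hval : ∑ i ∈ Finset.range (n + 1),
          (β ((i : ℤ) + 1) * s E₀ + -c' ((i : ℤ) + 1) + -c' (i : ℤ)) * 1
        = (∑ j ∈ Finset.Icc (1 : ℤ) n, β j) * s E₀ := by
      simp only [mul_one, Finset.sum_add_distrib, Finset.sum_neg_distrib, ← Finset.sum_mul]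
      have a1 : ∑ i ∈ Finset.range (n + 1), β ((i : ℤ) + 1) = ∑ j ∈ Finset.Icc (1 : ℤ) n, β j := by
        rw [Finset.sum_range_succ, sum_range_eq_sum_Icc, hβ _ (by omega), add_zero]
      have a2 : ∑ i ∈ Finset.range (n + 1), c' ((i : ℤ) + 1) = 0 := by
        rw [Finset.sum_range_succ, sum_range_eq_sum_Icc, hc'0 _ (by omega), add_zero, hsum']
      have a3 : ∑ i ∈ Finset.range (n + 1), c' (i : ℤ) = 0 := by
        rw [Finset.sum_range_succ']
        push_cast
        rw [sum_range_eq_sum_Icc, hsum', hc'0 _ (by omega), add_zero]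
      rw [a1, a2, a3]
      ring
    rw [hval] at hlim
    filter_upwards [hlim.eventually (gt_mem_nhds (mul_neg_of_neg_of_pos hsumβ hs₀)), hcne,
      self_mem_nhdsWithin] with ε h1 h2 h3
    have hε : (0 : ℝ) < ε := h3
    have hflux := jacobiSol_flux (d := d ε E₀) h2 (n + 1)
    have hcn : c ε ((n + 1 : ℕ) : ℤ) = κ := hc _ _ (by push_cast; omega)
    rw [hcn] at hflux
    have hmul : ∑ i ∈ Finset.range (n + 1), (d ε E₀ (i + 1) - c ε (i + 1) - c ε i)
          * jacobiSol (c ε) (d ε E₀) 1 (i + 1)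
        = ε * ∑ i ∈ Finset.range (n + 1),
        (β (i + 1) * s E₀ + (κ - c ε (i + 1)) / ε + (κ - c ε i) / ε)
          * jacobiSol (c ε) (d ε E₀) 1 (i + 1) := by
      rw [Finset.mul_sum]
      refine Finset.sum_congr rfl fun i _ => ?_
      simp only [hd, hx₀]
      field_simp
      ring
    rw [hmul] at hflux
    have h4 : κ * F ε E₀ < 0 := by
      simp only [hF, hμ, one_mul]
      rw [hflux]
      exact mul_neg_of_pos_of_neg hε h1
    by_contra! h5
    exact absurd h4 (not_lt.2 (mul_nonneg hκ.le h5))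
  filter_upwards [hpos, hneg, hcne] with ε h1 h2 h3
  have hcont : Continuous (F ε) := by
    rw [continuous_iff_continuousAt]
    intro E
    have hμc : Tendsto (fun E => decayRate κ (x E)) (𝓝 E) (𝓝 (decayRate κ (x E))) :=
      ((continuous_decayRate κ).comp hx).tendsto E
    have hdc : ∀ j, Tendsto (fun E => d ε E j) (𝓝 E) (𝓝 (d ε E j)) := fun j =>
      (hx.add (continuous_const.mul (continuous_const.mul hs))).tendsto E
    have hY := tendsto_jacobiSol (c := fun _ => c ε) (fun j => tendsto_const_nhds) hdc hμc h3
    exact (hY (n + 2)).sub (hμc.mul (hY (n + 1)))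
  obtain ⟨E, hEm, hE0⟩ := intermediate_value_uIcc hcont.continuousOn
    (show (0 : ℝ) ∈ uIcc (F ε E₁) (F ε E₀) from Icc_subset_uIcc' ⟨h2.le, h1.le⟩)
  have hne : E ≠ E₀ := fun h => by
    rw [h] at hE0
    linarith
  refine ⟨E, hEm, hne, ?_⟩
  refine exists_kernel_of_match hκ (hx₁ E hEm hne) h3 (hc ε) (fun j hj => ?_)
    (sub_eq_zero.1 hE0)
  rw [hβ j hj]
  ring

/-! ### Dependence of the fundamental solutions on the energy -/

lemma cosPi_sq_add (E : ℝ) : cosPi E ^ 2 + E * sinPi E ^ 2 = 1 := cosE_sq_add E Real.pi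

lemma hasDerivAt_cosPi {E : ℝ} (hE : E ≠ 0) : HasDerivAt cosPi (-(Real.pi / 2) * sinPi E) E := by
  rcases hE.lt_or_gt with h | h
  · have hq : 0 < √(-E) := Real.sqrt_pos.2 (neg_pos.2 h)
    have h1 : HasDerivAt (fun x : ℝ => √(-x)) (-1 / (2 * √(-E))) E :=
      (hasDerivAt_neg E).sqrt (neg_ne_zero.2 hE)
    have h2 := (h1.mul_const Real.pi).cosh
    have h3 := sqrt_neg_mul_sinE h.le Real.pi
    rw [← h3] at h2
    refine (h2.congr_of_eventuallyEq ?_).congr_deriv ?_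
    · filter_upwards [Iio_mem_nhds h] with x hx
      exact cosE_of_nonpos (le_of_lt hx) _
    · change _ = -(Real.pi / 2) * sinE E Real.pi
      field_simp
  · have hq : 0 < √E := Real.sqrt_pos.2 h
    have h2 := ((Real.hasDerivAt_sqrt hE).mul_const Real.pi).cos
    have h3 := sqrt_mul_sinE h.le Real.pi
    rw [← h3] at h2
    refine (h2.congr_of_eventuallyEq ?_).congr_deriv ?_
    · filter_upwards [Ioi_mem_nhds h] with x hx
      exact cosE_of_nonneg (le_of_lt hx) _
    · change _ = -(Real.pi / 2) * sinE E Real.pi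
      field_simp

lemma hasDerivAt_sinPi {E : ℝ} (hE : E ≠ 0) :
    HasDerivAt sinPi ((Real.pi * cosPi E - sinPi E) / (2 * E)) E := by
  rcases hE.lt_or_gt with h | h
  · have hq : 0 < √(-E) := Real.sqrt_pos.2 (neg_pos.2 h)
    have hqq := Real.sq_sqrt (neg_pos.2 h).le
    have h1 : HasDerivAt (fun x : ℝ => √(-x)) (-1 / (2 * √(-E))) E :=
      (hasDerivAt_neg E).sqrt (neg_ne_zero.2 hE)
    have h2 := (h1.mul_const Real.pi).sinh.div h1 hq.ne'
    have h3 := sqrt_neg_mul_sinE h.le Real.pi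
    have h4 := cosE_of_nonpos h.le Real.pi
    rw [← h3, ← h4] at h2
    refine (h2.congr_of_eventuallyEq ?_).congr_deriv ?_
    · filter_upwards [Iio_mem_nhds h] with x hx
      have hx0 : 0 < √(-x) := Real.sqrt_pos.2 (neg_pos.2 hx)
      rw [Pi.div_apply, ← sqrt_neg_mul_sinE (le_of_lt hx), mul_div_cancel_left₀ _ hx0.ne']
      rfl
    · change _ = (Real.pi * cosE E Real.pi - sinE E Real.pi) / (2 * E)
      have hE' : E = -√(-E) ^ 2 := by rw [hqq, neg_neg]
      generalize cosE E Real.pi = C at *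
      generalize sinE E Real.pi = S at *
      set q := √(-E)
      rw [hE']
      field_simp
      ring
  · have hq : 0 < √E := Real.sqrt_pos.2 h
    have hqq := Real.sq_sqrt h.le
    have h2 := ((Real.hasDerivAt_sqrt hE).mul_const Real.pi).sin.div (Real.hasDerivAt_sqrt hE) hq.ne'
    have h3 := sqrt_mul_sinE h.le Real.pi
    have h4 := cosE_of_nonneg h.le Real.pi
    rw [← h3, ← h4] at h2
    refine (h2.congr_of_eventuallyEq ?_).congr_deriv ?_
    · filter_upwards [Ioi_mem_nhds h] with x hx
      have hx0 : 0 < √x := Real.sqrt_pos.2 hx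
      rw [Pi.div_apply, ← sqrt_mul_sinE (le_of_lt hx), mul_div_cancel_left₀ _ hx0.ne']
      rfl
    · change _ = (Real.pi * cosE E Real.pi - sinE E Real.pi) / (2 * E)
      have hE' : E = √E ^ 2 := hqq.symm
      generalize cosE E Real.pi = C at *
      generalize sinE E Real.pi = S at *
      set q := √E
      rw [hE']
      field_simp

lemma abs_cosPi_le {E : ℝ} (hE : 0 ≤ E) : |cosPi E| ≤ 1 := by
  rw [cosPi, cosE_of_nonneg hE]
  exact Real.abs_cos_le_one _

lemma one_le_cosPi {E : ℝ} (hE : E ≤ 0) : 1 ≤ cosPi E := by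
  rw [cosPi, cosE_of_nonpos hE]
  exact Real.one_le_cosh _

lemma sinPi_zero : sinPi 0 = Real.pi := by simp [sinPi, sinE, cosE]

lemma abs_sinPi_lt {E : ℝ} (hE : 0 < E) : |sinPi E| < Real.pi := by
  have hq : 0 < √E := Real.sqrt_pos.2 hE
  have h := sqrt_mul_sinE hE.le Real.pi
  have h2 : |Real.sin (√E * Real.pi)| < √E * Real.pi := by
    have := Real.abs_sin_lt_abs (mul_pos hq Real.pi_pos).ne'
    rwa [abs_of_pos (mul_pos hq Real.pi_pos)] at this
  rw [← h, abs_mul, abs_of_pos hq] at h2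
  exact lt_of_mul_lt_mul_left h2 hq.le

lemma pi_lt_sinPi {E : ℝ} (hE : E < 0) : Real.pi < sinPi E := by
  have hq : 0 < √(-E) := Real.sqrt_pos.2 (neg_pos.2 hE)
  have h := sqrt_neg_mul_sinE hE.le Real.pi
  have h2 := Real.self_lt_sinh_iff.2 (mul_pos hq Real.pi_pos)
  rw [← h] at h2
  exact lt_of_mul_lt_mul_left h2 hq.le

lemma sqrt_mul_sinPi_le_cosPi {E : ℝ} (hE : E ≤ 0) : √(-E) * sinPi E ≤ cosPi E := by
  rw [sinPi, sqrt_neg_mul_sinE hE, cosPi, cosE_of_nonpos hE]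
  exact (Real.sinh_lt_cosh _).le

/-- `(cosPi E - c) / sinPi E` has a negative derivative. -/
lemma exists_hasDerivAt_ratio_neg {E c : ℝ} (hE : E ≠ 0) (hS : sinPi E ≠ 0) (hc : |c| < 1) :
    ∃ y < 0, HasDerivAt (fun E => (cosPi E - c) / sinPi E) y E := by
  refine ⟨_, ?_, ((hasDerivAt_cosPi hE).sub_const c).div (hasDerivAt_sinPi hE) hS⟩
  refine div_neg_of_neg_of_pos ?_ (by positivity)
  have hCS := cosPi_sq_add E
  obtain ⟨hc1, hc2⟩ := abs_lt.1 hc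
  -- The identity `cosPi² + E sinPi² = 1` removes the squares. The sign then follows from `cosPi ≥
  -- 1` and `sinPi > π` for `E < 0`, and from `|cosPi| ≤ 1` and `|sinPi| < π` for `E > 0`.
  have key : -(Real.pi / 2) * sinPi E * sinPi E
      - (cosPi E - c) * ((Real.pi * cosPi E - sinPi E) / (2 * E))
      = ((cosPi E - c) * sinPi E - Real.pi * (1 - c * cosPi E)) / (2 * E) := by
    field_simp
    linear_combination (-Real.pi) * hCS
  rw [key]
  rcases hE.lt_or_gt with h | h
  · refine div_neg_of_pos_of_neg ?_ (by linarith)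
    have h1 := one_le_cosPi h.le
    have h2 := pi_lt_sinPi h
    have h3 : 0 < (cosPi E - c) * (sinPi E - Real.pi) := mul_pos (by linarith) (by linarith)
    have h4 : 0 ≤ Real.pi * ((cosPi E - 1) * (1 + c)) :=
      mul_nonneg Real.pi_pos.le (mul_nonneg (by linarith) (by linarith))
    nlinarith
  · refine div_neg_of_neg_of_pos ?_ (by linarith)
    have h1 := abs_le.1 (abs_cosPi_le h.le)
    have h2 := abs_sinPi_lt h
    have h3 : |cosPi E - c| ≤ 1 - c * cosPi E := by
      rw [abs_le]
      constructor <;> nlinarith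
    have h4 : 0 < 1 - c * cosPi E := by
      have : |c * cosPi E| < 1 := by
        rw [abs_mul]
        exact mul_lt_one_of_nonneg_of_lt_one_left (abs_nonneg _) hc (abs_le.2 h1)
      linarith [(abs_lt.1 this).2]
    have h5 : (cosPi E - c) * sinPi E ≤ (1 - c * cosPi E) * |sinPi E| := by
      refine (le_abs_self _).trans ?_
      rw [abs_mul]
      exact mul_le_mul_of_nonneg_right h3 (abs_nonneg _)
    have h6 := mul_lt_mul_of_pos_left h2 h4
    linarith

/-! ### The intervals between the squares -/

/-- The interval from `r ^ 2` (from `-∞` if `r = 0`) to `(r + 1) ^ 2`. -/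
def cell (r : ℕ) : Set ℝ := {E | (r ≠ 0 → (r : ℝ) ^ 2 < E) ∧ E < ((r : ℝ) + 1) ^ 2}

lemma cell_mem_of_le {r : ℕ} {a b E : ℝ} (ha : a ∈ cell r) (hb : b ∈ cell r) (h1 : a ≤ E)
    (h2 : E ≤ b) : E ∈ cell r :=
  ⟨fun h => (ha.1 h).trans_le h1, h2.trans_lt hb.2⟩

lemma sinPi_pos_of_lt_one {E : ℝ} (hE : E < 1) : 0 < sinPi E := by
  rcases lt_trichotomy E 0 with h | h | h
  · exact Real.pi_pos.trans (pi_lt_sinPi h)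
  · rw [h, sinPi_zero]; exact Real.pi_pos
  · have hq : 0 < √E := Real.sqrt_pos.2 h
    have hq1 : √E < 1 := by rw [Real.sqrt_lt' one_pos]; simpa using hE
    have h1 := sqrt_mul_sinE h.le Real.pi
    have h2 := Real.sin_pos_of_pos_of_lt_pi (mul_pos hq Real.pi_pos)
      (by nlinarith [Real.pi_pos])
    rw [← h1] at h2
    exact pos_of_mul_pos_right h2 hq.le

lemma sinPi_sign {r : ℕ} {E : ℝ} (hE : E ∈ cell r) : 0 < (-1) ^ r * sinPi E := by
  rcases Nat.eq_zero_or_pos r with rfl | hr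
  · have := hE.2
    simp only [CharP.cast_eq_zero, zero_add, one_pow] at this
    simpa using sinPi_pos_of_lt_one this
  · have h1 := hE.1 hr.ne'
    have h0 : 0 < E := lt_of_le_of_lt (sq_nonneg _) h1
    have hq : 0 < √E := Real.sqrt_pos.2 h0
    have hq1 : (r : ℝ) < √E := Real.lt_sqrt_of_sq_lt h1
    have hq2 : √E < r + 1 := (Real.sqrt_lt' (by positivity)).2 hE.2
    have h3 : √E * ((-1) ^ r * sinPi E) = Real.sin ((√E - r) * Real.pi) := by
      rw [sub_mul, Real.sin_sub_nat_mul_pi, ← sqrt_mul_sinE h0.le, sinPi]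
      ring
    have h4 := Real.sin_pos_of_pos_of_lt_pi (mul_pos (sub_pos.2 hq1) Real.pi_pos)
      (by nlinarith [Real.pi_pos])
    rw [← h3] at h4
    exact pos_of_mul_pos_right h4 hq.le

lemma sinPi_ne_zero {r : ℕ} {E : ℝ} (hE : E ∈ cell r) : sinPi E ≠ 0 := fun h => by
  have := sinPi_sign hE
  simp [h] at this

lemma sinPi_sq {r : ℕ} (hr : r ≠ 0) : sinPi ((r : ℝ) ^ 2) = 0 := by
  have h := sqrt_mul_sinE (sq_nonneg (r : ℝ)) Real.pi
  rw [Real.sqrt_sq (Nat.cast_nonneg r), Real.sin_nat_mul_pi] at h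
  exact (mul_eq_zero.1 h).resolve_left (Nat.cast_ne_zero.2 hr)

lemma cosPi_sq (r : ℕ) : cosPi ((r : ℝ) ^ 2) = (-1) ^ r := by
  rw [cosPi, cosE_of_nonneg (sq_nonneg _), Real.sqrt_sq (Nat.cast_nonneg r), Real.cos_nat_mul_pi]

/-- Every energy is in a cell or a square. -/
lemma exists_cell (E : ℝ) : (∃ r, E ∈ cell r) ∨ ∃ r : ℕ, r ≠ 0 ∧ E = (r : ℝ) ^ 2 := by
  have hex : ∃ r : ℕ, E < ((r : ℝ) + 1) ^ 2 := by
    obtain ⟨r, hr⟩ := exists_nat_gt E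
    exact ⟨r, hr.trans_le (by nlinarith [(Nat.cast_nonneg r : (0 : ℝ) ≤ r)])⟩
  classical
  have h1 := Nat.find_spec hex
  have h2 := fun k => Nat.find_min hex (m := k)
  generalize Nat.find hex = r at h1 h2
  rcases Nat.eq_zero_or_pos r with rfl | hr
  · exact Or.inl ⟨0, fun h => absurd rfl h, h1⟩
  · have h3 := not_lt.1 (h2 (r - 1) (by omega))
    rw [Nat.cast_sub hr, Nat.cast_one, sub_add_cancel] at h3
    rcases h3.lt_or_eq with h4 | h4
    · exact Or.inl ⟨r, fun _ => h4, h1⟩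
    · exact Or.inr ⟨r, hr.ne', h4.symm⟩

/-- The derivative is negative throughout the cell except that its formula fails at `E = 0`; the
lowest cell is therefore cut at `0`, and the two pieces are joined by continuity. -/
theorem ratio_strictAntiOn {c : ℝ} (hc : |c| < 1) (r : ℕ) :
    StrictAntiOn (fun E => (cosPi E - c) / sinPi E) (cell r) := by
  have hcont : ContinuousOn (fun E => (cosPi E - c) / sinPi E) (cell r) :=
    (continuous_cosPi.sub continuous_const).continuousOn.div continuous_sinPi.continuousOn
      fun E hE => sinPi_ne_zero hE
  have hder : ∀ E ∈ cell r, E ≠ 0 → deriv (fun E => (cosPi E - c) / sinPi E) E < 0 :=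
    fun E hE h0 => by
      obtain ⟨y, hy, h⟩ := exists_hasDerivAt_ratio_neg h0 (sinPi_ne_zero hE) hc
      rwa [h.deriv]
  rcases Nat.eq_zero_or_pos r with rfl | hr
  · have e : cell 0 = Iic 0 ∪ Ico 0 1 := by
      rw [Iic_union_Ico_eq_Iio zero_lt_one]
      ext E
      simp [cell]
    have h1 : Iic (0 : ℝ) ⊆ cell 0 := e ▸ subset_union_left
    have h2 : Ico (0 : ℝ) 1 ⊆ cell 0 := e ▸ subset_union_right
    rw [e]
    refine StrictAntiOn.union (c := 0) ?_ ?_ isGreatest_Iic (isLeast_Ico zero_lt_one)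
    · refine strictAntiOn_of_deriv_neg (convex_Iic 0) (hcont.mono h1) fun E hE => ?_
      rw [interior_Iic] at hE
      exact hder E (h1 (show E ≤ 0 from le_of_lt hE)) (ne_of_lt hE)
    · refine strictAntiOn_of_deriv_neg (convex_Ico 0 1) (hcont.mono h2) fun E hE => ?_
      rw [interior_Ico] at hE
      exact hder E (h2 (Ioo_subset_Ico_self hE)) (ne_of_gt hE.1)
  · refine strictAntiOn_of_deriv_neg ?_ hcont fun E hE => hder E (interior_subset hE) ?_
    · have : cell r = Ioo ((r : ℝ) ^ 2) (((r : ℝ) + 1) ^ 2) := by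
        ext E
        simp [cell, hr.ne']
      rw [this]
      exact convex_Ioo _ _
    · exact (lt_of_le_of_lt (sq_nonneg _) ((interior_subset hE).1 hr.ne')).ne'

lemma continuous_eta (a : ℝ) : Continuous (eta a) := by
  unfold eta
  exact (continuous_const.mul continuous_cosPi).add (continuous_const.mul continuous_sinPi)

lemma neg_one_pow_mul_self (r : ℕ) : ((-1 : ℝ)) ^ r * (-1) ^ r = 1 := by
  rw [← mul_pow]; simp

/-- Intermediate values: `(-1) ^ r * η` equals `-2` at the right end of the cell and, for `r ≠ 0`,
equals `2` at the left end. The lowest cell has no left end, and a sufficiently negative energy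
takes its place. -/
lemma exists_eta_eq (a : ℝ) (r : ℕ) {y : ℝ} (hy : -2 < y) (hy' : y < 2) :
    ∃ E ∈ cell r, (-1) ^ r * eta a E = y := by
  have hR : (-1) ^ r * eta a (((r : ℝ) + 1) ^ 2) = -2 := by
    have h1 := sinPi_sq (Nat.succ_ne_zero r)
    have h2 := cosPi_sq (r + 1)
    push_cast at h1 h2
    rw [eta, h1, h2, pow_succ]
    linear_combination (-2) * neg_one_pow_mul_self r
  obtain ⟨b, hb1, hb2, hb3⟩ : ∃ b : ℝ, (r ≠ 0 → (r : ℝ) ^ 2 ≤ b) ∧ b < ((r : ℝ) + 1) ^ 2 ∧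
      y < (-1) ^ r * eta a b := by
    rcases Nat.eq_zero_or_pos r with rfl | hr
    · have hq : 0 < (|a| + 1) / (2 - y) := div_pos (by positivity) (by linarith)
      -- Chosen so that `|a| ≤ q (2 - y)`. With `q sinPi ≤ cosPi` and `1 ≤ cosPi` at the energy `-q
      -- ^ 2`, the coupling term cannot push `η` down to `y`.
      set q := (|a| + 1) / (2 - y) with hqd
      have hE : -q ^ 2 ≤ 0 := by nlinarith
      refine ⟨-q ^ 2, fun h => absurd rfl h, by simp; nlinarith, ?_⟩
      have h1 := sqrt_mul_sinPi_le_cosPi hE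
      have h2 := one_le_cosPi hE
      have h3 : 0 ≤ sinPi (-q ^ 2) := (sinPi_pos_of_lt_one (by linarith)).le
      rw [neg_neg, Real.sqrt_sq hq.le] at h1
      have h4 : |a| ≤ q * (2 - y) := by
        rw [hqd, div_mul_cancel₀ _ (by linarith)]
        linarith
      rw [pow_zero, one_mul, eta]
      generalize cosPi (-q ^ 2) = C at *
      generalize sinPi (-q ^ 2) = S at *
      have h5 : -(|a| * S) ≤ a * S := by nlinarith [neg_abs_le a]
      have h6 : |a| * S ≤ C * (2 - y) := by nlinarith
      nlinarith
    · refine ⟨(r : ℝ) ^ 2, fun _ => le_rfl, by nlinarith [(Nat.cast_nonneg r : (0 : ℝ) ≤ r)], ?_⟩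
      rw [eta, sinPi_sq hr.ne', cosPi_sq]
      linarith [neg_one_pow_mul_self r]
  obtain ⟨E, hE, hEy⟩ := intermediate_value_Ioo' hb2.le
    (continuous_const.mul (continuous_eta a)).continuousOn
    (show y ∈ Ioo ((-1) ^ r * eta a (((r : ℝ) + 1) ^ 2)) ((-1) ^ r * eta a b) from
      ⟨by rw [hR]; exact hy, hb3⟩)
  exact ⟨E, ⟨fun h => (hb1 h).trans_lt hE.1, hE.2⟩, hEy⟩

/-- The perturbation of the diagonal is proportional to `sinPi`, which is unbounded in the lowest
gap. Comparison with `η` there makes the smallness condition on `ε` uniform over the whole gap: for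
very negative `E` the term `cosPi` outweighs `(|a| + 1) sinPi`. -/
lemma exists_abs_sinPi_le (a : ℝ) : ∃ K, 0 < K ∧ ∀ E, |sinPi E| ≤ K * (1 + |eta a E|) := by
  obtain ⟨M, hM⟩ := (isCompact_Icc (a := -(|a| + 1) ^ 2) (b := 0)).exists_bound_of_continuousOn
    continuous_sinPi.continuousOn
  have hM0 : 0 ≤ M := (norm_nonneg _).trans (hM 0 ⟨by nlinarith [abs_nonneg a], le_rfl⟩)
  have hπ := Real.pi_pos
  refine ⟨M + Real.pi + 1, by positivity, fun E => ?_⟩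
  have hη := abs_nonneg (eta a E)
  rcases lt_or_ge 0 E with h | h
  · have := abs_sinPi_lt h
    nlinarith
  rcases le_or_gt (-(|a| + 1) ^ 2) E with h' | h'
  · have := hM E ⟨h', h⟩
    rw [Real.norm_eq_abs] at this
    nlinarith
  · have hS := sinPi_pos_of_lt_one (show E < 1 by linarith)
    have hq : |a| + 1 ≤ √(-E) := Real.le_sqrt_of_sq_le (by linarith)
    have h1 := sqrt_mul_sinPi_le_cosPi h
    have h2 : (|a| + 1) * sinPi E ≤ cosPi E := (mul_le_mul_of_nonneg_right hq hS.le).trans h1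
    have h3 := le_abs_self (eta a E)
    have h4 : -(|a| * sinPi E) ≤ a * sinPi E := by nlinarith [neg_abs_le a]
    rw [abs_of_pos hS]
    have h5 : sinPi E ≤ eta a E := by
      rw [eta]
      have : 0 ≤ |a| * sinPi E := by positivity
      linarith
    nlinarith

/-! ### The gaps -/

/-- The energies of the `r`-th cell where `τ η > 2 κ`. -/
def gapSet (a κ τ : ℝ) (r : ℕ) : Set ℝ := {E | E ∈ cell r ∧ 2 * κ < τ * eta a E}

/-- This turns the gap condition into a comparison of the monotone ratio with the fixed level `-(a /
4)`; the sign of `τ * sinPi E` decides the direction, hence on which side of the band edge the gap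
lies. -/
lemma lt_eta_iff {a κ τ E : ℝ} (hS : 0 < τ * sinPi E) (hτ : τ * τ = 1) :
    2 * κ < τ * eta a E ↔ -(a / 4) < (cosPi E - τ * κ) / sinPi E := by
  have h0 : sinPi E ≠ 0 := fun h => by simp [h] at hS
  have e : (cosPi E - τ * κ) / sinPi E = (τ * cosPi E - κ) / (τ * sinPi E) := by
    rw [← mul_div_mul_left _ _ (left_ne_zero_of_mul_eq_one hτ)]
    congr 1
    linear_combination -κ * hτ
  rw [e, lt_div_iff₀ hS, eta]
  constructor <;> intro h <;> linarith

lemma eta_eq_iff {a κ τ E : ℝ} (hS : sinPi E ≠ 0) (hτ : τ * τ = 1) :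
    τ * eta a E = 2 * κ ↔ (cosPi E - τ * κ) / sinPi E = -(a / 4) := by
  have hτ0 := left_ne_zero_of_mul_eq_one hτ
  rw [div_eq_iff hS, eta]
  constructor <;> intro h
  · refine mul_left_cancel₀ hτ0 ?_
    linear_combination h / 2 - κ * hτ
  · linear_combination 2 * τ * h + 2 * κ * hτ

lemma lt_eta_iff' {a κ τ E : ℝ} (hS : τ * sinPi E < 0) (hτ : τ * τ = 1) :
    2 * κ < τ * eta a E ↔ (cosPi E - τ * κ) / sinPi E < -(a / 4) := by
  have h0 : sinPi E ≠ 0 := fun h => by simp [h] at hS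
  have e : (cosPi E - τ * κ) / sinPi E = (τ * cosPi E - κ) / (τ * sinPi E) := by
    rw [← mul_div_mul_left _ _ (left_ne_zero_of_mul_eq_one hτ)]
    congr 1
    linear_combination -κ * hτ
  rw [e, div_lt_iff_of_neg hS, eta]
  constructor <;> intro h <;> linarith

/-! ### Numbering of the gaps -/

/-- Preconnected sets `G 0, G 1, …` that exhaust the complement of `S`, ordered from left to right
and separated by points of `S`, are the gaps of `S`. -/
theorem isNthGap_of_separated {S : Set ℝ} {G : ℕ → Set ℝ} (hne : ∀ k, (G k).Nonempty)
    (hpre : ∀ k, IsPreconnected (G k)) (hU : ∀ x, x ∈ Sᶜ ↔ ∃ k, x ∈ G k)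
    (hsep : ∀ k l, k < l → ∃ s ∈ S, (∀ x ∈ G k, x < s) ∧ ∀ y ∈ G l, s < y) (k : ℕ) :
    IsNthGap S (k + 1) (G k) := by
  have hcomp : ∀ k, ∀ x ∈ G k, connectedComponentIn Sᶜ x = G k := by
    intro k x hx
    have hxS : x ∈ Sᶜ := (hU x).2 ⟨k, hx⟩
    refine Subset.antisymm (fun y hy => ?_)
      ((hpre k).subset_connectedComponentIn hx fun z hz => (hU z).2 ⟨k, hz⟩)
    have hyS := connectedComponentIn_subset _ _ hy
    -- A component is an interval, so if it met two of the sets it would contain a point of `S`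
    -- separating them.
    have hord : OrdConnected (connectedComponentIn Sᶜ x) :=
      isPreconnected_connectedComponentIn.ordConnected
    have hx' := mem_connectedComponentIn hxS
    obtain ⟨l, hl⟩ := (hU y).1 hyS
    rcases lt_trichotomy k l with h | h | h
    · obtain ⟨s, hs, h1, h2⟩ := hsep k l h
      exact absurd hs (connectedComponentIn_subset _ _
        (hord.out hx' hy ⟨(h1 x hx).le, (h2 y hl).le⟩))
    · exact h ▸ hl
    · obtain ⟨s, hs, h1, h2⟩ := hsep l k h
      exact absurd hs (connectedComponentIn_subset _ _
        (hord.out hy hx' ⟨(h1 y hl).le, (h2 x hx).le⟩))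
  have hlt : ∀ k l, k < l → ∀ x ∈ G k, ∀ y ∈ G l, x < y := fun k l h x hx y hy => by
    obtain ⟨s, -, h1, h2⟩ := hsep k l h
    exact (h1 x hx).trans (h2 y hy)
  have hgap : ∀ k, IsGap S (G k) := fun k => by
    obtain ⟨x, hx⟩ := hne k
    exact ⟨x, (hU x).2 ⟨k, hx⟩, (hcomp k x hx).symm⟩
  refine ⟨hgap k, ?_⟩
  have hset : {J | IsGap S J ∧ ∀ x ∈ J, ∀ y ∈ G k, x < y} = G '' (Finset.range k : Set ℕ) := by
    ext J
    constructor
    · rintro ⟨⟨x, hx, rfl⟩, h⟩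
      obtain ⟨l, hl⟩ := (hU x).1 hx
      rw [hcomp l x hl] at h ⊢
      refine ⟨l, Finset.mem_coe.2 (Finset.mem_range.2 ?_), rfl⟩
      by_contra! hkl
      obtain ⟨y, hy⟩ := hne k
      rcases hkl.lt_or_eq with h1 | h1
      · exact absurd (h x hl y hy) (hlt k l h1 y hy x hl).not_gt
      · subst h1
        exact lt_irrefl _ (h x hl x hl)
    · rintro ⟨l, hl, rfl⟩
      exact ⟨hgap l, hlt l k (Finset.mem_range.1 (Finset.mem_coe.1 hl))⟩
  have hinj : Function.Injective G := fun i j hij => by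
    by_contra hne'
    obtain ⟨x, hx⟩ := hne i
    have hx' : x ∈ G j := hij ▸ hx
    rcases Nat.lt_or_gt_of_ne hne' with h | h
    · exact lt_irrefl _ (hlt i j h x hx x hx')
    · exact lt_irrefl _ (hlt j i h x hx' x hx)
  rw [hset, hinj.encard_image, Set.encard_coe_eq_coe_finsetCard, Finset.card_range]
  push_cast
  rfl

/-! ### The gaps of the periodic chain -/

/-- The sign of `η` in the gap number `k + 1`. -/
def gapSign (k : ℕ) : ℝ := (-1) ^ ((k + 1) / 2)

/-- The gap number `k + 1`. -/
def gap (a κ : ℝ) (k : ℕ) : Set ℝ := gapSet a κ (gapSign k) (k / 2)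

lemma gapSign_mul_self (k : ℕ) : gapSign k * gapSign k = 1 := neg_one_pow_mul_self _

lemma abs_gapSign (k : ℕ) : |gapSign k| = 1 := by simp [gapSign]

lemma gapSign_even (r : ℕ) : gapSign (2 * r) = (-1) ^ r := by
  rw [gapSign, show (2 * r + 1) / 2 = r by omega]

lemma gapSign_odd (r : ℕ) : gapSign (2 * r + 1) = -(-1) ^ r := by
  rw [gapSign, show (2 * r + 1 + 1) / 2 = r + 1 by omega, pow_succ, mul_neg_one]

section

variable {a κ : ℝ}

lemma abs_gapSign_mul_lt (hκ0 : 0 < κ) (hκ1 : κ < 1) (k : ℕ) : |gapSign k * κ| < 1 := by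
  rw [abs_mul, abs_gapSign, one_mul, abs_of_pos hκ0]
  exact hκ1

/-- The band edge of a gap. -/
lemma exists_bandEdge (a : ℝ) (hκ0 : 0 < κ) (hκ1 : κ < 1) (k : ℕ) :
    ∃ e ∈ cell (k / 2), gapSign k * eta a e = 2 * κ ∧
      (Even k → gap a κ k = {E | E ∈ cell (k / 2) ∧ E < e}) ∧
      (Odd k → gap a κ k = {E | E ∈ cell (k / 2) ∧ e < E}) := by
  have hτ := gapSign_mul_self k
  have hanti := ratio_strictAntiOn (abs_gapSign_mul_lt hκ0 hκ1 k) (k / 2)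
  rcases Nat.even_or_odd' k with ⟨r, rfl | rfl⟩
  · have hr : 2 * r / 2 = r := by omega
    rw [hr] at hanti ⊢
    obtain ⟨e, he, hey⟩ := exists_eta_eq a r (y := 2 * κ) (by linarith) (by linarith)
    rw [← gapSign_even] at hey
    refine ⟨e, he, hey, fun _ => ?_, fun h => absurd h (by simp)⟩
    ext E
    simp only [gap, gapSet, hr, mem_ofPred_eq]
    refine and_congr_right fun hE => ?_
    have hS := sinPi_sign hE
    rw [← gapSign_even] at hS
    rw [lt_eta_iff hS hτ, ← (eta_eq_iff (sinPi_ne_zero he) hτ).1 hey]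
    exact hanti.lt_iff_gt he hE
  · have hr : (2 * r + 1) / 2 = r := by omega
    rw [hr] at hanti ⊢
    obtain ⟨e, he, hey⟩ := exists_eta_eq a r (y := -(2 * κ)) (by linarith) (by linarith)
    have hey' : gapSign (2 * r + 1) * eta a e = 2 * κ := by
      rw [gapSign_odd]; linarith
    refine ⟨e, he, hey', fun h => absurd h (by simp), fun _ => ?_⟩
    ext E
    simp only [gap, gapSet, hr, mem_ofPred_eq]
    refine and_congr_right fun hE => ?_
    have hS := sinPi_sign hE
    have hS' : gapSign (2 * r + 1) * sinPi E < 0 := by rw [gapSign_odd]; linarith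
    rw [lt_eta_iff' hS' hτ, ← (eta_eq_iff (sinPi_ne_zero he) hτ).1 hey']
    exact hanti.lt_iff_gt hE he

lemma gap_nonempty (a : ℝ) (hκ0 : 0 < κ) (hκ1 : κ < 1) (k : ℕ) : (gap a κ k).Nonempty := by
  rcases Nat.even_or_odd' k with ⟨r, rfl | rfl⟩
  · have hr : 2 * r / 2 = r := by omega
    -- Since `κ < 1`, the value `1 + κ` lies strictly between `2 κ` and `2`.
    obtain ⟨e, he, hey⟩ := exists_eta_eq a r (y := 1 + κ) (by linarith) (by linarith)
    refine ⟨e, ?_, ?_⟩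
    · rwa [hr]
    · rw [gapSign_even, hey]; linarith
  · have hr : (2 * r + 1) / 2 = r := by omega
    obtain ⟨e, he, hey⟩ := exists_eta_eq a r (y := -(1 + κ)) (by linarith) (by linarith)
    refine ⟨e, ?_, ?_⟩
    · rwa [hr]
    · rw [gapSign_odd]; linarith

lemma gap_isPreconnected (a : ℝ) (hκ0 : 0 < κ) (hκ1 : κ < 1) (k : ℕ) :
    IsPreconnected (gap a κ k) := by
  obtain ⟨e, -, -, h1, h2⟩ := exists_bandEdge a hκ0 hκ1 k
  refine OrdConnected.isPreconnected ⟨fun x hx y hy z hz => ?_⟩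
  rcases Nat.even_or_odd k with hk | hk
  · rw [h1 hk] at hx hy ⊢
    exact ⟨cell_mem_of_le hx.1 hy.1 hz.1 hz.2, hz.2.trans_lt hy.2⟩
  · rw [h2 hk] at hx hy ⊢
    exact ⟨cell_mem_of_le hx.1 hy.1 hz.1 hz.2, hx.2.trans_le hz.1⟩

lemma sq_mem_essSpectrum (α A : ℝ) {r : ℕ} (hr : r ≠ 0) :
    (r : ℝ) ^ 2 ∈ essSpectrum (periodicHamiltonian α A) :=
  flat_mem_essSpectrum α A (sinPi_sq hr)

/-- An energy off the essential spectrum is not a square and has `|η| > 2 κ`; its cell and the sign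
of `η` determine the gap. -/
theorem isNthGap_periodicHamiltonian {α A : ℝ} (h0 : Real.cos (A * Real.pi) ≠ 0)
    (h1 : |Real.cos (A * Real.pi)| < 1) (k : ℕ) :
    IsNthGap (essSpectrum (periodicHamiltonian α A)) (k + 1)
      (gap α |Real.cos (A * Real.pi)| k) := by
  have hκ0 := abs_pos.2 h0
  set κ := |Real.cos (A * Real.pi)| with hκ
  refine isNthGap_of_separated (gap_nonempty α hκ0 h1) (gap_isPreconnected α hκ0 h1)
    (fun E => ⟨fun hE => ?_, ?_⟩) (fun k l hkl => ?_) k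
  · have hS : sinPi E ≠ 0 := fun h => hE (flat_mem_essSpectrum α A h)
    have hη : 2 * κ < |eta α E| := by
      by_contra! h
      exact hE (mem_essSpectrum_of_abs_eta_le hS h0 h)
    rcases exists_cell E with ⟨r, hr⟩ | ⟨r, hr, rfl⟩
    · rcases lt_or_ge 0 ((-1) ^ r * eta α E) with h | h
      · refine ⟨2 * r, ?_, ?_⟩
        · rwa [show 2 * r / 2 = r by omega]
        · rw [gapSign_even, ← abs_of_pos h, abs_mul, abs_neg_one_pow, one_mul]
          exact hη
      · refine ⟨2 * r + 1, ?_, ?_⟩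
        · rwa [show (2 * r + 1) / 2 = r by omega]
        · rw [gapSign_odd, neg_mul, ← abs_of_nonpos h, abs_mul, abs_neg_one_pow, one_mul]
          exact hη
    · exact absurd (sinPi_sq hr) hS
  · rintro ⟨k, hc, hE⟩ hess
    have := abs_eta_le_of_mem_essSpectrum (sinPi_ne_zero hc) hess
    have h2 := le_abs_self (gapSign k * eta α E)
    rw [abs_mul, abs_gapSign, one_mul] at h2
    linarith
  · rcases (Nat.div_le_div_right (c := 2) hkl.le).lt_or_eq with h | h
    · refine ⟨((k / 2 + 1 : ℕ) : ℝ) ^ 2, sq_mem_essSpectrum α A (Nat.succ_ne_zero _),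
        fun x hx => ?_, fun y hy => ?_⟩
      · push_cast
        exact hx.1.2
      · refine lt_of_le_of_lt ?_ (hy.1.1 (by omega))
        have : ((k / 2 + 1 : ℕ) : ℝ) ≤ ((l / 2 : ℕ) : ℝ) := by exact_mod_cast h
        gcongr
    · obtain ⟨r, rfl⟩ : ∃ r, k = 2 * r := ⟨k / 2, by omega⟩
      obtain rfl : l = 2 * r + 1 := by omega
      obtain ⟨e, he, hey, hg, -⟩ := exists_bandEdge α hκ0 h1 (2 * r)
      refine ⟨e, mem_essSpectrum_of_abs_eta_le (sinPi_ne_zero he) h0 ?_, fun x hx => ?_,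
        fun y hy => ?_⟩
      · rw [← one_mul |eta α e|, ← abs_gapSign (2 * r), ← abs_mul, hey, ← hκ,
          abs_of_pos (by linarith)]
      · rw [hg (by simp)] at hx
        exact hx.2
      · have hye : ¬ y < e := fun hlt => by
          have hym : y ∈ gap α κ (2 * r) := by
            rw [hg (by simp)]
            refine ⟨?_, hlt⟩
            rw [h]
            exact hy.1
          have a1 := hym.2
          have a2 := hy.2
          rw [gapSign_even] at a1
          rw [gapSign_odd] at a2
          linarith
        refine lt_of_le_of_ne (not_lt.1 hye) fun heq => ?_
        have a2 := hy.2
        rw [← heq] at a2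
        rw [gapSign_even] at hey
        rw [gapSign_odd] at a2
        linarith

end

/-! ### Eigenvalues and the vertex equation -/

lemma mem_eigenspace_hamiltonian {α A : ℤ → ℝ} {E : ℝ} {u : GraphL2} :
    u ∈ eigenspace (hamiltonian α A) E ↔ InGraph α A u ((E : ℂ) • u) :=
  mem_graph_hamiltonian α A u ((E : ℂ) • u)

lemma isEigenvalue_hamiltonian_iff {α A : ℤ → ℝ} {E : ℝ} :
    IsEigenvalue (hamiltonian α A) E ↔ ∃ u ∈ eigenspace (hamiltonian α A) E, u ≠ 0 := by
  constructor
  · rintro ⟨u, hu, h⟩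
    refine ⟨u, ?_, hu⟩
    have h1 := LinearPMap.mem_graph (hamiltonian α A) u
    rwa [h] at h1
  · rintro ⟨u, hu, h0⟩
    obtain ⟨w, hw1, hw2⟩ := (LinearPMap.mem_graph_iff _).1
      (show (u, (E : ℂ) • u) ∈ (hamiltonian α A).graph from hu)
    exact ⟨w, by rw [hw1]; exact h0, by rw [hw2, hw1]⟩

/-- The values of the eigenfunctions at the vertices. -/
lemma exists_vertexMap (α A : ℤ → ℝ) {E : ℝ} (hS : sinPi E ≠ 0) :
    ∃ L : eigenspace (hamiltonian α A) E →ₗ[ℂ] (ℤ → ℂ), Function.Injective L ∧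
      ∀ u, Summable (fun j => ‖L u j‖ ^ 2) ∧ ∀ j, defect α A E (L u) j = 0 := by
  obtain ⟨K, hK, hKA⟩ := exists_vertex_bounds E
  obtain ⟨y, z, hyz⟩ := hKA A
  have hz : ∀ (u : GraphL2) (e : Edge), ((E : ℂ) • u) e - (E : ℂ) • u e = 0 := fun u e => by
    rw [lp.coeFn_smul, Pi.smul_apply, sub_self]
  let L : eigenspace (hamiltonian α A) E →ₗ[ℂ] (ℤ → ℂ) :=
    { toFun := fun u j => inner ℂ (y j) ((u : GraphL2) (j, true))
      map_add' := fun u v => by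
        funext j
        exact inner_add_right _ _ _
      map_smul' := fun c u => by
        funext j
        exact inner_smul_right _ _ _ }
  have hL : ∀ u : eigenspace (hamiltonian α A) E,
      (Summable fun j => ‖L u j‖ ^ 2) ∧ (∀ j, defect α A E (L u) j = 0) ∧
      ∀ e, ‖(u : GraphL2) e‖ ≤ K * (‖L u e.1‖ + ‖L u (e.1 + 1)‖) := fun u => by
    obtain ⟨U, hU1, hU2, hU3, hU4⟩ := hyz α u _ (mem_eigenspace_hamiltonian.1 u.2)
    simp only [hz, inner_zero_right, norm_zero, add_zero, mul_zero] at hU1 hU2 hU3 hU4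
    have hUL : U = L u := funext hU1
    subst hUL
    refine ⟨(tsum_vertex_sq_le (K := K) (u := u) (g := 0) fun j => ?_).1,
      fun j => norm_le_zero_iff.1 (hU3 j), hU4 hS⟩
    simpa using hU2 j
  refine ⟨L, ?_, fun u => ⟨(hL u).1, (hL u).2.1⟩⟩
  rw [injective_iff_map_eq_zero]
  intro u hu
  refine Subtype.ext (lp.ext (funext fun e => norm_le_zero_iff.1 ?_))
  simpa [hu] using (hL u).2.2 e

lemma exists_mem_eigenspace {α A : ℤ → ℝ} {E : ℝ} (hS : sinPi E ≠ 0) {U : ℤ → ℂ}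
    (hU : Summable fun j => ‖U j‖ ^ 2) (hd : ∀ j, defect α A E U j = 0) (hU0 : U ≠ 0) :
    ∃ u ∈ eigenspace (hamiltonian α A) E, u ≠ 0 := by
  obtain ⟨K, hK, h⟩ := exists_inGraph_of_vertex hS
  obtain ⟨u, v, hg, -, hv, hUu⟩ := h α A U hU (by simp [hd])
  simp only [hd, norm_zero, mul_zero] at hv
  have hve : v = (E : ℂ) • u := lp.ext (funext fun e =>
    sub_eq_zero.1 (norm_le_zero_iff.1 (hv e)))
  refine ⟨u, mem_eigenspace_hamiltonian.2 (hve ▸ hg), fun hu0 => hU0 (funext fun j => ?_)⟩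
  have h1 := hUu j
  rw [norm_le_zero_iff.1 (hv _), hu0] at h1
  simpa using h1

/-- A change of signs turns the vertex equation into a Jacobi equation. -/
lemma jacobi_gauge {τ g : ℝ} (hτ : τ * τ = 1) (hg : g * g = 1) (α A : ℤ → ℝ) (E : ℝ)
    (X : ℤ → ℝ) (j : ℤ) :
    jacobi (fun j => g * hop A j) (fun j => τ * eta (α j) E) (fun j => (τ * g) ^ j * X j) j
      = -(τ * (τ * g) ^ j) * (hop A j * X (j + 1) + hop A (j - 1) * X (j - 1) - eta (α j) E * X j) := by
  have hs : (τ * g) * (τ * g) = 1 := by linear_combination (g * g) * hτ + hg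
  have hs0 : τ * g ≠ 0 := left_ne_zero_of_mul_eq_one hs
  have h1 : (τ * g) ^ (j + 1) = (τ * g) ^ j * (τ * g) := zpow_add_one₀ hs0 j
  have h2 : (τ * g) ^ (j - 1) = (τ * g) ^ j * (τ * g) := by
    rw [zpow_sub_one₀ hs0, inv_eq_of_mul_eq_one_right hs]
  simp only [jacobi]
  rw [h1, h2]
  linear_combination (-(τ * g) ^ j * τ * (hop A j * X (j + 1) + hop A (j - 1) * X (j - 1))) * hg

section

variable {τ g E : ℝ} {α A : ℤ → ℝ}

lemma abs_gauge (hτ : τ * τ = 1) (hg : g * g = 1) (j : ℤ) : ((τ * g) ^ j) ^ 2 = 1 := by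
  have h : (τ * g) ^ 2 = 1 := by linear_combination (g * g) * hτ + hg
  rw [← zpow_natCast, ← zpow_mul, mul_comm j, zpow_mul, zpow_natCast, h, one_zpow]

/-- The vertex equation has real coefficients, so its real and imaginary parts can be treated
separately, and the sign change preserves `ℓ²` norms. -/
lemma jacobi_re_im (hτ : τ * τ = 1) (hg : g * g = 1) {U : ℤ → ℂ}
    (hU : Summable fun j => ‖U j‖ ^ 2) (hd : ∀ j, defect α A E U j = 0) (φ : ℂ →ₗ[ℝ] ℝ)
    (hφ : ∀ z, |φ z| ≤ ‖z‖) :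
    (Summable fun j => ((τ * g) ^ j * φ (U j)) ^ 2) ∧
    ∀ j, jacobi (fun j => g * hop A j) (fun j => τ * eta (α j) E)
      (fun j => (τ * g) ^ j * φ (U j)) j = 0 := by
  constructor
  · refine Summable.of_nonneg_of_le (fun _ => sq_nonneg _) (fun j => ?_) hU
    rw [mul_pow, abs_gauge hτ hg, one_mul, ← sq_abs]
    exact pow_le_pow_left₀ (abs_nonneg _) (hφ _) 2
  · intro j
    rw [jacobi_gauge hτ hg α A E (fun j => φ (U j))]
    have h1 := congrArg φ (hd j)
    simp only [defect, ← Complex.real_smul, map_add, map_sub, map_smul, map_zero,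
      smul_eq_mul] at h1
    rw [h1, mul_zero]

/-- In the application `g` is the sign of `cos (A π)` and `τ` the sign of `η` in the gap, so every
gap is brought to the same normal form: bonds close to `κ > 0` and diagonal above `2 κ`. -/
theorem isEigenvalue_iff_jacobi (hτ : τ * τ = 1) (hg : g * g = 1) (hS : sinPi E ≠ 0) :
    IsEigenvalue (hamiltonian α A) E ↔ ∃ W : ℤ → ℝ, Summable (fun j => W j ^ 2) ∧ W ≠ 0 ∧
      ∀ j, jacobi (fun j => g * hop A j) (fun j => τ * eta (α j) E) W j = 0 := by
  rw [isEigenvalue_hamiltonian_iff]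
  have hs0 : τ * g ≠ 0 := mul_ne_zero (left_ne_zero_of_mul_eq_one hτ)
    (left_ne_zero_of_mul_eq_one hg)
  constructor
  · rintro ⟨u, hu, h0⟩
    obtain ⟨L, hinj, hL⟩ := exists_vertexMap α A hS
    obtain ⟨h1, h2⟩ := hL ⟨u, hu⟩
    have hne : L ⟨u, hu⟩ ≠ 0 := fun h => h0 (congrArg Subtype.val
      (hinj (h.trans (map_zero L).symm)))
    obtain ⟨i, hi⟩ := Function.ne_iff.1 hne
    by_cases hre : (L ⟨u, hu⟩ i).re = 0
    · have him : (L ⟨u, hu⟩ i).im ≠ 0 := fun h => hi (Complex.ext hre h)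
      obtain ⟨a, b⟩ := jacobi_re_im hτ hg h1 h2 Complex.imLm Complex.abs_im_le_norm
      exact ⟨_, a, fun h => mul_ne_zero (zpow_ne_zero i hs0) him (congrFun h i), b⟩
    · obtain ⟨a, b⟩ := jacobi_re_im hτ hg h1 h2 Complex.reLm Complex.abs_re_le_norm
      exact ⟨_, a, fun h => mul_ne_zero (zpow_ne_zero i hs0) hre (congrFun h i), b⟩
  · rintro ⟨W, hW, hW0, hJ⟩
    refine exists_mem_eigenspace hS (U := fun j => (((τ * g) ^ j * W j : ℝ) : ℂ)) ?_ (fun j => ?_)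
      fun h => hW0 (funext fun j => ?_)
    · refine hW.congr fun j => ?_
      rw [Complex.norm_real, Real.norm_eq_abs, sq_abs, mul_pow, abs_gauge hτ hg, one_mul]
    · have h1 := jacobi_gauge hτ hg α A E (fun j => (τ * g) ^ j * W j) j
      have h2 : (fun j => (τ * g) ^ j * ((τ * g) ^ j * W j)) = W := funext fun j => by
        rw [← mul_assoc, ← sq, abs_gauge hτ hg, one_mul]
      rw [h2, hJ] at h1
      have h3 := (mul_eq_zero.1 h1.symm).resolve_left
        (neg_ne_zero.2 (mul_ne_zero (left_ne_zero_of_mul_eq_one hτ) (zpow_ne_zero j hs0)))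
      simp only [defect]
      exact_mod_cast h3
    · have h1 : (τ * g) ^ j * W j = 0 := by
        exact Complex.ofReal_eq_zero.1 (congrFun h j)
      exact (mul_eq_zero.1 h1).resolve_left (zpow_ne_zero j hs0)

/-- By `hker` an eigenfunction is determined by its value at the vertex `1`, so two eigenfunctions
are proportional with the quotient of these values. -/
theorem finrank_eigenspace_eq_one (hτ : τ * τ = 1) (hg : g * g = 1) (hS : sinPi E ≠ 0)
    (hker : ∀ W : ℤ → ℝ, Summable (fun j => W j ^ 2) →
      (∀ j, jacobi (fun j => g * hop A j) (fun j => τ * eta (α j) E) W j = 0) → W 1 = 0 → W = 0)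
    (hE : IsEigenvalue (hamiltonian α A) E) :
    Module.finrank ℂ (eigenspace (hamiltonian α A) E) = 1 := by
  obtain ⟨u, hu, h0⟩ := isEigenvalue_hamiltonian_iff.1 hE
  obtain ⟨L, hinj, hL⟩ := exists_vertexMap α A hS
  have hs0 : τ * g ≠ 0 := mul_ne_zero (left_ne_zero_of_mul_eq_one hτ)
    (left_ne_zero_of_mul_eq_one hg)
  have hinj1 : ∀ v, L v 1 = 0 → v = 0 := fun v hv => by
    refine hinj (((funext fun j => ?_) : L v = 0).trans (map_zero L).symm)
    obtain ⟨h1, h2⟩ := hL v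
    obtain ⟨a, b⟩ := jacobi_re_im hτ hg h1 h2 Complex.reLm Complex.abs_re_le_norm
    obtain ⟨a', b'⟩ := jacobi_re_im hτ hg h1 h2 Complex.imLm Complex.abs_im_le_norm
    have e := congrFun (hker _ a b (by simp [hv])) j
    have e' := congrFun (hker _ a' b' (by simp [hv])) j
    exact Complex.ext ((mul_eq_zero.1 e).resolve_left (zpow_ne_zero j hs0))
      ((mul_eq_zero.1 e').resolve_left (zpow_ne_zero j hs0))
  refine finrank_eq_one_iff_of_nonzero' ⟨u, hu⟩ (fun h => h0 (congrArg Subtype.val h)) |>.2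
    fun w => ?_
  have hu1 : L ⟨u, hu⟩ 1 ≠ 0 := fun h => h0 (congrArg Subtype.val (hinj1 _ h))
  refine ⟨L w 1 / L ⟨u, hu⟩ 1, ?_⟩
  refine sub_eq_zero.1 (hinj1 _ ?_)
  rw [map_sub, map_smul, Pi.sub_apply, Pi.smul_apply, smul_eq_mul, div_mul_cancel₀ _ hu1, sub_self]

end

/-! ### Impurity states -/

lemma gapSign_mul_sinPi_pos {k : ℕ} (hk : Even k) {E : ℝ} (hE : E ∈ cell (k / 2)) :
    0 < gapSign k * sinPi E := by
  obtain ⟨r, rfl⟩ := hk.two_dvd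
  rw [gapSign_even]
  rw [show 2 * r / 2 = r by omega] at hE
  exact sinPi_sign hE

lemma gapSign_mul_sinPi_neg {k : ℕ} (hk : Odd k) {E : ℝ} (hE : E ∈ cell (k / 2)) :
    gapSign k * sinPi E < 0 := by
  obtain ⟨r, rfl⟩ := hk
  rw [gapSign_odd]
  rw [show (2 * r + 1) / 2 = r by omega] at hE
  linarith [sinPi_sign hE]

/-- Two different energies of the same cell, in the order needed for the comparison of forms. -/
lemma ratio_sign (k : ℕ) {E F : ℝ} (hE : E ∈ cell (k / 2)) (hF : F ∈ cell (k / 2)) (h : E ≠ F) :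
    (∀ c : ℝ, |c| < 1 → gapSign k * sinPi F
      * ((cosPi F - c) / sinPi F - (cosPi E - c) / sinPi E) < 0) ∨
    (∀ c : ℝ, |c| < 1 → gapSign k * sinPi E
      * ((cosPi E - c) / sinPi E - (cosPi F - c) / sinPi F) < 0) := by
  have hlt : ∀ c : ℝ, |c| < 1 → ∀ x ∈ cell (k / 2), ∀ y ∈ cell (k / 2), x < y →
      (cosPi y - c) / sinPi y - (cosPi x - c) / sinPi x < 0 := fun c hc x hx y hy hxy =>
    sub_neg.2 (ratio_strictAntiOn hc _ hx hy hxy)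
  have hgt : ∀ c : ℝ, |c| < 1 → ∀ x ∈ cell (k / 2), ∀ y ∈ cell (k / 2), y < x →
      0 < (cosPi y - c) / sinPi y - (cosPi x - c) / sinPi x := fun c hc x hx y hy hxy =>
    sub_pos.2 (ratio_strictAntiOn hc _ hy hx hxy)
  rcases Nat.even_or_odd k with hk | hk <;> rcases h.lt_or_gt with h | h
  · exact Or.inl fun c hc => mul_neg_of_pos_of_neg (gapSign_mul_sinPi_pos hk hF)
      (hlt c hc E hE F hF h)
  · exact Or.inr fun c hc => mul_neg_of_pos_of_neg (gapSign_mul_sinPi_pos hk hE)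
      (hlt c hc F hF E hE h)
  · exact Or.inr fun c hc => mul_neg_of_neg_of_pos (gapSign_mul_sinPi_neg hk hE)
      (hgt c hc F hF E hE h)
  · exact Or.inl fun c hc => mul_neg_of_neg_of_pos (gapSign_mul_sinPi_neg hk hF)
      (hgt c hc E hE F hF h)

/-- The scaling `ρ = sinPi F / sinPi E` makes the coupling terms at both energies agree, so the
difference of the diagonals is independent of `j`. The ratio inequality with parameter `-(τ y)`, for
`y = c j` and `y = -c j`, is precisely the diagonal dominance required by `jacobi_kernel_unique`;
this is why it is needed for all parameters below one in modulus. -/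
lemma kernel_unique_of_ratio {τ M E F : ℝ} {c α U V : ℤ → ℝ} (hτ : τ * τ = 1)
    (hE : sinPi E ≠ 0) (hF : sinPi F ≠ 0) (hc : ∀ j, |c j| < 1)
    (hα : ∀ j, |τ * eta (α j) F| ≤ M)
    (hratio : ∀ c : ℝ, |c| < 1 → τ * sinPi F
      * ((cosPi F - c) / sinPi F - (cosPi E - c) / sinPi E) < 0)
    (hpos : ∀ W : ℤ → ℝ, Summable (fun j => W j ^ 2) → W 1 = 0 → W ≠ 0 →
      0 < ∑' j, jacobi c (fun j => τ * eta (α j) F) W j * W j)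
    (hU : Summable fun j => U j ^ 2) (hV : Summable fun j => V j ^ 2)
    (hJU : ∀ j, jacobi c (fun j => τ * eta (α j) E) U j = 0)
    (hJV : ∀ j, jacobi c (fun j => τ * eta (α j) F) V j = 0)
    (hU0 : U ≠ 0) (hV0 : V ≠ 0) : False := by
  set ρ := sinPi F / sinPi E with hρ
  have hρE : ρ * sinPi E = sinPi F := div_mul_cancel₀ _ hE
  have hkey : ∀ y : ℝ, |y| < 1 → τ * (cosPi F - ρ * cosPi E) + y * (1 - ρ) < 0 := fun y hy => by
    have hτa : |τ| = 1 := by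
      have : |τ| * |τ| = 1 := by rw [← abs_mul, hτ, abs_one]
      nlinarith [abs_nonneg τ]
    have h1 := hratio (-(τ * y)) (by rwa [abs_neg, abs_mul, hτa, one_mul])
    have h2 : τ * sinPi F * ((cosPi F - -(τ * y)) / sinPi F - (cosPi E - -(τ * y)) / sinPi E)
        = τ * (cosPi F - ρ * cosPi E) + y * (1 - ρ) := by
      rw [hρ]
      field_simp
      linear_combination (y * (sinPi E - sinPi F)) * hτ
    rwa [h2] at h1
  refine jacobi_kernel_unique (d₁ := fun j => τ * eta (α j) E) (d₂ := fun j => τ * eta (α j) F)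
    (M := max 1 M) (ρ := ρ) (p := τ * (cosPi F - ρ * cosPi E))
    (fun j => (hc j).le.trans (le_max_left _ _)) (fun j => (hα j).trans (le_max_right _ _))
    hpos (fun j => ?_) (fun j => ?_) hU hV hJU hJV hU0 hV0
  · simp only [eta]
    linear_combination (-τ * α j / 2) * hρE
  · rw [abs_lt]
    constructor
    · linarith [hkey (-c j) (by rw [abs_neg]; exact hc j)]
    · linarith [hkey (c j) (hc j)]

lemma perturb_of_not {c ε : ℝ} {n : ℕ} {d : ℤ → ℝ} {j : ℤ} (h : ¬(1 ≤ j ∧ j ≤ (n : ℤ))) :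
    perturb c ε n d j = c := if_neg h

lemma hasDerivAt_hop_perturb (A : ℝ) (n : ℕ) (A' : ℤ → ℝ) (j : ℤ) :
    HasDerivAt (fun ε => hop (perturb A ε n A') j)
      (-Real.sin (A * Real.pi) * (if 1 ≤ j ∧ j ≤ (n : ℤ) then A' j * Real.pi else 0)) 0 := by
  by_cases hj : 1 ≤ j ∧ j ≤ (n : ℤ)
  · simp only [hop, perturb, if_pos hj]
    have h := ((((hasDerivAt_id (0 : ℝ)).mul_const (A' j)).const_add A).mul_const Real.pi).cos
    simpa using h
  · simp only [hop, perturb, if_neg hj, mul_zero]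
    exact hasDerivAt_const _ _

lemma eta_perturb (α ε : ℝ) (n : ℕ) (α' : ℤ → ℝ) (E : ℝ) (j : ℤ) :
    eta (perturb α ε n α' j) E
      = eta α E + ε * ((if 1 ≤ j ∧ j ≤ (n : ℤ) then α' j else 0) * (sinPi E / 2)) := by
  by_cases hj : 1 ≤ j ∧ j ≤ (n : ℤ)
  · simp only [perturb, if_pos hj, eta]
    ring
  · simp only [perturb, if_neg hj, eta]
    ring

/-- Weak coupling at the band edge produces an eigenvalue. Positivity of the form on sequences
vanishing at `1`, for all energies of the gap at once, excludes a second eigenvalue and a second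
eigenfunction. -/
theorem eventually_hasOneSimpleEigenvalueIn_gap {α A : ℝ} (h0 : Real.cos (A * Real.pi) ≠ 0)
    (h1 : |Real.cos (A * Real.pi)| < 1) {n : ℕ} {α' A' : ℤ → ℝ}
    (hA' : ∑ j ∈ Finset.Icc (1 : ℤ) n, A' j = 0) (k : ℕ)
    (hα' : (-1) ^ k * ∑ j ∈ Finset.Icc (1 : ℤ) n, α' j < 0) :
    ∀ᶠ ε in 𝓝[>] (0 : ℝ), HasOneSimpleEigenvalueIn (perturbedHamiltonian α A n α' A' ε)
      (gap α |Real.cos (A * Real.pi)| k) := by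
  have hκ0 := abs_pos.2 h0
  obtain ⟨g, hg, hgκ⟩ : ∃ g : ℝ, g * g = 1 ∧ g * Real.cos (A * Real.pi)
      = |Real.cos (A * Real.pi)| := by
    rcases le_total 0 (Real.cos (A * Real.pi)) with h | h
    · exact ⟨1, by norm_num, by rw [abs_of_nonneg h, one_mul]⟩
    · exact ⟨-1, by norm_num, by rw [abs_of_nonpos h, neg_one_mul]⟩
  set κ := |Real.cos (A * Real.pi)| with hκ
  set τ := gapSign k with hτd
  have hτ : τ * τ = 1 := gapSign_mul_self k
  have hτa : |τ| = 1 := abs_gapSign k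
  have hsg := neg_one_pow_mul_self k
  -- The sign `(-1) ^ k` is put into both `β` and `s`: their product is unchanged, `s` becomes
  -- positive on the cell, and the hypothesis reads `∑ β < 0`.
  set β : ℤ → ℝ := fun j => (-1) ^ k * (if 1 ≤ j ∧ j ≤ (n : ℤ) then α' j else 0) with hβ
  set s : ℝ → ℝ := fun E => (-1) ^ k * (τ * sinPi E / 2) with hs
  set c : ℝ → ℤ → ℝ := fun ε j => g * hop (perturb A ε n A') j with hc
  have hdiag : ∀ ε E j, τ * eta (perturb α ε n α' j) E
      = τ * eta α E + ε * (β j * s E) := fun ε E j => by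
    rw [eta_perturb]
    simp only [hβ, hs]
    linear_combination (-ε * τ * (if 1 ≤ j ∧ j ≤ (n : ℤ) then α' j else 0) * sinPi E / 2) * hsg
  have hspos : ∀ E ∈ cell (k / 2), 0 < s E := fun E hE => by
    simp only [hs]
    rcases Nat.even_or_odd k with hk | hk
    · rw [hk.neg_one_pow]
      linarith [gapSign_mul_sinPi_pos hk hE]
    · rw [hk.neg_one_pow]
      linarith [gapSign_mul_sinPi_neg hk hE]
  have hcoff : ∀ ε j, ¬(1 ≤ j ∧ j ≤ (n : ℤ)) → c ε j = κ := fun ε j hj => by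
    simp only [hc, hop, perturb_of_not hj]
    exact hgκ
  have hc00 : ∀ j, c 0 j = κ := fun j => by
    simp only [hc, hop, perturb, zero_mul, add_zero, ite_self]
    exact hgκ
  have hcder := fun j => (hasDerivAt_hop_perturb A n A' j).const_mul g
  have hcl : ∀ j, Tendsto (fun ε => c ε j) (𝓝[>] 0) (𝓝 κ) := fun j => by
    have := (hcder j).continuousAt.tendsto
    change Tendsto (fun ε => c ε j) (𝓝 0) (𝓝 (c 0 j)) at this
    rw [hc00] at this
    exact this.mono_left nhdsWithin_le_nhds
  -- existence
  obtain ⟨e, he, hey, hge, hgo⟩ := exists_bandEdge α hκ0 h1 k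
  obtain ⟨E₁, hE₁⟩ := gap_nonempty α hκ0 h1 k
  have hseg : ∀ E ∈ uIcc E₁ e, E ≠ e → E ∈ gap α κ k := fun E hE hne => by
    rcases Nat.even_or_odd k with hk | hk
    · rw [hge hk] at hE₁ ⊢
      rw [uIcc_of_le hE₁.2.le] at hE
      exact ⟨cell_mem_of_le hE₁.1 he hE.1 hE.2, lt_of_le_of_ne hE.2 hne⟩
    · rw [hgo hk] at hE₁ ⊢
      rw [uIcc_of_ge hE₁.2.le] at hE
      exact ⟨cell_mem_of_le he hE₁.1 hE.1 hE.2, lt_of_le_of_ne hE.1 hne.symm⟩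
  have hne₁ : E₁ ≠ e := fun h => by
    have := hE₁.2
    rw [h, hey] at this
    exact lt_irrefl _ this
  have hexist := exists_kernel_weak_coupling (n := n) (β := β) (c := c) hκ0
    (continuous_const.mul (continuous_eta α) : Continuous fun E => τ * eta α E)
    (continuous_const.mul ((continuous_const.mul continuous_sinPi).div_const 2) : Continuous s)
    hcoff hc00 hcder
    (by
      rw [← Finset.mul_sum, ← Finset.mul_sum, Finset.sum_congr rfl fun j hj =>
        if_pos (Finset.mem_Icc.1 hj), ← Finset.sum_mul, hA']
      ring)
    (fun j hj => by simp only [hβ, if_neg hj, mul_zero])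
    (by
      rw [← Finset.mul_sum, Finset.sum_congr rfl fun j hj => if_pos (Finset.mem_Icc.1 hj)]
      exact hα')
    hey (hspos e he) (fun E hE hne => (hseg E hE hne).2) hne₁
  -- positivity
  obtain ⟨K, hK0, hK⟩ := exists_abs_sinPi_le α
  set B : ℝ := 1 + ∑ j ∈ Finset.Icc (1 : ℤ) n, |α' j| with hB
  have hB0 : 0 < B := by
    have : 0 ≤ ∑ j ∈ Finset.Icc (1 : ℤ) n, |α' j| := Finset.sum_nonneg fun _ _ => abs_nonneg _
    linarith
  have hβB : ∀ j, |β j| ≤ B := fun j => by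
    simp only [hβ]
    rw [abs_mul, abs_neg_one_pow, one_mul]
    by_cases hj : 1 ≤ j ∧ j ≤ (n : ℤ)
    · rw [if_pos hj]
      have := Finset.single_le_sum (f := fun j => |α' j|) (fun _ _ => abs_nonneg _)
        (Finset.mem_Icc.2 hj)
      linarith
    · rw [if_neg hj, abs_zero]
      exact hB0.le
  -- The allowed size of the perturbation, chosen for `3 δ n (n + 1) ≤ κ / 2`; the summand `1` keeps
  -- the denominator positive for `n = 0`.
  set δ : ℝ := κ / (6 * (n * (n + 1) + 1)) with hδ
  have hnn : (0 : ℝ) ≤ n * (n + 1) := by positivity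
  have hδ0 : 0 < δ := by positivity
  have hδn : 3 * δ * (n * (n + 1)) ≤ κ / 2 := by
    have h2 : δ * (6 * (n * (n + 1) + 1)) = κ := div_mul_cancel₀ _ (by positivity)
    nlinarith
  have hcev : ∀ᶠ ε in 𝓝[>] (0 : ℝ), ∀ j, κ / 2 ≤ c ε j ∧ c ε j ≤ κ + δ ∧ c ε j < 1 := by
    have hfin : ∀ᶠ ε in 𝓝[>] (0 : ℝ), ∀ j ∈ Finset.Icc (1 : ℤ) n,
        κ / 2 ≤ c ε j ∧ c ε j ≤ κ + δ ∧ c ε j < 1 :=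
      (Finset.eventually_all _).2 fun j _ =>
        ((hcl j).eventually_const_le (by linarith)).and
          (((hcl j).eventually_le_const (by linarith)).and ((hcl j).eventually_lt_const h1))
    filter_upwards [hfin] with ε h j
    by_cases hj : 1 ≤ j ∧ j ≤ (n : ℤ)
    · exact h j (Finset.mem_Icc.2 hj)
    · rw [hcoff ε j hj]
      exact ⟨by linarith, by linarith, h1⟩
  have hid : Tendsto (fun ε : ℝ => ε * (B * K)) (𝓝[>] 0) (𝓝 0) := by
    have : Tendsto (fun ε : ℝ => ε) (𝓝[>] 0) (𝓝 0) := tendsto_id.mono_left nhdsWithin_le_nhds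
    simpa using this.mul_const (B * K)
  filter_upwards [hexist, hcev, hid.eventually_le_const (zero_lt_one),
    hid.eventually_le_const (show 0 < δ / 2 by positivity), self_mem_nhdsWithin]
    with ε hex hcε hε1 hε2 hε3
  have hε : (0 : ℝ) < ε := hε3
  have hca : ∀ j, |c ε j| < 1 := fun j => by
    rw [abs_of_nonneg (by linarith [(hcε j).1])]
    exact (hcε j).2.2
  have hdM : ∀ E, ∃ M, ∀ j, |τ * eta (perturb α ε n α' j) E| ≤ M := fun E => by
    refine ⟨|τ * eta α E| + ε * (B * |s E|), fun j => ?_⟩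
    rw [hdiag]
    refine (abs_add_le _ _).trans (add_le_add le_rfl ?_)
    rw [abs_mul, abs_mul, abs_of_pos hε]
    exact mul_le_mul_of_nonneg_left (mul_le_mul_of_nonneg_right (hβB j) (abs_nonneg _)) hε.le
  have hpos : ∀ E ∈ gap α κ k, ∀ W : ℤ → ℝ, Summable (fun j => W j ^ 2) → W 1 = 0 → W ≠ 0 →
      0 < ∑' j, jacobi (c ε) (fun j => τ * eta (perturb α ε n α' j) E) W j * W j := by
    intro E hE W hW hW1 hW0
    obtain ⟨M, hM⟩ := hdM E
    have hx := hE.2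
    refine tsum_jacobi_pos (M := max 1 M) hx hδ0.le hδn
      (fun j => (hca j).le.trans (le_max_left _ _)) (fun j => (hM j).trans (le_max_right _ _))
      (fun j => (hcε j).1) (fun j => (hcε j).2.1) (hcoff ε) (fun j _ => ?_) (fun j hj => ?_)
      hW hW1 hW0
    · rw [hdiag]
      have hxa : |eta α E| = τ * eta α E := by
        rw [← abs_of_pos (show 0 < τ * eta α E by linarith), abs_mul, hτa, one_mul]
      have hsE : |s E| ≤ K * (1 + τ * eta α E) / 2 := by
        have h2 := hK E
        rw [hxa] at h2
        simp only [hs]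
        rw [abs_mul, abs_neg_one_pow, one_mul, abs_div, abs_mul, hτa, one_mul, abs_two]
        linarith
      -- In this bound `1 + τ η` is written as `(τ η - 2 κ) + (1 + 2 κ)`. The first summand costs at
      -- most half the distance to the band edge, however large that is; the second costs at most
      -- `δ`, because `κ < 1`.
      have h3 : |ε * (β j * s E)| ≤ ε * (B * (K * (1 + τ * eta α E) / 2)) := by
        rw [abs_mul, abs_mul, abs_of_pos hε]
        exact mul_le_mul_of_nonneg_left (mul_le_mul (hβB j) hsE (abs_nonneg _) hB0.le) hε.le
      have h4 := neg_abs_le (ε * (β j * s E))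
      have h5 : ε * (B * K) * (τ * eta α E - 2 * κ) ≤ 1 * (τ * eta α E - 2 * κ) :=
        mul_le_mul_of_nonneg_right hε1 (by linarith)
      have h6 : ε * (B * K) * (1 + 2 * κ) ≤ δ / 2 * (1 + 2 * κ) :=
        mul_le_mul_of_nonneg_right hε2 (by linarith)
      nlinarith
    · rw [perturb_of_not hj]
  have hev : ∀ E, sinPi E ≠ 0 → (IsEigenvalue (perturbedHamiltonian α A n α' A' ε) E ↔
      ∃ W : ℤ → ℝ, Summable (fun j => W j ^ 2) ∧ W ≠ 0 ∧
        ∀ j, jacobi (c ε) (fun j => τ * eta (perturb α ε n α' j) E) W j = 0) :=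
    fun E hS => isEigenvalue_iff_jacobi hτ hg hS
  obtain ⟨E, hEseg, hEne, W, hW, hW0, hJW⟩ := hex
  have hEg := hseg E hEseg hEne
  have hES := sinPi_ne_zero hEg.1
  have hJW' : ∀ j, jacobi (c ε) (fun j => τ * eta (perturb α ε n α' j) E) W j = 0 := by
    simp only [hdiag]
    exact hJW
  have hEev := (hev E hES).2 ⟨W, hW, hW0, hJW'⟩
  refine ⟨E, Subset.antisymm (fun F hF => ?_) (singleton_subset_iff.2 ⟨hEg, hEev⟩), ?_⟩
  · obtain ⟨hFg, hFe⟩ := hF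
    have hFS := sinPi_ne_zero hFg.1
    obtain ⟨V, hV, hV0, hJV⟩ := (hev F hFS).1 hFe
    by_contra hne
    obtain ⟨ME, hME⟩ := hdM E
    obtain ⟨MF, hMF⟩ := hdM F
    rcases ratio_sign k hEg.1 hFg.1 (Ne.symm hne) with h | h
    · exact kernel_unique_of_ratio hτ hES hFS hca hMF h (hpos F hFg) hW hV hJW' hJV hW0 hV0
    · exact kernel_unique_of_ratio hτ hFS hES hca hME h (hpos E hEg) hV hW hJV hJW' hV0 hW0
  · refine finrank_eigenspace_eq_one hτ hg hES (fun V hV hJV hV1 => ?_) hEev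
    by_contra hV0
    have h2 := hpos E hEg V hV hV1 hV0
    rw [tsum_congr fun j => by rw [hJV j, zero_mul], tsum_zero] at h2
    exact lt_irrefl _ h2

lemma abs_cos_mul_pi_lt_one {A : ℝ} (hA : ∀ z : ℤ, A ≠ z) : |Real.cos (A * Real.pi)| < 1 := by
  refine lt_of_le_of_ne (Real.abs_cos_le_one _) fun h => ?_
  have h1 : Real.sin (A * Real.pi) = 0 := by
    have h2 := Real.sin_sq_add_cos_sq (A * Real.pi)
    rw [← sq_abs (Real.cos _), h] at h2
    nlinarith
  obtain ⟨z, hz⟩ := Real.sin_eq_zero_iff.1 h1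
  exact hA z (mul_right_cancel₀ Real.pi_ne_zero hz.symm)

lemma cos_mul_pi_ne_zero {A : ℝ} (hA : ∀ z : ℤ, A ≠ z + 1 / 2) : Real.cos (A * Real.pi) ≠ 0 := by
  intro h
  obtain ⟨z, hz⟩ := Real.cos_eq_zero_iff.1 h
  refine hA z (mul_right_cancel₀ Real.pi_ne_zero ?_)
  rw [hz]
  ring

theorem eventually_nthGap_hasOneSimpleEigenvalue {α A : ℝ} (hA : ∀ z : ℤ, A ≠ z)
    (hA2 : ∀ z : ℤ, A ≠ z + 1 / 2) {n : ℕ} {α' A' : ℤ → ℝ}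
    (hA' : ∑ j ∈ Finset.Icc (1 : ℤ) n, A' j = 0) (k : ℕ)
    (hα' : (-1) ^ k * ∑ j ∈ Finset.Icc (1 : ℤ) n, α' j < 0) :
    ∀ᶠ ε in 𝓝[>] (0 : ℝ), ∃ I : Set ℝ,
      IsNthGap (essSpectrum (perturbedHamiltonian α A n α' A' ε)) (k + 1) I ∧
      HasOneSimpleEigenvalueIn (perturbedHamiltonian α A n α' A' ε) I := by
  have h0 := cos_mul_pi_ne_zero hA2
  have h1 := abs_cos_mul_pi_lt_one hA
  filter_upwards [eventually_hasOneSimpleEigenvalueIn_gap (α := α) h0 h1 hA' k hα'] with ε h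
  refine ⟨_, ?_, h⟩
  rw [essSpectrum_perturbedHamiltonian]
  exact isNthGap_periodicHamiltonian h0 h1 k

end ChainGraph

end

theorem mainTheorem9 (α A : ℝ) (hA : ∀ z : ℤ, A ≠ z) (n : ℕ) (α' A' : ℤ → ℝ)
    (hA' : ∑ j ∈ Finset.Icc (1 : ℤ) n, A' j = 0) :
    (∀ ε ∈ Set.Ioo (0 : ℝ) 1,
      ChainGraph.essSpectrum (ChainGraph.perturbedHamiltonian α A n α' A' ε)
        = ChainGraph.essSpectrum (ChainGraph.periodicHamiltonian α A)) ∧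
    ((∀ z : ℤ, A ≠ z + 1 / 2) →
      (∑ j ∈ Finset.Icc (1 : ℤ) n, α' j < 0 →
        ∀ m : ℕ, Odd m → ∀ᶠ ε in 𝓝[>] (0 : ℝ), ∃ I : Set ℝ,
          ChainGraph.IsNthGap
            (ChainGraph.essSpectrum (ChainGraph.perturbedHamiltonian α A n α' A' ε)) m I ∧
          ChainGraph.HasOneSimpleEigenvalueIn
            (ChainGraph.perturbedHamiltonian α A n α' A' ε) I) ∧
      (0 < ∑ j ∈ Finset.Icc (1 : ℤ) n, α' j →
        ∀ m : ℕ, 0 < m → Even m → ∀ᶠ ε in 𝓝[>] (0 : ℝ), ∃ I : Set ℝ,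
          ChainGraph.IsNthGap
            (ChainGraph.essSpectrum (ChainGraph.perturbedHamiltonian α A n α' A' ε)) m I ∧
          ChainGraph.HasOneSimpleEigenvalueIn
            (ChainGraph.perturbedHamiltonian α A n α' A' ε) I)) := by
  refine ⟨fun ε _ => ChainGraph.essSpectrum_perturbedHamiltonian α A n α' A' ε, fun hA2 =>
    ⟨fun hα' m hm => ?_, fun hα' m hm0 hm => ?_⟩⟩
  · obtain ⟨r, rfl⟩ := hm
    -- The gap with index `k` has number `k + 1`, so odd numbers belong to even indices.
    refine ChainGraph.eventually_nthGap_hasOneSimpleEigenvalue hA hA2 hA' (2 * r) ?_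
    rwa [(even_two_mul r).neg_one_pow, one_mul]
  · obtain ⟨k, rfl⟩ : ∃ k, m = k + 1 := ⟨m - 1, by omega⟩
    have hk : Odd k := Nat.even_add_one.1 hm |> Nat.not_even_iff_odd.1
    refine ChainGraph.eventually_nthGap_hasOneSimpleEigenvalue hA hA2 hA' k ?_
    rw [hk.neg_one_pow]
    linarith
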